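/- **Theorem 3.1.** Graphs are finite and simple. For a graph $G$ and a fixed linear order on $V(G)$ let $P_G=\prod_{uv\in E(G),\,u<v}(x_v-x_u)\in\mathbb R[x_v:v\in V(G)]$. The Alon–Tarsi number $AT(G)$ is the least $k$ such that some monomial $\prod_v x_v^{\eta(v)}$ with $\eta(v)<k$ for all $v\in V(G)$ has a nonzero coefficient in $P_G$ (this does not depend on the order). The graph $G$ is $k$-choosable if, for every assignment of a set $L(v)$ of $k$ colours to each vertex $v$, there is a proper colouring $\phi$ of $G$ with $\phi(v)\in L(v)$ for all $v$. It is $k$-paintable if Painter has a winning strategy in the following game: initially every vertex is uncoloured and has $k$ tokens; in each round Lister selects a nonempty set $U$ of uncoloured vertices and takes away one token from each vertex of $U$, and Painter then colours the vertices of some independent set $X\subseteq U$ of $G$; Lister wins if at the end of some round an uncoloured vertex has no token left, and Painter wins once all vertices are coloured. Every planar graph $G$ contains a forest $F$ such that $AT(G-E(F))\le 3$. Moreover, $G-E(F)$ is $3$-paintable and $3$-choosable. -/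

import Mathlib

universe u w

/-! ### Plane drawings and planar graphs -/

/-- A simple polygonal arc in the plane, with corners `corner 0, …, corner n` (`n ≥ 1`): it is the
union of the segments joining consecutive corners; two different segments meet only if
they are consecutive, and then only in their common corner. -/
structure PolygonalArc where
  n : ℕ
  n_pos : 0 < n
  corner : ℕ → ℝ × ℝ
  corner_ne : ∀ i, i < n → corner i ≠ corner (i + 1)
  simple : ∀ i j, i < j → j < n →
    ∀ x ∈ segment ℝ (corner i) (corner (i + 1)) ∩ segment ℝ (corner j) (corner (j + 1)),
      j = i + 1 ∧ x = corner j

/-- The set of points of a polygonal arc. -/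
def PolygonalArc.carrier (A : PolygonalArc) : Set (ℝ × ℝ) :=
  {x | ∃ i, i < A.n ∧ x ∈ segment ℝ (A.corner i) (A.corner (i + 1))}

/-- The unordered pair of the two ends of a polygonal arc. -/
def PolygonalArc.ends (A : PolygonalArc) : Sym2 (ℝ × ℝ) :=
  s(A.corner 0, A.corner A.n)

/-- A drawing of `G` in the plane without crossings: distinct vertices are distinct points, every
edge is a simple polygonal arc joining its two ends and containing no other vertex, and
two distinct edges have no point in common except a common end. -/
structure PlaneDrawing {V : Type*} (G : SimpleGraph V) where
  pos : V → ℝ × ℝ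
  pos_injective : Function.Injective pos
  arc : G.edgeSet → PolygonalArc
  arc_ends : ∀ e : G.edgeSet, (arc e).ends = (e : Sym2 V).map pos
  vertex_mem : ∀ (e : G.edgeSet) (v : V), pos v ∈ (arc e).carrier → v ∈ (e : Sym2 V)
  disjoint : ∀ e f : G.edgeSet, e ≠ f → ∀ x ∈ (arc e).carrier ∩ (arc f).carrier,
    ∃ v : V, v ∈ (e : Sym2 V) ∧ v ∈ (f : Sym2 V) ∧ pos v = x

/-- A graph is planar if it can be drawn in the plane without crossings. -/
def IsPlanar {V : Type*} (G : SimpleGraph V) : Prop :=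
  Nonempty (PlaneDrawing G)

/-! ### The Alon-Tarsi number -/

open Classical in
/-- The graph polynomial `∏_{uv ∈ E(G), u < v} (x_v - x_u)`. -/
noncomputable def graphPolynomial {V : Type*} [Fintype V] [LinearOrder V]
    (G : SimpleGraph V) : MvPolynomial V ℝ :=
  ∏ p : V × V with p.1 < p.2 ∧ G.Adj p.1 p.2, (MvPolynomial.X p.2 - MvPolynomial.X p.1)

/-- The set of all `k` for which some monomial with nonzero coefficient in the graph polynomial
has all its exponents smaller than `k`. -/
def alonTarsiSet {V : Type*} [Fintype V] [LinearOrder V] (G : SimpleGraph V) : Set ℕ :=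
  {k | ∃ η : V →₀ ℕ, (graphPolynomial G).coeff η ≠ 0 ∧ ∀ v, η v < k}

/-- The Alon-Tarsi number: the least element of `alonTarsiSet G`. -/
noncomputable def alonTarsiNumber {V : Type*} [Fintype V] [LinearOrder V]
    (G : SimpleGraph V) : ℕ :=
  sInf (alonTarsiSet G)

/-- The minimum in the definition of the Alon-Tarsi number is taken over a nonempty set. -/
theorem alonTarsiSet_nonempty {V : Type*} [Fintype V] [LinearOrder V]
    (G : SimpleGraph V) : (alonTarsiSet G).Nonempty := by
  classical
  have h : graphPolynomial G ≠ 0 := by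
    unfold graphPolynomial
    refine Finset.prod_ne_zero_iff.2 fun p hp => ?_
    have hp' := (Finset.mem_filter.1 hp).2.1
    exact sub_ne_zero.2 fun h => hp'.ne' (MvPolynomial.X_injective h)
  obtain ⟨η, hη⟩ := MvPolynomial.ne_zero_iff.1 h
  exact ⟨∑ v, η v + 1, η, hη, fun v => Nat.lt_succ_of_le
    (Finset.single_le_sum (f := fun v => η v) (fun _ _ => Nat.zero_le _) (Finset.mem_univ v))⟩

/-! ### Choosability and paintability -/

/-- `G` is `k`-choosable: whenever every vertex `v` is given a set `L v` of `k` permissible colours,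
there is a proper colouring of `G` that gives every vertex one of its permissible colours. -/
def IsChoosable {V : Type u} (G : SimpleGraph V) (k : ℕ) : Prop :=
  ∀ (C : Type w) (L : V → Finset C), (∀ v, (L v).card = k) →
    ∃ φ : G.Coloring C, ∀ v, φ v ∈ L v

/-- `PainterWins G S t`: Painter has a winning strategy in the painting game on `G` from the
position in which `S` is the set of uncoloured vertices and each `v ∈ S` has `t v` tokens left.
Either all vertices are coloured; or every uncoloured vertex has a token left, and `σ` is a
reply of Painter to the nonempty sets `U` of uncoloured vertices that Lister may select: Lister
takes away one token from each vertex of `U`, Painter colours the vertices of the independent set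
`σ U ⊆ U`, and Painter wins from the resulting position. A position in which some uncoloured
vertex has no token left is lost for Painter. -/
inductive PainterWins {V : Type*} [DecidableEq V] (G : SimpleGraph V) :
    Finset V → (V → ℕ) → Prop
  | done (t : V → ℕ) : PainterWins G ∅ t
  | round (S : Finset V) (t : V → ℕ) (tokens : ∀ v ∈ S, 0 < t v)
      (σ : Finset V → Finset V)
      (subset : ∀ U, U ⊆ S → U.Nonempty → σ U ⊆ U)
      (indep : ∀ U, U ⊆ S → U.Nonempty → G.IsIndepSet (σ U : Set V))
      (next : ∀ U, U ⊆ S → U.Nonempty →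
        PainterWins G (S \ σ U) (fun v => if v ∈ U then t v - 1 else t v)) :
      PainterWins G S t

/-- `G` is `k`-paintable: Painter has a winning strategy in the painting game in which all vertices
are initially uncoloured and have `k` tokens each. -/
def IsPaintable {V : Type*} [Fintype V] [DecidableEq V] (G : SimpleGraph V) (k : ℕ) : Prop :=
  PainterWins G Finset.univ (fun _ => k)

/-! The edges of `G` split into a forest `F` and a 2-degenerate graph: for a suitable ranking every
vertex of `G - E(F)` has at most two neighbours of smaller or equal rank. This gives all three
bounds. Colouring greedily by rank settles choosability; kernels taken by rank give Painter's
strategy; and the product of the higher-ranked ends of the edges is a monomial of the graph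
polynomial that cannot cancel.

The splitting is proved by induction in a stronger form, `HasForest`, relative to a triangle `z x
y`: `F` avoids `z` and the edge `x y`, the vertices `x` and `y` are lowest, and any other vertex of
`H - z - E(F)` has at most two neighbours not above it, only one if it is adjacent to `z`. Putting
`z` below everything then yields 2-degeneracy. For the induction, `H` is made edge-maximal, so that
`z x` lies in a second triangle `z x v`. If some triangle `z v a` separates, both sides are treated
by induction and glued (`HasForest.glue`). Otherwise `z` and `v` have at most one common neighbour
`w` besides `x`, since a third would lead by contractions to `K₅` or `K₃₃`
(`IsSpherical.separating_triangle`). Then `v` is contracted into `z`, and afterwards restored just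
above `x` and `y`, with `v w` added to the forest (`HasForest.of_contractPair`).

Planarity is used only through rotation systems satisfying Euler's inequality, with vertices, edges
and faces counted as orbits. Deleting, adding and contracting edges are multiplications by
transpositions that preserve this inequality (`GenusZero.swap_mul`), so no topology of faces is
needed. A polygonal drawing gives such a rotation system by a sweep across its straight segments
(`isSpherical_of_heights`), after which each arc is contracted to a single edge
(`PlaneDrawing.isSpherical_subdivision`). -/

set_option linter.unusedSectionVars false

/-! ### Orbit counts of permutations and the genus-zero inequality -/

section

open Equiv Equiv.Perm

/-- The equivalence relation obtained from `r` by merging the classes of `a` and `b`. -/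
def Setoid.merge {D : Type*} (r : Setoid D) (a b : D) : Setoid D where
  r p q := r p q ∨ (r p a ∧ r q b) ∨ (r p b ∧ r q a)
  iseqv := by
    refine ⟨fun x => Or.inl (r.refl' x), ?_, ?_⟩
    · rintro x y (h | ⟨h, h'⟩ | ⟨h, h'⟩)
      · exact Or.inl (r.symm' h)
      · exact Or.inr (Or.inr ⟨h', h⟩)
      · exact Or.inr (Or.inl ⟨h', h⟩)
    · rintro x y z (h | ⟨h, h'⟩ | ⟨h, h'⟩) (k | ⟨k, k'⟩ | ⟨k, k'⟩)
      · exact Or.inl (r.trans' h k)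
      · exact Or.inr (Or.inl ⟨r.trans' h k, k'⟩)
      · exact Or.inr (Or.inr ⟨r.trans' h k, k'⟩)
      · exact Or.inr (Or.inl ⟨h, r.trans' (r.symm' k) h'⟩)
      · exact Or.inl (r.trans' h (r.trans' (r.symm' k) (r.trans' h' (r.symm' k'))))
      · exact Or.inl (r.trans' h (r.symm' k'))
      · exact Or.inr (Or.inr ⟨h, r.trans' (r.symm' k) h'⟩)
      · exact Or.inl (r.trans' h (r.symm' k'))
      · exact Or.inl (r.trans' h (r.trans' (r.symm' k) (r.trans' h' (r.symm' k'))))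

theorem Setoid.le_merge {D : Type*} (r : Setoid D) (a b : D) : r ≤ r.merge a b :=
  fun _ _ h => Or.inl h

theorem Setoid.merge_pair {D : Type*} (r : Setoid D) (a b : D) : r.merge a b a b :=
  Or.inr (Or.inl ⟨r.refl' a, r.refl' b⟩)

theorem Setoid.merge_le {D : Type*} {r s : Setoid D} {a b : D} (h : r ≤ s) (hab : s a b) :
    r.merge a b ≤ s := by
  rintro p q (hpq | ⟨h1, h2⟩ | ⟨h1, h2⟩)
  · exact h hpq
  · exact s.trans' (h h1) (s.trans' hab (s.symm' (h h2)))
  · exact s.trans' (h h1) (s.trans' (s.symm' hab) (s.symm' (h h2)))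

theorem Setoid.merge_of_rel {D : Type*} {r : Setoid D} {a b : D} (h : r a b) :
    r.merge a b = r :=
  le_antisymm (Setoid.merge_le le_rfl h) (r.le_merge a b)

/-- The class of `b` is absorbed by that of `a`, so the classes other than that of `b` represent the
merged classes exactly once. -/
theorem Setoid.card_merge {D : Type*} [Finite D] (r : Setoid D) {a b : D} (h : ¬ r a b) :
    Nat.card (Quotient (r.merge a b)) + 1 = Nat.card (Quotient r) := by
  classical
  have e : {q : Quotient r // q ≠ Quotient.mk r b} ≃ Quotient (r.merge a b) := by
    refine Equiv.ofBijective
      (fun q => Quotient.map' (s₂ := r.merge a b) id (fun _ _ h => r.le_merge a b h) q.1) ⟨?_, ?_⟩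
    · rintro ⟨p, hp⟩ ⟨q, hq⟩ hpq
      induction p using Quotient.inductionOn with | _ p => ?_
      induction q using Quotient.inductionOn with | _ q => ?_
      have hp' : ¬ r p b := fun h => hp (Quotient.sound h)
      have hq' : ¬ r q b := fun h => hq (Quotient.sound h)
      have : r.merge a b p q := Quotient.exact hpq
      rcases this with h1 | ⟨_, h1⟩ | ⟨h1, _⟩
      · exact Subtype.ext (Quotient.sound h1)
      · exact absurd h1 hq'
      · exact absurd h1 hp'
    · intro q
      induction q using Quotient.inductionOn with | _ q => ?_
      by_cases hq : r q b
      · refine ⟨⟨Quotient.mk r a, fun h' => h (Quotient.exact h')⟩, ?_⟩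
        exact Quotient.sound (s := r.merge a b) (Or.inr (Or.inl ⟨r.refl' a, hq⟩))
      · exact ⟨⟨Quotient.mk r q, fun h' => hq (Quotient.exact h')⟩, rfl⟩
  rw [← Nat.card_congr e]
  have := Fintype.ofFinite (Quotient r)
  rw [Nat.card_eq_fintype_card, Nat.card_eq_fintype_card, Fintype.card_subtype_compl,
    Fintype.card_subtype_eq]
  have : 0 < Fintype.card (Quotient r) := Fintype.card_pos_iff.2 ⟨Quotient.mk r b⟩
  omega

/-! ### Orbits of a permutation multiplied by a transposition -/

variable {D : Type*}

theorem Equiv.Perm.SameCycle.induction_on_setoid {σ : Perm D} {r : Setoid D}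
    (h : ∀ p, r p (σ p)) {p q : D} (hpq : SameCycle σ p q) : r p q := by
  have hn : ∀ n : ℕ, ∀ p, r p ((σ ^ n) p) := by
    intro n
    induction n with
    | zero => exact fun p => r.refl' p
    | succ n ih =>
      intro p
      rw [pow_succ', mul_apply]
      exact r.trans' (ih p) (h _)
  obtain ⟨k, rfl⟩ := hpq
  rcases Int.eq_nat_or_neg k with ⟨n, rfl | rfl⟩
  · simpa using hn n p
  · have := hn n ((σ ^ (-(n : ℤ))) p)
    rw [← mul_apply, zpow_neg, zpow_natCast, mul_inv_cancel] at this
    rw [zpow_neg, zpow_natCast]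
    exact r.symm' this

/-- The orbit relation of a permutation. -/
abbrev orb (σ : Perm D) : Setoid D := SameCycle.setoid σ

theorem orb_apply (σ : Perm D) (p : D) : orb σ p (σ p) := ⟨1, by simp⟩

theorem orb_le {σ : Perm D} {r : Setoid D} (h : ∀ p, r p (σ p)) : orb σ ≤ r :=
  fun _ _ hpq => SameCycle.induction_on_setoid h hpq

variable [DecidableEq D]

theorem orb_swap_mul_le (σ : Perm D) (a b : D) : orb (swap a b * σ) ≤ (orb σ).merge a b := by
  refine orb_le fun p => ?_
  rw [mul_apply, swap_apply_def]
  have := orb_apply σ p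
  split_ifs with h1 h2
  · rw [h1] at this
    exact Or.inr (Or.inl ⟨this, (orb σ).refl' b⟩)
  · rw [h2] at this
    exact Or.inr (Or.inr ⟨this, (orb σ).refl' a⟩)
  · exact Or.inl this

theorem swap_mul_swap_mul (σ : Perm D) (a b : D) : swap a b * (swap a b * σ) = σ := by
  rw [← mul_assoc, swap_mul_self, one_mul]

theorem orb_le_swap_mul (σ : Perm D) (a b : D) : orb σ ≤ (orb (swap a b * σ)).merge a b := by
  have := orb_swap_mul_le (swap a b * σ) a b
  rwa [swap_mul_swap_mul] at this

variable [Finite D]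

/-- The cycle of `a` misses `b`, so the product follows it unchanged until the step that would
return to `a`; that step goes to `b`. -/
theorem orb_swap_mul_of_not (σ : Perm D) {a b : D} (h : ¬ orb σ a b) :
    orb (swap a b * σ) a b := by
  classical
  have hex : ∃ n : ℕ, 0 < n ∧ (σ ^ n) a = a :=
    ⟨orderOf σ, orderOf_pos σ, by rw [pow_orderOf_eq_one]; rfl⟩
  obtain ⟨hN, hNa⟩ := Nat.find_spec hex
  have hmin : ∀ k, 0 < k → k < Nat.find hex → (σ ^ k) a ≠ a := fun k hk hk' h' =>
    Nat.find_min hex hk' ⟨hk, h'⟩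
  set N := Nat.find hex
  have key : ∀ k, k < N → orb (swap a b * σ) a ((σ ^ k) a) := by
    intro k
    induction k with
    | zero => exact fun _ => Setoid.refl' _ _
    | succ k ih =>
      intro hk
      refine Setoid.trans' _ (ih (by omega)) ?_
      have h1 := orb_apply (swap a b * σ) ((σ ^ k) a)
      rw [mul_apply, ← mul_apply σ, ← pow_succ', swap_apply_of_ne_of_ne] at h1
      · exact h1
      · exact hmin _ (by omega) hk
      · exact fun h' => h ⟨(k + 1 : ℕ), by rw [zpow_natCast, h']⟩
  refine Setoid.trans' _ (key (N - 1) (by omega)) ?_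
  have h1 := orb_apply (swap a b * σ) ((σ ^ (N - 1)) a)
  rw [mul_apply, ← mul_apply σ, ← pow_succ', Nat.sub_add_cancel hN, hNa, swap_apply_left] at h1
  exact h1

/-- From `a` up to the first visit to `b` the product agrees with `σ`, and the step that would reach
`b` returns to `a`. This stretch is therefore invariant and misses `b`. -/
theorem not_orb_swap_mul (σ : Perm D) {a b : D} (hab : a ≠ b) (h : orb σ a b) :
    ¬ orb (swap a b * σ) a b := by
  classical
  have hex : ∃ n : ℕ, (σ ^ n) a = b := (SameCycle.exists_nat_pow_eq h)
  have hN := Nat.find_spec hex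
  have hmin : ∀ k, k < Nat.find hex → (σ ^ k) a ≠ b := fun k hk' h' => Nat.find_min hex hk' h'
  set N := Nat.find hex
  have hN0 : 0 < N := Nat.pos_of_ne_zero fun h0 => hab (by rw [← hN, h0]; rfl)
  have hmin' : ∀ k, 0 < k → k < N → (σ ^ k) a ≠ a := by
    intro k hk hk' h'
    refine hmin (N - k) (by omega) ?_
    have : (σ ^ (N - k + k)) a = b := by rw [Nat.sub_add_cancel hk'.le, hN]
    rwa [pow_add, mul_apply, h'] at this
  intro hcon
  let T : Set D := {p | ∃ k, k < N ∧ (σ ^ k) a = p}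
  have hT : ∀ p, p ∈ T → (swap a b * σ) p ∈ T := by
    rintro _ ⟨k, hk, rfl⟩
    rw [mul_apply, ← mul_apply σ, ← pow_succ']
    rcases Nat.lt_or_ge (k + 1) N with hk' | hk'
    · rw [swap_apply_of_ne_of_ne (hmin' _ (by omega) hk') (hmin _ hk')]
      exact ⟨k + 1, hk', rfl⟩
    · rw [show k + 1 = N by omega, hN, swap_apply_right]
      exact ⟨0, hN0, rfl⟩
  obtain ⟨n, hn⟩ := SameCycle.exists_nat_pow_eq hcon
  have : ∀ n : ℕ, ((swap a b * σ) ^ n) a ∈ T := by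
    intro n
    induction n with
    | zero => exact ⟨0, hN0, rfl⟩
    | succ n ih => rw [pow_succ', mul_apply]; exact hT _ ih
  obtain ⟨k, hk, hk'⟩ := this n
  exact hmin k hk (hk'.trans hn)

/-- Multiplying twice by the transposition gives `σ` back, so each orbit relation lies in the merge
of the other one; in the product `a` and `b` are already related, so there the merge is superfluous.
-/
theorem orb_swap_mul_eq (σ : Perm D) {a b : D} (h : ¬ orb σ a b) :
    orb (swap a b * σ) = (orb σ).merge a b := by
  have h1 := orb_swap_mul_of_not σ h
  refine le_antisymm (orb_swap_mul_le σ a b) (Setoid.merge_le ?_ h1)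
  exact (orb_le_swap_mul σ a b).trans (Setoid.merge_of_rel h1).le

theorem card_orb_of_not (σ : Perm D) {a b : D} (h : ¬ orb σ a b) :
    Nat.card (Quotient (orb (swap a b * σ))) + 1 = Nat.card (Quotient (orb σ)) := by
  rw [orb_swap_mul_eq σ h, Setoid.card_merge _ h]

theorem card_orb_of_rel (σ : Perm D) {a b : D} (hab : a ≠ b) (h : orb σ a b) :
    Nat.card (Quotient (orb (swap a b * σ))) = Nat.card (Quotient (orb σ)) + 1 := by
  have := card_orb_of_not (swap a b * σ) (not_orb_swap_mul σ hab h)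
  rw [swap_mul_swap_mul] at this
  exact this.symm

theorem card_orb_le (σ : Perm D) {a b : D} (hab : a ≠ b) :
    Nat.card (Quotient (orb σ)) ≤ Nat.card (Quotient (orb (swap a b * σ))) + 1 := by
  by_cases h : orb σ a b
  · rw [card_orb_of_rel σ hab h]; omega
  · rw [card_orb_of_not σ h]

/-! ### Components and the Euler inequality -/

/-- The components of the hypermap with permutations `σ` and `α`. -/
abbrev comps (σ α : Perm D) : Setoid D := orb σ ⊔ orb α

/-- The Euler characteristic of the hypermap `(σ, α)` is (at least) that of a disjoint union
of spheres. -/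
def GenusZero (σ α : Perm D) : Prop :=
  Nat.card D + 2 * Nat.card (Quotient (comps σ α)) ≤
    Nat.card (Quotient (orb σ)) + Nat.card (Quotient (orb α)) + Nat.card (Quotient (orb (σ * α)))

theorem comps_swap_mul_le {D : Type*} [DecidableEq D] (σ α : Perm D) (a b : D) :
    comps (swap a b * σ) α ≤ (comps σ α).merge a b := by
  refine sup_le ((orb_swap_mul_le σ a b).trans ?_) (le_sup_right.trans (Setoid.le_merge _ a b))
  exact Setoid.merge_le (le_sup_left.trans (Setoid.le_merge _ a b)) (Setoid.merge_pair _ a b)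

theorem comps_le_swap_mul {D : Type*} [DecidableEq D] (σ α : Perm D) (a b : D) :
    comps σ α ≤ (comps (swap a b * σ) α).merge a b := by
  have := comps_swap_mul_le (swap a b * σ) α a b
  rwa [swap_mul_swap_mul] at this

theorem orb_mul_le_comps {D : Type*} (σ α : Perm D) : orb (σ * α) ≤ comps σ α :=
  orb_le fun p => Setoid.trans' _ ((le_sup_right : orb α ≤ _) (orb_apply α p))
    ((le_sup_left : orb σ ≤ comps σ α) (orb_apply σ (α p)))

theorem comps_swap_mul_eq (σ α : Perm D) {a b : D} (h : ¬ comps σ α a b) :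
    comps (swap a b * σ) α = (comps σ α).merge a b := by
  have h1 : comps (swap a b * σ) α a b :=
    (le_sup_left : orb (swap a b * σ) ≤ _)
      (orb_swap_mul_of_not σ fun h' => h ((le_sup_left : orb σ ≤ _) h'))
  refine le_antisymm (comps_swap_mul_le σ α a b) (Setoid.merge_le ?_ h1)
  exact (comps_le_swap_mul σ α a b).trans (Setoid.merge_of_rel h1).le

/-- Splitting a vertex, splitting a face, and joining two components preserve genus zero. -/
theorem GenusZero.swap_mul {σ α : Perm D} (h : GenusZero σ α) {a b : D}
    (hab : orb σ a b ∨ orb (σ * α) a b ∨ ¬ comps σ α a b) : GenusZero (swap a b * σ) α := by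
  rcases eq_or_ne a b with rfl | hne
  · rwa [swap_self, show Equiv.refl D = 1 from rfl, one_mul]
  unfold GenusZero at h ⊢
  rw [mul_assoc]
  by_cases hc : comps σ α a b
  · have hab' : orb σ a b ∨ orb (σ * α) a b := by tauto
    -- If `a` and `b` stay in one component, the components do not change; one of the counts of
    -- vertices and faces grows by one and the other drops by at most one.
    by_cases hc' : comps (swap a b * σ) α a b
    · have e : comps (swap a b * σ) α = comps σ α :=
        le_antisymm ((comps_swap_mul_le σ α a b).trans (Setoid.merge_of_rel hc).le)
          ((comps_le_swap_mul σ α a b).trans (Setoid.merge_of_rel hc').le)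
      rw [e]
      rcases hab' with h1 | h1
      · have := card_orb_of_rel σ hne h1
        have := card_orb_le (σ * α) hne
        omega
      · have := card_orb_of_rel _ hne h1
        have := card_orb_le σ hne
        omega
    -- Otherwise the component breaks in two. Read backwards, this is the joining of two components,
    -- so the counts of components, vertices and faces all grow by one.
    · have e := comps_swap_mul_eq (swap a b * σ) α hc'
      rw [swap_mul_swap_mul] at e
      have h1 := Setoid.card_merge _ hc'
      rw [← e] at h1
      have h2 := card_orb_of_not (swap a b * σ) (a := a) (b := b)
        fun h' => hc' ((le_sup_left : orb (swap a b * σ) ≤ _) h')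
      have h3 := card_orb_of_not (swap a b * σ * α) (a := a) (b := b)
        fun h' => hc' (orb_mul_le_comps _ _ h')
      rw [swap_mul_swap_mul] at h2
      rw [mul_assoc, swap_mul_swap_mul] at h3
      omega
  -- Joining two components lowers the counts of components, vertices and faces by one each.
  · have h1 := Setoid.card_merge _ hc
    rw [← comps_swap_mul_eq σ α hc] at h1
    have h2 := card_orb_of_not σ (a := a) (b := b) fun h' => hc ((le_sup_left : orb σ ≤ _) h')
    have h3 := card_orb_of_not (σ * α) (a := a) (b := b) fun h' => hc (orb_mul_le_comps _ _ h')
    omega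

/-- The starting point of the sweep. Every dart is a vertex, and components and faces are both the
orbits of `α`, so equality holds. -/
theorem genusZero_one {D : Type*} (α : Perm D) : GenusZero 1 α := by
  have e : orb (1 : Perm D) = ⊥ := by
    ext p q
    exact sameCycle_one
  unfold GenusZero
  rw [one_mul, comps, e, bot_sup_eq]
  have : Nat.card (Quotient (⊥ : Setoid D)) = Nat.card D :=
    Nat.card_congr (Equiv.ofBijective (Quotient.mk ⊥)
      ⟨fun _ _ h => Quotient.exact h, Quotient.mk_surjective⟩).symm
  omega

/-- On a finite set the inverse of a permutation is one of its powers, so forward invariance already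
makes `T` a union of components. -/
theorem not_comps_of_invariant {D : Type*} [Finite D] {σ α : Perm D} {T : Set D}
    (hσ : ∀ p ∈ T, σ p ∈ T) (hα : ∀ p ∈ T, α p ∈ T) {a b : D} (ha : a ∈ T) (hb : b ∉ T) :
    ¬ comps σ α a b := by
  have key : ∀ τ : Perm D, (∀ p ∈ T, τ p ∈ T) → orb τ ≤ Setoid.ker (· ∈ T) := by
    intro τ hτ
    refine orb_le fun p => propext ⟨hτ p, fun hp => ?_⟩
    have hn : ∀ n : ℕ, (τ ^ n) (τ p) ∈ T := by
      intro n
      induction n with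
      | zero => exact hp
      | succ n ih => rw [pow_succ', mul_apply]; exact hτ _ ih
    have := hn (orderOf τ - 1)
    rwa [← mul_apply, ← pow_succ, Nat.sub_add_cancel (orderOf_pos τ), pow_orderOf_eq_one] at this
  intro h
  exact hb (((sup_le (key σ hσ) (key α hα) : comps σ α ≤ _) h).to_iff.1 ha)

/-- Removing `d` from its cycle does not disturb the cycles of the other elements. -/
theorem orb_remove {D : Type*} [DecidableEq D] {σ : Perm D} {d p q : D} (hp : p ≠ d) (hq : q ≠ d)
    (h : orb σ p q) : orb (swap d (σ d) * σ) p q := by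
  -- Skipping `d` by way of `f` turns each step of `σ` into at most one step of the product.
  let f : D → D := fun x => if x = d then σ d else x
  have hr : ∀ x, (Setoid.comap f (orb (swap d (σ d) * σ))) x (σ x) := by
    intro x
    rw [Setoid.comap_rel]
    have h1 := orb_apply (swap d (σ d) * σ) x
    rw [mul_apply] at h1
    simp only [f]
    split_ifs with h2 h3 h3
    · exact Setoid.refl' _ _
    · rw [h2]
    · rwa [h3, swap_apply_left] at h1
    · rwa [swap_apply_of_ne_of_ne h3 (fun h' => h2 (σ.injective h'))] at h1
  have := orb_le hr h
  rw [Setoid.comap_rel] at this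
  simpa [f, hp, hq] using this

end

/-! ### Graphs with a rotation system of genus zero -/

section

open Equiv Equiv.Perm

section
variable {V : Type*}

/-- The involution that reverses every dart. -/
abbrev rev (V : Type*) : Perm (V × V) := Equiv.prodComm V V

/-- `σ` is a rotation system of `G` on the darts `V × V`: the darts of `G` leaving a vertex form
one cycle, and pairs that are not darts of `G` are fixed. -/
structure IsRotation (G : SimpleGraph V) (σ : Perm (V × V)) : Prop where
  fst : ∀ p, (σ p).1 = p.1
  fixed : ∀ u v, ¬ G.Adj u v → σ (u, v) = (u, v)
  cycle : ∀ u v w, G.Adj u v → G.Adj u w → orb σ (u, v) (u, w)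

/-- `G` has a rotation system of genus zero. -/
def IsSpherical (G : SimpleGraph V) : Prop :=
  ∃ σ, IsRotation G σ ∧ GenusZero σ (rev V)

variable {G H : SimpleGraph V} {σ : Perm (V × V)}

theorem IsRotation.adj (h : IsRotation G σ) {u v : V} (huv : G.Adj u v) :
    G.Adj u (σ (u, v)).2 := by
  by_contra h'
  have h1 := h.fixed _ _ h'
  have h2 : σ (u, v) = (u, (σ (u, v)).2) := Prod.ext (h.fst _) rfl
  rw [← h2] at h1
  have := σ.injective h1
  rw [this] at h'
  exact h' huv

theorem IsRotation.exists_next (h : IsRotation G σ) {u v : V} (huv : G.Adj u v) :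
    ∃ w, G.Adj u w ∧ σ (u, v) = (u, w) :=
  ⟨_, h.adj huv, Prod.ext (h.fst _) rfl⟩

theorem IsRotation.exists_prev (h : IsRotation G σ) {u v : V} (huv : G.Adj u v) :
    ∃ w, G.Adj u w ∧ σ (u, w) = (u, v) := by
  have h1 : (σ.symm (u, v)).1 = u := by
    rw [← h.fst, Equiv.apply_symm_apply]
  have h2 : σ (u, (σ.symm (u, v)).2) = (u, v) := by
    have h3 : (u, (σ.symm (u, v)).2) = σ.symm (u, v) := Prod.ext h1.symm rfl
    rw [h3, Equiv.apply_symm_apply]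
  refine ⟨_, ?_, h2⟩
  by_contra h'
  have h3 := h.fixed _ _ h'
  rw [h2] at h3
  rw [← (Prod.ext_iff.1 h3).2] at h'
  exact h' huv

/-- The only neighbour of a vertex whose rotation at one dart is trivial. -/
theorem IsRotation.eq_of_fixed (h : IsRotation G σ) {u v w : V} (huv : G.Adj u v)
    (huw : G.Adj u w) (hf : σ (u, v) = (u, v)) : w = v := by
  have := SameCycle.eq_of_left (h.cycle u v w huv huw) hf
  exact (Prod.ext_iff.1 this).2.symm

/-! ### Deleting, adding and contracting edges on the sphere -/

variable [DecidableEq V]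

theorem swap_mul_apply_fst (h : ∀ p, (σ p).1 = p.1) {a b : V × V} (hab : a.1 = b.1) :
    ∀ p, ((swap a b * σ) p).1 = p.1 := by
  intro p
  rw [mul_apply, swap_apply_def]
  split_ifs with h1 h2
  · rw [← hab, ← h1, h]
  · rw [hab, ← h2, h]
  · exact h p

/-- The transposition of a dart with its successor takes the dart out of its cycle and makes it a
fixed, unused one. Both lie in the same cycle, so this only splits a vertex; it is done for the two
darts of the edge in turn. -/
theorem IsSpherical.deleteEdge [Finite V] (h : IsSpherical G) (u v : V) :
    IsSpherical (G.deleteEdges {s(u, v)}) := by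
  obtain ⟨σ, hr, hg⟩ := h
  set σ₁ := swap (u, v) (σ (u, v)) * σ with h₁
  set σ₂ := swap (v, u) (σ₁ (v, u)) * σ₁ with h₂
  have f1 : ∀ p, (σ₁ p).1 = p.1 := swap_mul_apply_fst hr.fst (hr.fst _).symm
  have f2 : ∀ p, (σ₂ p).1 = p.1 := swap_mul_apply_fst f1 (f1 _).symm
  have k1 : ∀ p, σ p = p → σ₁ p = p := by
    intro p hp
    rw [h₁, mul_apply, hp]
    by_cases h' : p = (u, v)
    · rw [← h', hp, swap_self]; rfl
    · refine swap_apply_of_ne_of_ne h' fun h3 => h' (σ.injective (hp.trans h3))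
  have k2 : ∀ p, σ₁ p = p → σ₂ p = p := by
    intro p hp
    rw [h₂, mul_apply, hp]
    by_cases h' : p = (v, u)
    · rw [← h', hp, swap_self]; rfl
    · refine swap_apply_of_ne_of_ne h' fun h3 => h' (σ₁.injective (hp.trans h3))
  have e1 : σ₂ (u, v) = (u, v) := by
    apply k2; rw [h₁, mul_apply, swap_apply_right]
  have e2 : σ₂ (v, u) = (v, u) := by
    rw [h₂, mul_apply, swap_apply_right]
  refine ⟨σ₂, ⟨f2, ?_, ?_⟩, (hg.swap_mul (Or.inl (orb_apply σ _))).swap_mul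
    (Or.inl (orb_apply σ₁ _))⟩
  · intro a b hab
    rw [SimpleGraph.deleteEdges_adj, not_and, not_not, Set.mem_singleton_iff, Sym2.eq_iff] at hab
    by_cases h' : G.Adj a b
    · rcases hab h' with ⟨rfl, rfl⟩ | ⟨rfl, rfl⟩
      · exact e1
      · exact e2
    · exact k2 _ (k1 _ (hr.fixed _ _ h'))
  · intro a b c hab hac
    rw [SimpleGraph.deleteEdges_adj, Set.mem_singleton_iff, Sym2.eq_iff] at hab hac
    refine orb_remove ?_ ?_ (orb_remove ?_ ?_ (hr.cycle a b c hab.1 hac.1))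
    all_goals rw [Ne, Prod.ext_iff]; tauto

theorem IsSpherical.mono [Finite V] (hG : IsSpherical G) (h : H ≤ G) : IsSpherical H := by
  have key : ∀ s : Set (Sym2 V), s.Finite → IsSpherical (G.deleteEdges s) := by
    intro s hs
    induction s, hs using Set.Finite.induction_on with
    | empty => simpa using hG
    | @insert e s _ _ ih =>
      induction e using Sym2.ind with | _ u v => ?_
      have := ih.deleteEdge u v
      rwa [SimpleGraph.deleteEdges_deleteEdges, Set.union_singleton] at this
  have := key (G.edgeSet \ H.edgeSet) (Set.toFinite _)
  convert this using 1
  ext a b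
  rw [SimpleGraph.deleteEdges_adj]
  simp only [Set.mem_sdiff, SimpleGraph.mem_edgeSet, not_and, not_not]
  exact ⟨fun h' => ⟨h h', fun _ => h'⟩, fun h' => h'.2 h'.1⟩

/-- A fixed dart `d ≠ x` is inserted just before `x` in the cycle of `x`; existing relations survive
because distinct cycles are merged. -/
theorem orb_insert [Finite V] {d x : V × V} (hd : σ d = d) {p q : V × V} (h : orb σ p q) :
    orb (swap d x * σ) p q := by
  by_cases hx : orb σ d x
  · have : d = x := SameCycle.eq_of_left hx hd
    rw [this, swap_self]
    exact h
  · rw [orb_swap_mul_eq σ hx]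
    exact Setoid.le_merge _ _ _ h

theorem orb_insert_self [Finite V] {d x : V × V} (hd : σ d = d) :
    orb (swap d x * σ) d x := by
  by_cases hx : orb σ d x
  · have : d = x := SameCycle.eq_of_left hx hd
    rw [this]
  · exact orb_swap_mul_of_not σ hx

/-- Inserting two opposite darts into a rotation of `G` gives a rotation of `G` with one more
edge. -/
theorem IsRotation.sup_edge [Finite V] (hr : IsRotation G σ) {a b x y : V} (hab : a ≠ b)
    (hadj : ¬ G.Adj a b) (hx : G.Adj a x ∨ (x = b ∧ ∀ c, ¬ G.Adj a c))
    (hy : G.Adj b y ∨ (y = a ∧ ∀ c, ¬ G.Adj b c)) :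
    IsRotation (G ⊔ SimpleGraph.edge a b)
      (swap (b, a) (b, y) * (swap (a, b) (a, x) * σ)) := by
  have hd : σ (a, b) = (a, b) := hr.fixed _ _ hadj
  have fix1 : ∀ u v, ¬ G.Adj u v → (u, v) ≠ (a, b) → (swap (a, b) (a, x) * σ) (u, v) = (u, v) := by
    intro u v huv hne
    rw [mul_apply, hr.fixed _ _ huv, swap_apply_of_ne_of_ne hne]
    rintro ⟨⟩
    rcases hx with hx | ⟨rfl, _⟩
    · exact huv hx
    · exact hne rfl
  have he : (swap (a, b) (a, x) * σ) (b, a) = (b, a) :=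
    fix1 _ _ (fun h => hadj h.symm) (fun h => hab (Prod.ext_iff.1 h).2)
  have lift : ∀ {p q}, orb σ p q → orb (swap (b, a) (b, y) * (swap (a, b) (a, x) * σ)) p q :=
    fun h => orb_insert he (orb_insert hd h)
  have ha : ∀ c, G.Adj a c →
      orb (swap (b, a) (b, y) * (swap (a, b) (a, x) * σ)) (a, b) (a, c) := by
    intro c hc
    rcases hx with hx | ⟨_, hx⟩
    · exact Setoid.trans' _ (orb_insert he (orb_insert_self hd)) (lift (hr.cycle _ _ _ hx hc))
    · exact absurd hc (hx c)
  have hb : ∀ c, G.Adj b c →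
      orb (swap (b, a) (b, y) * (swap (a, b) (a, x) * σ)) (b, a) (b, c) := by
    intro c hc
    rcases hy with hy | ⟨_, hy⟩
    · exact Setoid.trans' _ (orb_insert_self he) (lift (hr.cycle _ _ _ hy hc))
    · exact absurd hc (hy c)
  refine ⟨swap_mul_apply_fst (a := (b, a)) (b := (b, y))
    (swap_mul_apply_fst (a := (a, b)) (b := (a, x)) hr.fst rfl) rfl, ?_, ?_⟩
  · intro u v huv
    rw [SimpleGraph.sup_adj, SimpleGraph.edge_adj, not_or] at huv
    have hne1 : (u, v) ≠ (a, b) := by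
      rintro ⟨⟩; exact huv.2 ⟨Or.inl ⟨rfl, rfl⟩, hab⟩
    have hne2 : (u, v) ≠ (b, a) := by
      rintro ⟨⟩; exact huv.2 ⟨Or.inr ⟨rfl, rfl⟩, hab.symm⟩
    rw [mul_apply, fix1 _ _ huv.1 hne1, swap_apply_of_ne_of_ne hne2]
    rintro ⟨⟩
    rcases hy with hy | ⟨rfl, _⟩
    · exact huv.1 hy
    · exact hne2 rfl
  · intro u v w huv huw
    rw [SimpleGraph.sup_adj, SimpleGraph.edge_adj] at huv huw
    rcases huv with huv | ⟨⟨rfl, rfl⟩ | ⟨rfl, rfl⟩, hne⟩ <;>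
      rcases huw with huw | ⟨⟨h1, rfl⟩ | ⟨h1, rfl⟩, _⟩
    · exact lift (hr.cycle _ _ _ huv huw)
    · subst h1; exact Setoid.symm' _ (ha _ huv)
    · subst h1; exact Setoid.symm' _ (hb _ huv)
    · exact ha _ huw
    · exact Setoid.refl' _ _
    · exact absurd h1 hne
    · exact hb _ huw
    · exact absurd h1 hne
    · exact Setoid.refl' _ _

/-- A pair of opposite fixed darts is a component of its own. -/
theorem not_comps_of_fixed [Finite V] {a b : V} (h1 : σ (a, b) = (a, b)) (h2 : σ (b, a) = (b, a))
    {p : V × V} (hp1 : p ≠ (a, b)) (hp2 : p ≠ (b, a)) : ¬ comps σ (rev V) (a, b) p := by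
  refine not_comps_of_invariant (T := {p | p = (a, b) ∨ p = (b, a)}) ?_ ?_ (Or.inl rfl)
    (fun h => h.elim hp1 hp2)
  · rintro p (rfl | rfl)
    · exact Or.inl h1
    · exact Or.inr h2
  · rintro p (rfl | rfl)
    · exact Or.inr rfl
    · exact Or.inl rfl

/-- Consecutive neighbours `z`, `w` of a vertex `v` can be joined by an edge. -/
theorem IsRotation.isSpherical_sup_corner [Finite V] (hr : IsRotation G σ)
    (hg : GenusZero σ (rev V)) {v z w : V} (hvz : G.Adj v z) (hσ : σ (v, z) = (v, w))
    (hzw : z ≠ w) : IsSpherical (G ⊔ SimpleGraph.edge z w) := by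
  by_cases hadj : G.Adj z w
  · rw [sup_eq_left.2 ((SimpleGraph.edge_le_iff _).2 (Or.inr hadj))]
    exact ⟨σ, hr, hg⟩
  have hvw : G.Adj v w := by simpa [hσ] using hr.adj hvz
  obtain ⟨y, hwy, hy⟩ := hr.exists_next hvw.symm
  have hd : σ (z, w) = (z, w) := hr.fixed _ _ hadj
  have he : σ (w, z) = (w, z) := hr.fixed _ _ fun h => hadj h.symm
  refine ⟨_, hr.sup_edge hzw hadj (Or.inl hvz.symm) (Or.inl hwy), ?_⟩
  -- The first insertion joins the component of the two unused darts to the rest. The second splits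
  -- a face: around the new triangle, the face permutation leads from `(w, z)` to `(w, y)` in three
  -- steps.
  refine (hg.swap_mul (Or.inr (Or.inr ?_))).swap_mul (Or.inr (Or.inl ?_))
  · exact not_comps_of_fixed hd he (fun h => hvw.ne (Prod.ext_iff.1 h).2)
      (fun h => hzw (Prod.ext_iff.1 h).1)
  · set τ := swap (z, w) (z, v) * σ * rev V with hτ
    have t1 : τ (w, z) = (z, v) := by
      simp [hτ, mul_apply, hd]
    have t2 : τ (z, v) = (v, w) := by
      simp only [hτ, mul_apply, Equiv.prodComm_apply, Prod.swap_prod_mk, hσ]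
      exact swap_apply_of_ne_of_ne (fun h => hvz.ne (Prod.ext_iff.1 h).1)
        (fun h => hvz.ne (Prod.ext_iff.1 h).1)
    have t3 : τ (v, w) = (w, y) := by
      simp only [hτ, mul_apply, Equiv.prodComm_apply, Prod.swap_prod_mk, hy]
      exact swap_apply_of_ne_of_ne (fun h => hzw (Prod.ext_iff.1 h).1.symm)
        (fun h => hzw (Prod.ext_iff.1 h).1.symm)
    have o1 := orb_apply τ (w, z)
    have o2 := orb_apply τ (z, v)
    have o3 := orb_apply τ (v, w)
    rw [t1] at o1
    rw [t2] at o2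
    rw [t3] at o3
    exact Setoid.trans' _ o1 (Setoid.trans' _ o2 o3)

/-- Vertices in different components can be joined by an edge. -/
theorem IsSpherical.sup_edge_of_closed [Finite V] (hG : IsSpherical G) {S : Set V}
    (hS : ∀ u ∈ S, ∀ v, G.Adj u v → v ∈ S) {a b : V} (ha : a ∈ S) (hb : b ∉ S) :
    IsSpherical (G ⊔ SimpleGraph.edge a b) := by
  obtain ⟨σ, hr, hg⟩ := hG
  have hab : a ≠ b := fun h => hb (h ▸ ha)
  have hadj : ¬ G.Adj a b := fun h => hb (hS _ ha _ h)
  -- At an isolated vertex there is no dart to insert next to; the fallback value makes the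
  -- transposition trivial.
  have hdart : ∀ u v : V, ∃ x, G.Adj u x ∨ (x = v ∧ ∀ c, ¬ G.Adj u c) := by
    intro u v
    by_cases h : ∃ c, G.Adj u c
    · exact ⟨_, Or.inl h.choose_spec⟩
    · exact ⟨v, Or.inr ⟨rfl, not_exists.1 h⟩⟩
  obtain ⟨x, hx⟩ := hdart a b
  obtain ⟨y, hy⟩ := hdart b a
  have hd : σ (a, b) = (a, b) := hr.fixed _ _ hadj
  have he : σ (b, a) = (b, a) := hr.fixed _ _ fun h => hadj h.symm
  refine ⟨_, hr.sup_edge hab hadj hx hy, ?_⟩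
  refine GenusZero.swap_mul ?_ ?_
  · by_cases hxb : x = b
    · rw [hxb, swap_self, show Equiv.refl (V × V) = 1 from rfl, one_mul]
      exact hg
    · exact hg.swap_mul (Or.inr (Or.inr (not_comps_of_fixed hd he
        (fun h => hxb (Prod.ext_iff.1 h).2) (fun h => hab (Prod.ext_iff.1 h).1))))
  by_cases hya : y = a
  · rw [hya]; exact Or.inl (Setoid.refl' _ _)
  refine Or.inr (Or.inr ?_)
  -- After the first insertion, the pairs inside `S` together with the two new darts are still
  -- invariant, and `(b, y)` is not among them.
  have key : ∀ p : V × V, (p.1 ∈ S ∧ p.2 ∈ S) ∨ p = (a, b) ∨ p = (b, a) →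
      ((swap (a, b) (a, x) * σ) p).1 ∈ S ∧ ((swap (a, b) (a, x) * σ) p).2 ∈ S ∨
      (swap (a, b) (a, x) * σ) p = (a, b) ∨ (swap (a, b) (a, x) * σ) p = (b, a) := by
    have hsw : ∀ p : V × V, (p.1 ∈ S ∧ p.2 ∈ S) ∨ p = (a, b) ∨ p = (b, a) →
        ((swap (a, b) (a, x) p).1 ∈ S ∧ (swap (a, b) (a, x) p).2 ∈ S) ∨
        swap (a, b) (a, x) p = (a, b) ∨ swap (a, b) (a, x) p = (b, a) := by
      intro p hp
      rw [swap_apply_def]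
      split_ifs with h1 h2
      · rcases hx with hx | ⟨rfl, _⟩
        · exact Or.inl ⟨ha, hS _ ha _ hx⟩
        · exact Or.inr (Or.inl rfl)
      · exact Or.inr (Or.inl rfl)
      · exact hp
    intro p hp
    rw [mul_apply]
    refine hsw _ ?_
    rcases hp with ⟨h1, h2⟩ | rfl | rfl
    · obtain ⟨u, v⟩ := p
      by_cases huv : G.Adj u v
      · refine Or.inl ⟨?_, hS _ h1 _ (hr.adj huv)⟩
        rw [hr.fst]; exact h1
      · rw [hr.fixed _ _ huv]; exact Or.inl ⟨h1, h2⟩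
    · exact Or.inr (Or.inl hd)
    · exact Or.inr (Or.inr he)
  refine not_comps_of_invariant
    (T := {p : V × V | (p.1 ∈ S ∧ p.2 ∈ S) ∨ p = (a, b) ∨ p = (b, a)}) ?_ ?_
    (Or.inr (Or.inr rfl)) ?_
  · exact key
  · rintro p (⟨h1, h2⟩ | rfl | rfl)
    · exact Or.inl ⟨h2, h1⟩
    · exact Or.inr (Or.inr rfl)
    · exact Or.inr (Or.inl rfl)
  · rintro (h | h | h)
    · exact hb h.1
    · exact hab (Prod.ext_iff.1 h).1.symm
    · exact hya (Prod.ext_iff.1 h).2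

/-- The graph obtained from `G` by contracting the pair `z v` to `z`; the vertex `v` is kept as an
isolated vertex. -/
def contractPair (G : SimpleGraph V) (z v : V) : SimpleGraph V where
  Adj a b := a ≠ b ∧ a ≠ v ∧ b ≠ v ∧ (G.Adj a b ∨ (a = z ∧ G.Adj v b) ∨ (b = z ∧ G.Adj v a))
  symm := ⟨fun a b ⟨h1, h2, h3, h4⟩ => ⟨h1.symm, h3, h2, by
    rcases h4 with h | h | h
    · exact Or.inl h.symm
    · exact Or.inr (Or.inr h)
    · exact Or.inr (Or.inl h)⟩⟩
  loopless := ⟨fun _ h => h.1 rfl⟩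

theorem contractPair_adj {z v a b : V} : (contractPair G z v).Adj a b ↔
    a ≠ b ∧ a ≠ v ∧ b ≠ v ∧ (G.Adj a b ∨ (a = z ∧ G.Adj v b) ∨ (b = z ∧ G.Adj v a)) := Iff.rfl

/-- If `w` follows `z` in the rotation at `v`, the edge `z w` is drawn into that corner and `v w` is
deleted. This moves an edge from `v` to `z` without losing anything in the contraction, and lowers
the degree of `v`. When `z` is the only neighbour of `v`, the contraction is a subgraph. -/
theorem IsSpherical.contractPair [Finite V] {z v : V} (hG : IsSpherical G) (hzv : G.Adj z v) :
    IsSpherical (contractPair G z v) := by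
  induction hn : (G.neighborSet v).ncard using Nat.strong_induction_on generalizing G with
  | _ n ih =>
  obtain ⟨σ, hr, hg⟩ := hG
  obtain ⟨w, hvw, hw⟩ := hr.exists_next hzv.symm
  by_cases hwz : w = z
  · subst hwz
    refine IsSpherical.mono ⟨σ, hr, hg⟩ fun a b h => ?_
    have huniq : ∀ c, G.Adj v c → c = w := fun c hc => hr.eq_of_fixed hzv.symm hc hw
    obtain ⟨h1, h2, h3, h4 | ⟨h4, h5⟩ | ⟨h4, h5⟩⟩ := h
    · exact h4
    · exact absurd (h4.trans (huniq _ h5).symm) h1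
    · exact absurd ((huniq _ h5).trans h4.symm) h1
  · have hG' := (hr.isSpherical_sup_corner hg hzv.symm hw (Ne.symm hwz)).deleteEdge v w
    set G' := (G ⊔ SimpleGraph.edge z w).deleteEdges {s(v, w)} with hG'def
    have adj' : ∀ a b, G'.Adj a b ↔ (G.Adj a b ∨ ((z = a ∧ w = b ∨ z = b ∧ w = a) ∧ a ≠ b)) ∧
        ¬ (v = a ∧ w = b ∨ v = b ∧ w = a) := by
      intro a b
      rw [hG'def, SimpleGraph.deleteEdges_adj, SimpleGraph.sup_adj, SimpleGraph.edge_adj,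
        Set.mem_singleton_iff, eq_comm (a := s(a, b)), Sym2.eq_iff]
      tauto
    have hzv' : G'.Adj z v := (adj' _ _).2 ⟨Or.inl hzv, by
      rintro (⟨h1, _⟩ | ⟨_, h1⟩)
      · exact hzv.ne h1.symm
      · exact hwz h1⟩
    have hlt : (G'.neighborSet v).ncard < n := by
      rw [← hn]
      refine Set.ncard_lt_ncard ?_ (Set.toFinite _)
      refine ⟨fun c hc => ?_, fun h => ?_⟩
      · rcases ((adj' _ _).1 hc).1 with h | ⟨⟨h, _⟩ | ⟨h, h'⟩, _⟩
        · exact h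
        · exact absurd h hzv.ne
        · exact absurd h' hvw.ne'
      · exact ((adj' _ _).1 (h hvw)).2 (Or.inl ⟨rfl, rfl⟩)
    refine (ih _ hlt hG' hzv' rfl).mono fun a b h => ?_
    rw [contractPair_adj] at h ⊢
    have hvw' := hvw.ne
    have hzv' := hzv.ne
    simp only [adj']
    refine ⟨h.1, h.2.1, h.2.2.1, ?_⟩
    obtain ⟨h1, h2, h3, h4 | ⟨rfl, h5⟩ | ⟨rfl, h5⟩⟩ := h
    · exact Or.inl ⟨Or.inl h4, by tauto⟩
    · by_cases hbw : b = w
      · subst hbw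
        exact Or.inl ⟨Or.inr ⟨Or.inl ⟨rfl, rfl⟩, h1⟩, by tauto⟩
      · refine Or.inr (Or.inl ⟨rfl, Or.inl h5, ?_⟩)
        rintro (⟨_, h⟩ | ⟨h, _⟩)
        · exact hbw h.symm
        · exact h3 h.symm
    · by_cases haw : a = w
      · subst haw
        exact Or.inl ⟨Or.inr ⟨Or.inr ⟨rfl, rfl⟩, h1⟩, by tauto⟩
      · refine Or.inr (Or.inr ⟨rfl, Or.inl h5, ?_⟩)
        rintro (⟨_, h⟩ | ⟨h, _⟩)
        · exact haw h.symm
        · exact h2 h.symm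

end

/-! ### Nonplanarity of `K₅` and `K₃₃` -/

/-- The number of classes of an equivalence relation as a sum over all elements. -/
theorem Setoid.card_quotient_eq_sum {D : Type*} [Fintype D] (r : Setoid D) :
    (Nat.card (Quotient r) : ℚ) = ∑ d, 1 / (Nat.card {e // r d e} : ℚ) := by
  classical
  rw [Nat.card_eq_fintype_card, ← Finset.card_univ, Finset.cast_card,
    ← Finset.sum_fiberwise (s := Finset.univ) (g := fun d : D => Quotient.mk r d)]
  refine Finset.sum_congr rfl fun q _ => ?_
  induction q using Quotient.inductionOn with | _ d => ?_
  have h1 : ∀ e ∈ Finset.univ.filter (fun e => Quotient.mk r e = Quotient.mk r d),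
      (1 : ℚ) / (Nat.card {f // r e f} : ℚ) = 1 / (Nat.card {f // r d f} : ℚ) := by
    intro e he
    have he' : r e d := Quotient.exact (Finset.mem_filter.1 he).2
    have : (fun f => r e f) = fun f => r d f := funext fun f =>
      propext ⟨fun h => r.trans' (r.symm' he') h, fun h => r.trans' he' h⟩
    rw [this]
  rw [Finset.sum_congr rfl h1, Finset.sum_const, nsmul_eq_mul]
  have h2 : (Finset.univ.filter (fun e => Quotient.mk r e = Quotient.mk r d)).card =
      Nat.card {f // r d f} := by
    rw [Nat.card_eq_fintype_card, Fintype.card_subtype]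
    congr 1
    ext e
    simp only [Finset.mem_filter, Finset.mem_univ, true_and]
    exact ⟨fun h => r.symm' (Quotient.exact h), fun h => Quotient.sound (r.symm' h)⟩
  rw [h2, mul_one_div, div_self]
  have : Nonempty {f // r d f} := ⟨⟨d, r.refl' d⟩⟩
  exact_mod_cast Nat.card_pos.ne'

section
variable {V : Type*} [Fintype V] [DecidableEq V] {G : SimpleGraph V} {σ : Perm (V × V)}

theorem card_le_card_class {D : Type*} [Finite D] (r : Setoid D) {d : D} (t : Finset D)
    (h : ∀ e ∈ t, r d e) : t.card ≤ Nat.card {e // r d e} := by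
  have := Fintype.ofFinite D
  classical
  rw [Nat.card_eq_fintype_card, Fintype.card_subtype]
  exact Finset.card_le_card fun e he => Finset.mem_filter.2 ⟨Finset.mem_univ _, h e he⟩

theorem card_class_le {D : Type*} [Finite D] (r : Setoid D) {d : D} (t : Finset D)
    (h : ∀ e, r d e → e ∈ t) : Nat.card {e // r d e} ≤ t.card := by
  have := Fintype.ofFinite D
  classical
  rw [Nat.card_eq_fintype_card, Fintype.card_subtype]
  exact Finset.card_le_card fun e he => h e (Finset.mem_filter.1 he).2

theorem card_class_pos {D : Type*} [Finite D] (r : Setoid D) (d : D) :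
    0 < Nat.card {e // r d e} := by
  have : Nonempty {e // r d e} := ⟨⟨d, r.refl' d⟩⟩
  exact Nat.card_pos

/-- The Euler inequality for a nonempty graph of genus zero with `N` darts, minimum degree at least
`m` and faces of length at least `k`. -/
theorem IsRotation.two_le (hr : IsRotation G σ) (hg : GenusZero σ (rev V)) {m k : ℕ} (hm : 0 < m)
    (hk : 0 < k) (A : Finset (V × V)) (hA : ∀ u v, (u, v) ∈ A ↔ G.Adj u v) (hne : A.Nonempty)
    (hdeg : ∀ p ∈ A, m ≤ Nat.card {e // orb σ p e})
    (hface : ∀ p ∈ A, k ≤ Nat.card {e // orb (σ * rev V) p e}) :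
    (2 : ℚ) ≤ A.card * (1 / m + 1 / k - 1 / 2) := by
  have hrev : ∀ u v : V, u ≠ v → 2 ≤ Nat.card {e // orb (rev V) (u, v) e} := by
    intro u v huv
    rw [← Finset.card_pair (show (u, v) ≠ (v, u) from fun h => huv (Prod.ext_iff.1 h).1)]
    refine card_le_card_class _ _ fun e he => ?_
    simp only [Finset.mem_insert, Finset.mem_singleton] at he
    rcases he with rfl | rfl
    · exact Setoid.refl' _ _
    · exact orb_apply (rev V) (u, v)
  have hmul : ∀ u v, ¬ G.Adj u v → (σ * rev V) (u, v) = (v, u) := fun u v h =>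
    hr.fixed v u fun h' => h h'.symm
  have inv : ∀ {a b : ℕ}, 0 < a → a ≤ b → (1 : ℚ) / b ≤ 1 / a := fun ha hab =>
    one_div_le_one_div_of_le (by exact_mod_cast ha) (by exact_mod_cast hab)
  -- A pair of opposite unused darts is a component with two vertices, one edge and one face; a
  -- diagonal dart is one with one of each. Hence unused darts add nothing positive to the excess.
  have hdummy : ∀ p ∉ A, (1 : ℚ) / Nat.card {e // orb σ p e} +
      1 / Nat.card {e // orb (rev V) p e} + 1 / Nat.card {e // orb (σ * rev V) p e} - 1 -
      2 * (1 / Nat.card {e // comps σ (rev V) p e}) ≤ 0 := by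
    rintro ⟨u, v⟩ hp
    rw [hA] at hp
    have h1 := inv one_pos (card_class_pos (orb σ) (u, v))
    have hcomp : ∀ e, comps σ (rev V) (u, v) e → e ∈ ({(u, v), (v, u)} : Finset (V × V)) := by
      intro e he
      by_contra h
      simp only [Finset.mem_insert, Finset.mem_singleton, not_or] at h
      exact not_comps_of_fixed (hr.fixed _ _ hp) (hr.fixed _ _ fun h => hp h.symm) h.1 h.2 he
    have h4 := card_class_le _ _ hcomp
    have hpos := card_class_pos (comps σ (rev V)) (u, v)
    by_cases huv : u = v
    · subst huv
      simp only [Finset.pair_eq_singleton, Finset.card_singleton] at h4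
      have h4' := inv hpos h4
      have h2 := inv one_pos (card_class_pos (orb (rev V)) (u, u))
      have h3 := inv one_pos (card_class_pos (orb (σ * rev V)) (u, u))
      norm_num at h1 h2 h3 h4' ⊢
      linarith
    · have h4' := inv hpos (h4.trans Finset.card_le_two)
      have h2 := inv two_pos (hrev u v huv)
      have h3 : 2 ≤ Nat.card {e // orb (σ * rev V) (u, v) e} := by
        rw [← Finset.card_pair (show (u, v) ≠ (v, u) from fun h => huv (Prod.ext_iff.1 h).1)]
        refine card_le_card_class _ _ fun e he => ?_
        simp only [Finset.mem_insert, Finset.mem_singleton] at he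
        rcases he with rfl | rfl
        · exact Setoid.refl' _ _
        · have := orb_apply (σ * rev V) (u, v)
          rwa [hmul u v hp] at this
      have h3' := inv two_pos h3
      norm_num at h1 h2 h3' h4' ⊢
      linarith
  -- `A` is invariant, so the component of a dart of `A` has at most `A.card` darts, and summed over
  -- `A` the component terms amount to at least 2.
  have hactive : ∀ p ∈ A, (1 : ℚ) / Nat.card {e // orb σ p e} +
      1 / Nat.card {e // orb (rev V) p e} + 1 / Nat.card {e // orb (σ * rev V) p e} - 1 -
      2 * (1 / Nat.card {e // comps σ (rev V) p e}) ≤ (1 / m + 1 / k - 1 / 2) - 2 / A.card := by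
    rintro ⟨u, v⟩ hp
    have huv := (hA u v).1 hp
    have h1 := inv hm (hdeg _ hp)
    have h2 := inv two_pos (hrev u v huv.ne)
    have h3 := inv hk (hface _ hp)
    have h4 : Nat.card {e // comps σ (rev V) (u, v) e} ≤ A.card := by
      refine card_class_le _ _ fun e he => ?_
      by_contra hcon
      refine not_comps_of_invariant (T := {p | p ∈ A}) ?_ ?_ hp hcon he
      · rintro ⟨a, b⟩ hab
        have h' := hr.adj ((hA a b).1 hab)
        have h2 : σ (a, b) = (a, (σ (a, b)).2) := Prod.ext (hr.fst _) rfl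
        rw [h2]
        exact (hA _ _).2 h'
      · rintro ⟨a, b⟩ hab
        exact (hA _ _).2 ((hA a b).1 hab).symm
    have h4' := inv (card_class_pos (comps σ (rev V)) (u, v)) h4
    have e2 : (2 : ℚ) / A.card = 2 * (1 / A.card) := by ring
    rw [e2]
    norm_num at h1 h2 h3 h4' ⊢
    linarith
  have hsum : (0 : ℚ) ≤ ∑ p : V × V, ((1 : ℚ) / Nat.card {e // orb σ p e} +
      1 / Nat.card {e // orb (rev V) p e} + 1 / Nat.card {e // orb (σ * rev V) p e} - 1 -
      2 * (1 / Nat.card {e // comps σ (rev V) p e})) := by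
    unfold GenusZero at hg
    have hg' : (Nat.card (V × V) : ℚ) + 2 * Nat.card (Quotient (comps σ (rev V))) ≤
      Nat.card (Quotient (orb σ)) + Nat.card (Quotient (orb (rev V))) +
      Nat.card (Quotient (orb (σ * rev V))) := by exact_mod_cast hg
    simp only [Setoid.card_quotient_eq_sum] at hg'
    simp only [Finset.sum_sub_distrib, Finset.sum_add_distrib, ← Finset.mul_sum, Finset.sum_const,
      Finset.card_univ, nsmul_eq_mul, mul_one]
    rw [Nat.card_eq_fintype_card] at hg'
    linarith
  rw [← Finset.sum_add_sum_compl A] at hsum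
  have s1 := Finset.sum_le_sum hactive
  have s2 := Finset.sum_nonpos (s := Aᶜ) fun p hp => hdummy p (Finset.mem_compl.1 hp)
  rw [Finset.sum_const, nsmul_eq_mul] at s1
  have hN : (0 : ℚ) < A.card := by exact_mod_cast hne.card_pos
  have e3 : (A.card : ℚ) * (1 / m + 1 / k - 1 / 2 - 2 / A.card) =
      A.card * (1 / m + 1 / k - 1 / 2) - 2 := by field_simp
  linarith

/-- A vertex with at least two neighbours is passed by every face without turning back. -/
theorem IsRotation.face_step (hr : IsRotation G σ) {a b c : V} (hab : G.Adj a b) (hbc : G.Adj b c)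
    (hca : c ≠ a) : ∃ d, (σ * rev V) (a, b) = (b, d) ∧ G.Adj b d ∧ d ≠ a := by
  obtain ⟨d, hd, hσ⟩ := hr.exists_next hab.symm
  refine ⟨d, hσ, hd, ?_⟩
  rintro rfl
  exact hca (hr.eq_of_fixed hab.symm hbc hσ)

theorem IsRotation.card_le_card_orb (hr : IsRotation G σ) {u v : V} (huv : G.Adj u v)
    (t : Finset V) (ht : ∀ w ∈ t, G.Adj u w) : t.card ≤ Nat.card {e // orb σ (u, v) e} := by
  have : t.card = (t.image fun w => (u, w)).card :=
    (Finset.card_image_of_injective _ fun a b h => (Prod.ext_iff.1 h).2).symm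
  rw [this]
  refine card_le_card_class _ _ fun e he => ?_
  obtain ⟨w, hw, rfl⟩ := Finset.mem_image.1 he
  exact hr.cycle _ _ _ huv (ht w hw)

/-- Five pairwise adjacent vertices do not occur on the sphere. -/
theorem IsSpherical.not_complete_five (hG : IsSpherical G) (S : Finset V) (hS : S.card = 5) :
    ¬ ∀ a ∈ S, ∀ b ∈ S, a ≠ b → G.Adj a b := by
  intro hadj
  let K : SimpleGraph V :=
    { Adj := fun a b => a ∈ S ∧ b ∈ S ∧ a ≠ b
      symm := ⟨fun a b h => ⟨h.2.1, h.1, h.2.2.symm⟩⟩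
      loopless := ⟨fun a h => h.2.2 rfl⟩ }
  obtain ⟨σ, hr, hg⟩ := hG.mono (H := K) fun a b h => hadj a h.1 b h.2.1 h.2.2
  have hcard : S.offDiag.card = 20 := by rw [Finset.offDiag_card, hS]
  have hK : ∀ {u v}, K.Adj u v ↔ u ∈ S ∧ v ∈ S ∧ u ≠ v := Iff.rfl
  have := hr.two_le hg (m := 4) (k := 3) (by norm_num) (by norm_num) S.offDiag
    (fun u v => by rw [Finset.mem_offDiag])
    (Finset.card_pos.1 (by omega)) ?_ ?_
  -- The inequality would read `2 ≤ 20 (1/4 + 1/3 - 1/2) = 5/3`.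
  · rw [hcard] at this
    norm_num at this
  · rintro ⟨u, v⟩ hp
    rw [Finset.mem_offDiag] at hp
    have h4 : (S.erase u).card = 4 := by rw [Finset.card_erase_of_mem hp.1, hS]
    rw [← h4]
    exact hr.card_le_card_orb (hK.2 hp) _ fun w hw =>
      hK.2 ⟨hp.1, Finset.mem_of_mem_erase hw, (Finset.ne_of_mem_erase hw).symm⟩
  · have step : ∀ a b, K.Adj a b → ∃ d, (σ * rev V) (a, b) = (b, d) ∧ K.Adj b d ∧ d ≠ a := by
      intro a b hab
      have : ((S.erase a).erase b).Nonempty := by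
        rw [← Finset.card_pos, Finset.card_erase_of_mem
          (Finset.mem_erase.2 ⟨hab.2.2.symm, hab.2.1⟩), Finset.card_erase_of_mem hab.1, hS]
        norm_num
      obtain ⟨c, hc⟩ := this
      simp only [Finset.mem_erase] at hc
      exact hr.face_step hab (hK.2 ⟨hab.2.1, hc.2.2, hc.1.symm⟩) hc.2.1
    rintro ⟨u, v⟩ hp
    rw [Finset.mem_offDiag] at hp
    obtain ⟨w, h1, hvw, hwu⟩ := step u v hp
    obtain ⟨x, h2, hwx, _⟩ := step v w hvw
    have hc : ({(u, v), (v, w), (w, x)} : Finset (V × V)).card = 3 := by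
      rw [Finset.card_insert_of_notMem, Finset.card_pair]
      · exact fun h => hvw.ne (Prod.ext_iff.1 h).1
      · simp only [Finset.mem_insert, Finset.mem_singleton, not_or, Prod.mk.injEq]
        exact ⟨fun h => hp.2.2 h.1, fun h => hwu h.1.symm⟩
    rw [← hc]
    have o1 := orb_apply (σ * rev V) (u, v)
    have o2 := orb_apply (σ * rev V) (v, w)
    rw [h1] at o1
    rw [h2] at o2
    refine card_le_card_class _ _ fun e he => ?_
    simp only [Finset.mem_insert, Finset.mem_singleton] at he
    rcases he with rfl | rfl | rfl
    · exact Setoid.refl' _ _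
    · exact o1
    · exact Setoid.trans' _ o1 o2

/-- Three vertices with three common neighbours do not occur on the sphere. -/
theorem IsSpherical.not_complete_bipartite (hG : IsSpherical G) (S T : Finset V) (hS : S.card = 3)
    (hT : T.card = 3) (hST : Disjoint S T) : ¬ ∀ a ∈ S, ∀ b ∈ T, G.Adj a b := by
  intro hadj
  let K : SimpleGraph V :=
    { Adj := fun a b => (a ∈ S ∧ b ∈ T) ∨ (a ∈ T ∧ b ∈ S)
      symm := ⟨fun a b h => h.elim (fun h => Or.inr ⟨h.2, h.1⟩) (fun h => Or.inl ⟨h.2, h.1⟩)⟩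
      loopless := ⟨fun a h => h.elim (fun h => Finset.disjoint_left.1 hST h.1 h.2)
        (fun h => Finset.disjoint_left.1 hST h.2 h.1)⟩ }
  obtain ⟨σ, hr, hg⟩ := hG.mono (H := K) fun a b h =>
    h.elim (fun h => hadj a h.1 b h.2) (fun h => (hadj b h.2 a h.1).symm)
  have hK : ∀ {u v}, K.Adj u v ↔ (u ∈ S ∧ v ∈ T) ∨ (u ∈ T ∧ v ∈ S) := Iff.rfl
  have hdis : ∀ {a}, a ∈ S → a ∈ T → False := fun h1 h2 => Finset.disjoint_left.1 hST h1 h2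
  have hcard : (S ×ˢ T ∪ T ×ˢ S).card = 18 := by
    rw [Finset.card_union_of_disjoint, Finset.card_product, Finset.card_product, hS, hT]
    rw [Finset.disjoint_left]
    rintro ⟨a, b⟩ h1 h2
    exact hdis (Finset.mem_product.1 h1).1 (Finset.mem_product.1 h2).1
  have hA : ∀ u v, (u, v) ∈ S ×ˢ T ∪ T ×ˢ S ↔ K.Adj u v := fun u v => by
    rw [Finset.mem_union, Finset.mem_product, Finset.mem_product]
  have := hr.two_le hg (m := 3) (k := 4) (by norm_num) (by norm_num) (S ×ˢ T ∪ T ×ˢ S) hA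
    (Finset.card_pos.1 (by omega)) ?_ ?_
  -- The inequality would read `2 ≤ 18 (1/3 + 1/4 - 1/2) = 3/2`.
  · rw [hcard] at this
    norm_num at this
  · rintro ⟨u, v⟩ hp
    rw [hA] at hp
    rcases hK.1 hp with h | h
    · rw [← hT]
      exact hr.card_le_card_orb hp _ fun w hw => hK.2 (Or.inl ⟨h.1, hw⟩)
    · rw [← hS]
      exact hr.card_le_card_orb hp _ fun w hw => hK.2 (Or.inr ⟨h.1, hw⟩)
  · have step : ∀ a b, K.Adj a b → ∃ d, (σ * rev V) (a, b) = (b, d) ∧ K.Adj b d ∧ d ≠ a := by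
      intro a b hab
      rcases hK.1 hab with h | h
      · obtain ⟨c, hc, hca⟩ := Finset.exists_mem_ne (by omega : 1 < S.card) a
        exact hr.face_step hab (hK.2 (Or.inr ⟨h.2, hc⟩)) hca
      · obtain ⟨c, hc, hca⟩ := Finset.exists_mem_ne (by omega : 1 < T.card) a
        exact hr.face_step hab (hK.2 (Or.inl ⟨h.2, hc⟩)) hca
    -- The sides alternate, so a walk of length three does not close up; faces therefore have at
    -- least four darts.
    have alt : ∀ a b c, K.Adj a b → K.Adj b c → ∀ d, K.Adj c d → d ≠ a := by
      rintro a b c h1 h2 d h3 rfl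
      rcases hK.1 h1 with ⟨x1, x2⟩ | ⟨x1, x2⟩ <;> rcases hK.1 h2 with ⟨y1, y2⟩ | ⟨y1, y2⟩ <;>
        rcases hK.1 h3 with ⟨z1, z2⟩ | ⟨z1, z2⟩
      all_goals first
        | exact hdis x1 z2
        | exact hdis z2 x1
        | exact hdis x2 y1
        | exact hdis y1 x2
        | exact hdis y2 z1
        | exact hdis z1 y2
    rintro ⟨u, v⟩ hp
    rw [hA] at hp
    obtain ⟨w, h1, hvw, hwu⟩ := step u v hp
    obtain ⟨x, h2, hwx, hxv⟩ := step v w hvw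
    obtain ⟨y, h3, hxy, hyw⟩ := step w x hwx
    have hxu := alt u v w hp hvw x hwx
    have hc : ({(u, v), (v, w), (w, x), (x, y)} : Finset (V × V)).card = 4 := by
      rw [Finset.card_insert_of_notMem, Finset.card_insert_of_notMem, Finset.card_pair]
      · exact fun h => hwx.ne (Prod.ext_iff.1 h).1
      · simp only [Finset.mem_insert, Finset.mem_singleton, not_or, Prod.mk.injEq]
        exact ⟨fun h => hvw.ne h.1, fun h => hxv h.1.symm⟩
      · simp only [Finset.mem_insert, Finset.mem_singleton, not_or, Prod.mk.injEq]
        exact ⟨fun h => hp.ne h.1, fun h => hwu h.1.symm, fun h => hxu h.1.symm⟩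
    rw [← hc]
    have o1 := orb_apply (σ * rev V) (u, v)
    have o2 := orb_apply (σ * rev V) (v, w)
    have o3 := orb_apply (σ * rev V) (w, x)
    rw [h1] at o1
    rw [h2] at o2
    rw [h3] at o3
    refine card_le_card_class _ _ fun e he => ?_
    simp only [Finset.mem_insert, Finset.mem_singleton] at he
    rcases he with rfl | rfl | rfl | rfl
    · exact Setoid.refl' _ _
    · exact o1
    · exact Setoid.trans' _ o1 o2
    · exact Setoid.trans' _ o1 (Setoid.trans' _ o2 o3)

end

end

/-! ### Forests with 2-degenerate complement in spherical graphs -/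

section
variable {V : Type*} [Fintype V] [DecidableEq V] {H : SimpleGraph V}

/-- The subgraph of `H` induced on `X` is connected, in terms of cuts. -/
def CutConnected (H : SimpleGraph V) (X : Finset V) : Prop :=
  ∀ S ⊆ X, S.Nonempty → S ≠ X → ∃ s ∈ S, ∃ t ∈ X, t ∉ S ∧ H.Adj s t

/-- A cut lifts to `X` by putting `v` on the side of `z`; in the crossing edge found there, `v` may
be replaced by `z`. -/
theorem CutConnected.contractPair {X : Finset V} (h : CutConnected H X) {z v : V} (hz : z ∈ X)
    (hv : v ∈ X) (hzv : z ≠ v) : CutConnected (contractPair H z v) (X.erase v) := by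
  intro S hS hne hSX
  by_cases hzS : z ∈ S
  · obtain ⟨s, hs, t, ht, htS, hst⟩ := h (insert v S)
      (Finset.insert_subset hv (hS.trans (Finset.erase_subset _ _))) (Finset.insert_nonempty _ _)
      (fun h' => hSX (by
        rw [← h', Finset.erase_insert]
        exact fun h'' => Finset.notMem_erase v X (hS h'')))
    rw [Finset.mem_insert, not_or] at htS
    rcases Finset.mem_insert.1 hs with rfl | hs
    · exact ⟨z, hzS, t, Finset.mem_erase.2 ⟨htS.1, ht⟩, htS.2, fun h' => htS.2 (h' ▸ hzS), hzv,
        htS.1, Or.inr (Or.inl ⟨rfl, hst⟩)⟩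
    · exact ⟨s, hs, t, Finset.mem_erase.2 ⟨htS.1, ht⟩, htS.2, hst.ne, Finset.ne_of_mem_erase (hS hs),
        htS.1, Or.inl hst⟩
  · obtain ⟨s, hs, t, ht, htS, hst⟩ := h S (hS.trans (Finset.erase_subset _ _)) hne
      (fun h' => hzS (h' ▸ hz))
    have hsv := Finset.ne_of_mem_erase (hS hs)
    by_cases htv : t = v
    · subst htv
      exact ⟨s, hs, z, Finset.mem_erase.2 ⟨hzv, hz⟩, hzS, fun h' => hzS (h' ▸ hs), hsv, hzv,
        Or.inr (Or.inr ⟨rfl, hst.symm⟩)⟩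
    · exact ⟨s, hs, t, Finset.mem_erase.2 ⟨htv, ht⟩, htS, hst.ne, hsv, htv, Or.inl hst⟩

/-- A cut lifts to `X` by putting `s` on the side of `b`; then no crossing edge uses `s`. -/
theorem CutConnected.erase_leaf {X : Finset V} (h : CutConnected H X) {s b : V} (hs : s ∈ X)
    (hb : ∀ t ∈ X, H.Adj s t → t = b) : CutConnected H (X.erase s) := by
  intro S hS hne hSX
  have hsS : s ∉ S := fun h' => Finset.notMem_erase s X (hS h')
  by_cases hbS : b ∈ S
  · obtain ⟨x, hx, t, ht, htS, hxt⟩ := h (insert s S)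
      (Finset.insert_subset hs (hS.trans (Finset.erase_subset _ _))) (Finset.insert_nonempty _ _)
      (fun h' => hSX (by rw [← h', Finset.erase_insert hsS]))
    rw [Finset.mem_insert, not_or] at htS
    rcases Finset.mem_insert.1 hx with rfl | hx
    · exact absurd ((hb t ht hxt) ▸ hbS) htS.2
    · exact ⟨x, hx, t, Finset.mem_erase.2 ⟨htS.1, ht⟩, htS.2, hxt⟩
  · obtain ⟨x, hx, t, ht, htS, hxt⟩ := h S (hS.trans (Finset.erase_subset _ _)) hne
      (fun h' => hsS (h' ▸ hs))
    refine ⟨x, hx, t, Finset.mem_erase.2 ⟨?_, ht⟩, htS, hxt⟩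
    rintro rfl
    exact hbS (hb x (Finset.mem_of_mem_erase (hS hx)) hxt.symm ▸ hx)

theorem CutConnected.mono_off {X : Finset V} (h : CutConnected H X) {z v : V} (hv : v ∉ X) :
    CutConnected (_root_.contractPair H z v) X := by
  intro S hS hne hSX
  obtain ⟨s, hs, t, ht, htS, hst⟩ := h S hS hne hSX
  exact ⟨s, hs, t, ht, htS, hst.ne, fun h' => hv (h' ▸ hS hs), fun h' => hv (h' ▸ ht), Or.inl hst⟩

/-- Two adjacent vertices `z`, `v` of a spherical graph cannot have three common neighbours such
that none of the three triangles is separating. -/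
theorem IsSpherical.separating_triangle (hH : IsSpherical H) {z v a b c : V} {X : Finset V}
    (hzX : z ∉ X) (hvX : v ∉ X) (ha : a ∈ X) (hb : b ∈ X) (hc : c ∈ X) (hab : a ≠ b) (hac : a ≠ c)
    (hbc : b ≠ c) (hzv : H.Adj z v) (hza : H.Adj z a) (hzb : H.Adj z b) (hzc : H.Adj z c)
    (hva : H.Adj v a) (hvb : H.Adj v b) (hvc : H.Adj v c) (hXa : CutConnected H (X.erase a))
    (hXb : CutConnected H (X.erase b)) (hXc : CutConnected H (X.erase c)) : False := by
  induction hn : X.card using Nat.strong_induction_on generalizing H X a b c with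
  | _ n ih =>
  -- contracting `s` into `s'`
  have adjc : ∀ {s' s x y : V}, s ≠ x → s ≠ y → H.Adj x y → (_root_.contractPair H s' s).Adj x y :=
    fun hx hy h => ⟨h.ne, hx.symm, hy.symm, Or.inl h⟩
  have hcard : ∀ {s}, s ∈ X → (X.erase s).card < n := fun hs => by
    rw [← hn]; exact Finset.card_erase_lt_of_mem hs
  have nz : ∀ {s}, s ∈ X → s ≠ z := fun hs h => hzX (h ▸ hs)
  have nv : ∀ {s}, s ∈ X → s ≠ v := fun hs h => hvX (h ▸ hs)
  have mem' : ∀ {s x}, x ≠ s → x ∈ X → x ∈ X.erase s := fun h1 h2 => Finset.mem_erase.2 ⟨h1, h2⟩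
  -- Here `s` is contracted into `a`. Without `a`, it is a leaf at `b` and can be dropped; in the
  -- two sets that contain `a`, the contraction takes place inside the set.
  have two : ∀ {s a b c}, a ∈ X → b ∈ X → c ∈ X → a ≠ b → a ≠ c → b ≠ c → H.Adj z a → H.Adj z b →
      H.Adj z c → H.Adj v a → H.Adj v b → H.Adj v c → CutConnected H (X.erase a) →
      CutConnected H (X.erase b) → CutConnected H (X.erase c) → s ∈ X → s ≠ a → s ≠ b → s ≠ c →
      H.Adj s a → (∀ t ∈ X, H.Adj s t → t = a ∨ t = b) → False := by
    intro s a b c ha hb hc hab hac hbc hza hzb hzc hva hvb hvc hXa hXb hXc hs hsa hsb hsc hadj hN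
    refine ih _ (hcard hs) (hH.contractPair hadj.symm) (X := X.erase s)
      (fun h => hzX (Finset.mem_of_mem_erase h)) (fun h => hvX (Finset.mem_of_mem_erase h))
      (mem' hsa.symm ha) (mem' hsb.symm hb) (mem' hsc.symm hc) hab hac hbc
      (adjc (nz hs) (nv hs) hzv) (adjc (nz hs) hsa hza) (adjc (nz hs) hsb hzb)
      (adjc (nz hs) hsc hzc) (adjc (nv hs) hsa hva) (adjc (nv hs) hsb hvb)
      (adjc (nv hs) hsc hvc) ?_ ?_ ?_ rfl
    · rw [Finset.erase_right_comm]
      refine (hXa.erase_leaf (mem' hsa hs) (b := b) fun t ht hst => ?_).mono_off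
        (Finset.notMem_erase _ _)
      exact (hN t (Finset.mem_of_mem_erase ht) hst).resolve_left (Finset.ne_of_mem_erase ht)
    · rw [Finset.erase_right_comm]
      exact hXb.contractPair (mem' hab ha) (mem' hsb hs) hsa.symm
    · rw [Finset.erase_right_comm]
      exact hXc.contractPair (mem' hac ha) (mem' hsc hs) hsa.symm
  by_cases hex : ∃ s ∈ X, s ≠ a ∧ s ≠ b ∧ s ≠ c
  · obtain ⟨s, hs, hsa, hsb, hsc⟩ := hex
    by_cases hex' : ∃ t ∈ X, H.Adj s t ∧ t ≠ a ∧ t ≠ b ∧ t ≠ c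
    · obtain ⟨t, ht, hst, hta, htb, htc⟩ := hex'
      -- The vertex `t` lies in all three sets, so contracting `s` into `t` keeps each of them
      -- connected.
      refine ih _ (hcard hs) (hH.contractPair hst.symm) (X := X.erase s) (a := a) (b := b) (c := c)
        (fun h => hzX (Finset.mem_of_mem_erase h)) (fun h => hvX (Finset.mem_of_mem_erase h))
        (mem' hsa.symm ha) (mem' hsb.symm hb) (mem' hsc.symm hc) hab hac hbc
        (adjc (nz hs) (nv hs) hzv) (adjc (nz hs) hsa hza) (adjc (nz hs) hsb hzb)
        (adjc (nz hs) hsc hzc) (adjc (nv hs) hsa hva) (adjc (nv hs) hsb hvb)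
        (adjc (nv hs) hsc hvc) ?_ ?_ ?_ rfl
      · rw [Finset.erase_right_comm]
        exact hXa.contractPair (mem' hta ht) (mem' hsa hs) hst.ne'
      · rw [Finset.erase_right_comm]
        exact hXb.contractPair (mem' htb ht) (mem' hsb hs) hst.ne'
      · rw [Finset.erase_right_comm]
        exact hXc.contractPair (mem' htc ht) (mem' hsc hs) hst.ne'
    · have hN : ∀ t ∈ X, H.Adj s t → t = a ∨ t = b ∨ t = c := by
        intro t ht hst
        by_contra h
        exact hex' ⟨t, ht, hst, by tauto⟩
      -- Connectedness of `X.erase d` prevents `s` from being isolated there, so `s` has at least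
      -- two neighbours among `a`, `b`, `c`.
      have one : ∀ d, d ∈ X → d ≠ s → (∃ x ∈ X, x ≠ d ∧ x ≠ s) → CutConnected H (X.erase d) →
          ∃ t ∈ X, t ≠ d ∧ H.Adj s t := by
        rintro d hd hds ⟨x, hx, hxd, hxs⟩ hcon
        obtain ⟨s', hs', t, ht, -, hst⟩ := hcon {s} (Finset.singleton_subset_iff.2 (mem' hds.symm hs))
          (Finset.singleton_nonempty s) (fun h => hxs (by
            have := mem' hxd hx
            rw [← h] at this
            exact Finset.mem_singleton.1 this))
        rw [Finset.mem_singleton.1 hs'] at hst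
        exact ⟨t, Finset.mem_of_mem_erase ht, Finset.ne_of_mem_erase ht, hst⟩
      by_cases hA : H.Adj s a <;> by_cases hB : H.Adj s b <;> by_cases hC : H.Adj s c
      · refine hH.not_complete_bipartite {z, v, s} {a, b, c} ?_ ?_ ?_ ?_
        · rw [Finset.card_eq_three]
          exact ⟨z, v, s, hzv.ne, (nz hs).symm, (nv hs).symm, rfl⟩
        · rw [Finset.card_eq_three]
          exact ⟨a, b, c, hab, hac, hbc, rfl⟩
        · rw [Finset.disjoint_left]
          intro x hx hx'
          simp only [Finset.mem_insert, Finset.mem_singleton] at hx hx'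
          have := nz ha; have := nz hb; have := nz hc
          have := nv ha; have := nv hb; have := nv hc
          rcases hx with rfl | rfl | rfl <;> rcases hx' with rfl | rfl | rfl <;> contradiction
        · intro x hx y hy
          simp only [Finset.mem_insert, Finset.mem_singleton] at hx hy
          rcases hx with rfl | rfl | rfl <;> rcases hy with rfl | rfl | rfl <;> assumption
      · exact two ha hb hc hab hac hbc hza hzb hzc hva hvb hvc hXa hXb hXc hs hsa hsb hsc hA
          fun t ht hst => by
            rcases hN t ht hst with h | h | rfl
            · exact Or.inl h
            · exact Or.inr h
            · exact absurd hst hC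
      · exact two ha hc hb hac hab hbc.symm hza hzc hzb hva hvc hvb hXa hXc hXb hs hsa hsc hsb hA
          fun t ht hst => by
            rcases hN t ht hst with h | rfl | h
            · exact Or.inl h
            · exact absurd hst hB
            · exact Or.inr h
      · obtain ⟨t, ht, hta, hst⟩ := one a ha hsa.symm ⟨b, hb, hab.symm, hsb.symm⟩ hXa
        rcases hN t ht hst with rfl | rfl | rfl <;> contradiction
      · exact two hb hc ha hbc hab.symm hac.symm hzb hzc hza hvb hvc hva hXb hXc hXa hs hsb hsc hsa
          hB fun t ht hst => by
            rcases hN t ht hst with rfl | h | h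
            · exact absurd hst hA
            · exact Or.inl h
            · exact Or.inr h
      · obtain ⟨t, ht, hta, hst⟩ := one b hb hsb.symm ⟨a, ha, hab, hsa.symm⟩ hXb
        rcases hN t ht hst with rfl | rfl | rfl <;> contradiction
      · obtain ⟨t, ht, hta, hst⟩ := one c hc hsc.symm ⟨b, hb, hbc, hsb.symm⟩ hXc
        rcases hN t ht hst with rfl | rfl | rfl <;> contradiction
      · obtain ⟨t, ht, hta, hst⟩ := one c hc hsc.symm ⟨b, hb, hbc, hsb.symm⟩ hXc
        rcases hN t ht hst with rfl | rfl | rfl <;> contradiction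
  · have hX : ∀ s ∈ X, s = a ∨ s = b ∨ s = c := by
      intro s hs
      by_contra h
      exact hex ⟨s, hs, by tauto⟩
    -- Only `a`, `b`, `c` are left. A connected pair is an edge, so together with `z` and `v` they
    -- form a `K₅`.
    have edge : ∀ d e f, d ∈ X → e ∈ X → f ∈ X → d ≠ e → d ≠ f → e ≠ f →
        (∀ s ∈ X, s = d ∨ s = e ∨ s = f) → CutConnected H (X.erase d) → H.Adj e f := by
      intro d e f hd he hf hde hdf hef hX hcon
      obtain ⟨s, hs, t, ht, hts, hst⟩ := hcon {e} (Finset.singleton_subset_iff.2 (mem' hde.symm he))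
        (Finset.singleton_nonempty e) (fun h => hef (by
          have := mem' hdf.symm hf
          rw [← h] at this
          exact (Finset.mem_singleton.1 this).symm))
      rw [Finset.mem_singleton] at hs hts
      subst hs
      rcases hX t (Finset.mem_of_mem_erase ht) with h | h | rfl
      · exact absurd h (Finset.ne_of_mem_erase ht)
      · exact absurd h hts
      · exact hst
    have ebc := edge a b c ha hb hc hab hac hbc hX hXa
    have eac := edge b a c hb ha hc hab.symm hbc hac (fun s hs => by have := hX s hs; tauto) hXb
    have eab := edge c a b hc ha hb hac.symm hbc.symm hab (fun s hs => by have := hX s hs; tauto) hXc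
    refine hH.not_complete_five {z, v, a, b, c} ?_ ?_
    · have := nz ha; have := nz hb; have := nz hc
      have := nv ha; have := nv hb; have := nv hc
      have := hzv.ne
      rw [Finset.card_insert_of_notMem, Finset.card_insert_of_notMem, Finset.card_eq_three.2
        ⟨a, b, c, hab, hac, hbc, rfl⟩] <;>
      · simp only [Finset.mem_insert, Finset.mem_singleton]
        tauto
    · intro x hx y hy hxy
      simp only [Finset.mem_insert, Finset.mem_singleton] at hx hy
      rcases hx with rfl | rfl | rfl | rfl | rfl <;>
        rcases hy with rfl | rfl | rfl | rfl | rfl <;>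
        first | exact absurd rfl hxy | assumption | (apply SimpleGraph.Adj.symm; assumption)

end

/-! ### Forest witnesses and the induction along a triangle -/

section
variable {V : Type*} [Fintype V] [DecidableEq V] {H K : SimpleGraph V}

open Classical in
/-- A forest `F` in `H - z`, disjoint from the edge `x y`, and two rankings (minimal exactly at
`x` and `y`): with respect to `s`, the graph `F` is 1-degenerate above `{x, y}`, and with respect to
`r`, the graph `H - z - E(F)` is 2-degenerate, where neighbours of `z` have at most one neighbour of
smaller or equal rank. -/
structure ForestWitness (H : SimpleGraph V) (z x y : V) (F : SimpleGraph V) (r s : V → ℕ) :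
    Prop where
  le : F ≤ H
  avoid : ∀ u, ¬ F.Adj z u
  not_adj : ¬ F.Adj x y
  r_eq : ∀ u, r u = 0 ↔ u = x ∨ u = y
  s_eq : ∀ u, s u = 0 ↔ u = x ∨ u = y
  r_le : ∀ u, u ≠ x → u ≠ y → u ≠ z →
    {u' | H.Adj u u' ∧ ¬ F.Adj u u' ∧ u' ≠ z ∧ r u' ≤ r u}.ncard ≤ if H.Adj z u then 1 else 2
  s_le : ∀ u, u ≠ x → u ≠ y → u ≠ z → {u' | F.Adj u u' ∧ s u' ≤ s u}.ncard ≤ 1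

/-- The induction statement. The stricter bound at the neighbours of `z` leaves room for `z` itself,
which is finally ranked lowest. -/
def HasForest (H : SimpleGraph V) (z x y : V) : Prop :=
  ∃ F r s, ForestWitness H z x y F r s

/-- A vertex that ceases to be adjacent to `z` only gets a weaker bound. This allows the induction
to work with edge-maximal graphs. -/
theorem HasForest.mono {z x y : V} (h : HasForest K z x y) (hHK : H ≤ K) : HasForest H z x y := by
  classical
  obtain ⟨F, r, s, h⟩ := h
  refine ⟨F ⊓ H, r, s, inf_le_right, fun u hu => h.avoid u hu.1, fun hu => h.not_adj hu.1, h.r_eq,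
    h.s_eq, ?_, ?_⟩
  · intro u hx hy hz
    refine (Set.ncard_le_ncard ?_ (Set.toFinite _)).trans ((h.r_le u hx hy hz).trans ?_)
    · rintro u' ⟨h1, h2, h3, h4⟩
      exact ⟨hHK h1, fun h5 => h2 ⟨h5, h1⟩, h3, h4⟩
    · split_ifs with h1 h2 h2
      · rfl
      · norm_num
      · exact absurd (hHK h2) h1
      · rfl
  · intro u hx hy hz
    refine (Set.ncard_le_ncard ?_ (Set.toFinite _)).trans (h.s_le u hx hy hz)
    rintro u' ⟨h1, h2⟩
    exact ⟨h1.1, h2⟩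

/-- The subgraph of `H` with the edges inside `W`. -/
def restrictTo (H : SimpleGraph V) (W : Finset V) : SimpleGraph V where
  Adj a b := H.Adj a b ∧ a ∈ W ∧ b ∈ W
  symm := ⟨fun _ _ h => ⟨h.1.symm, h.2.2, h.2.1⟩⟩
  loopless := ⟨fun _ h => h.1.ne rfl⟩

theorem restrictTo_adj {W : Finset V} {a b : V} :
    (restrictTo H W).Adj a b ↔ H.Adj a b ∧ a ∈ W ∧ b ∈ W := Iff.rfl

theorem restrictTo_le (W : Finset V) : restrictTo H W ≤ H := fun _ _ h => h.1

/-- Gluing along a triangle `z p q`. -/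
theorem HasForest.glue {z x y p q : V} {W₁ W₂ : Finset V}
    (hadj : ∀ a b, H.Adj a b → (a ∈ W₁ ∧ b ∈ W₁) ∨ (a ∈ W₂ ∧ b ∈ W₂))
    (hz₁ : z ∈ W₁) (hz₂ : z ∈ W₂)
    (hW : ∀ a, a ∈ W₁ → a ∈ W₂ → a = z ∨ a = p ∨ a = q) (hp : p ∈ W₁) (hq : q ∈ W₁)
    (hx : x ∈ W₁) (hy : y ∈ W₁)
    (h₁ : HasForest (restrictTo H W₁) z x y) (h₂ : HasForest (restrictTo H W₂) z p q) :
    HasForest H z x y := by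
  classical
  obtain ⟨F₁, r₁, s₁, h₁⟩ := h₁
  obtain ⟨F₂, r₂, s₂, h₂⟩ := h₂
  -- The vertices outside `W₁` are lifted above all of `W₁` by adding `M`, so those of `W₁` see none
  -- of them below.
  set M := ∑ u, (r₁ u + s₁ u) with hM
  have hle : ∀ u, r₁ u + s₁ u ≤ M := fun u =>
    Finset.single_le_sum (f := fun u => r₁ u + s₁ u) (fun _ _ => Nat.zero_le _) (Finset.mem_univ u)
  have r₂pos : ∀ u, u ∉ W₁ → 0 < r₂ u := fun u hu => Nat.pos_of_ne_zero fun h => by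
    rcases (h₂.r_eq u).1 h with rfl | rfl <;> contradiction
  have s₂pos : ∀ u, u ∉ W₁ → 0 < s₂ u := fun u hu => Nat.pos_of_ne_zero fun h => by
    rcases (h₂.s_eq u).1 h with rfl | rfl <;> contradiction
  -- `F₂` avoids `z` and the edge `p q`, hence has no edge inside the shared triangle.
  have hF₂ : ∀ a b, F₂.Adj a b → a ∈ W₁ → b ∈ W₁ → False := by
    intro a b hab ha hb
    have h := h₂.le hab
    rcases hW a ha h.2.1 with rfl | rfl | rfl
    · exact h₂.avoid _ hab
    · rcases hW b hb h.2.2 with rfl | rfl | rfl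
      · exact h₂.avoid _ hab.symm
      · exact hab.ne rfl
      · exact h₂.not_adj hab
    · rcases hW b hb h.2.2 with rfl | rfl | rfl
      · exact h₂.avoid _ hab.symm
      · exact h₂.not_adj hab.symm
      · exact hab.ne rfl
  refine ⟨F₁ ⊔ F₂, fun u => if u ∈ W₁ then r₁ u else M + r₂ u,
    fun u => if u ∈ W₁ then s₁ u else M + s₂ u,
    sup_le (h₁.le.trans (restrictTo_le _)) (h₂.le.trans (restrictTo_le _)), ?_, ?_, ?_, ?_, ?_, ?_⟩
  · rintro u (h | h)
    · exact h₁.avoid _ h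
    · exact h₂.avoid _ h
  · rintro (h | h)
    · exact h₁.not_adj h
    · exact hF₂ _ _ h hx hy
  · intro u
    by_cases hu : u ∈ W₁
    · simp only [hu, if_true]; exact h₁.r_eq u
    · simp only [hu, if_false]
      have := r₂pos u hu
      constructor
      · intro h; omega
      · rintro (rfl | rfl) <;> contradiction
  · intro u
    by_cases hu : u ∈ W₁
    · simp only [hu, if_true]; exact h₁.s_eq u
    · simp only [hu, if_false]
      have := s₂pos u hu
      constructor
      · intro h; omega
      · rintro (rfl | rfl) <;> contradiction
  · intro u hux huy huz
    by_cases hu : u ∈ W₁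
    · refine (Set.ncard_le_ncard ?_ (Set.toFinite _)).trans ((h₁.r_le u hux huy huz).trans ?_)
      · rintro u' ⟨k1, k2, k3, k4⟩
        have hu' : u' ∈ W₁ := by
          by_contra hu'
          simp only [hu, hu', if_true, if_false] at k4
          have := r₂pos u' hu'
          have := hle u
          omega
        simp only [hu, hu', if_true] at k4
        exact ⟨⟨k1, hu, hu'⟩, fun h => k2 (Or.inl h), k3, k4⟩
      · simp only [restrictTo_adj, hz₁, hu, and_true, le_refl]
    · have hu2 : ∀ u', H.Adj u u' → u ∈ W₂ ∧ u' ∈ W₂ := fun u' h =>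
        (hadj u u' h).resolve_left fun h => hu h.1
      refine (Set.ncard_le_ncard ?_ (Set.toFinite _)).trans ((h₂.r_le u (fun h => hu (h ▸ hp))
        (fun h => hu (h ▸ hq)) huz).trans ?_)
      · rintro u' ⟨k1, k2, k3, k4⟩
        refine ⟨⟨k1, hu2 u' k1⟩, fun h => k2 (Or.inr h), k3, ?_⟩
        -- A neighbour in the shared part is `p` or `q`, which has rank 0 in the second witness and
        -- was counted there too.
        by_cases hu' : u' ∈ W₁
        · rw [(h₂.r_eq u').2 ((hW u' hu' (hu2 u' k1).2).resolve_left k3)]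
          exact Nat.zero_le _
        · simp only [hu, hu', if_false] at k4
          omega
      · by_cases hzu : H.Adj z u
        · rw [if_pos hzu, if_pos ⟨hzu, hz₂, (hu2 z hzu.symm).1⟩]
        · rw [if_neg hzu, if_neg fun h => hzu h.1]
  · intro u hux huy huz
    by_cases hu : u ∈ W₁
    · refine (Set.ncard_le_ncard ?_ (Set.toFinite _)).trans (h₁.s_le u hux huy huz)
      rintro u' ⟨k1, k4⟩
      have hu' : u' ∈ W₁ := by
        by_contra hu'
        simp only [hu, hu', if_true, if_false] at k4
        have := s₂pos u' hu'
        have := hle u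
        omega
      simp only [hu, hu', if_true] at k4
      exact ⟨k1.resolve_right fun h => hF₂ _ _ h hu hu', k4⟩
    · refine (Set.ncard_le_ncard ?_ (Set.toFinite _)).trans (h₂.s_le u (fun h => hu (h ▸ hp))
        (fun h => hu (h ▸ hq)) huz)
      rintro u' ⟨k1, k4⟩
      have k1' : F₂.Adj u u' := k1.resolve_left fun h => hu (h₁.le h).2.1
      refine ⟨k1', ?_⟩
      by_cases hu' : u' ∈ W₁
      · rw [(h₂.s_eq u').2 ((hW u' hu' (h₂.le k1').2.2).resolve_left
          fun h => h₂.avoid u (h ▸ k1'.symm))]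
        exact Nat.zero_le _
      · simp only [hu, hu', if_false] at k4
        omega

/-- Undoing the contraction of `z v`, where `v` has no common neighbours with `z` except `x` and
possibly `w` (the case `w = v` means that there is no further common neighbour). -/
theorem HasForest.of_contractPair {z x y v w : V} (hzv : H.Adj z v) (hvx : v ≠ x) (hvy : v ≠ y)
    (hzy : H.Adj z y) (hxy : x ≠ y) (hcommon : ∀ c, H.Adj z c → H.Adj v c → c = x ∨ c = w)
    (hw : w = v ∨ (H.Adj z w ∧ H.Adj v w)) (h : HasForest (contractPair H z v) z x y) :
    HasForest H z x y := by
  classical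
  obtain ⟨F', r', s', h⟩ := h
  set M := ∑ u, s' u + 1 with hM
  have hle : ∀ u, s' u < M := fun u => Nat.lt_succ_of_le
    (Finset.single_le_sum (f := fun u => s' u) (fun _ _ => Nat.zero_le _) (Finset.mem_univ u))
  have hF' : ∀ {a b}, F'.Adj a b → a ≠ v ∧ b ≠ v ∧ H.Adj a b := by
    intro a b hab
    obtain ⟨h1, h2, h3, h4 | ⟨rfl, _⟩ | ⟨rfl, _⟩⟩ := h.le hab
    · exact ⟨h2, h3, h4⟩
    · exact absurd hab (h.avoid _)
    · exact absurd hab.symm (h.avoid _)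
  have hF : ∀ a b, (F' ⊔ SimpleGraph.edge v w).Adj a b ↔
      F'.Adj a b ∨ ((v = a ∧ w = b ∨ v = b ∧ w = a) ∧ a ≠ b) := by
    intro a b
    rw [SimpleGraph.sup_adj, SimpleGraph.edge_adj]
    tauto
  have hwz : w ≠ z := by
    rcases hw with rfl | hw
    · exact hzv.ne'
    · exact hw.1.ne'
  have r_of : ∀ u, u ≠ x → u ≠ y → r' u ≠ 0 := fun u h1 h2 h3 => by
    have := (h.r_eq u).1 h3; tauto
  -- For `r`, the vertex `v` comes directly above `x` and `y`; for `s` it comes last, with `v w` as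
  -- its only forest edge. If `w = v`, no edge is added.
  refine ⟨F' ⊔ SimpleGraph.edge v w,
    fun u => if u = x ∨ u = y then 0 else if u = v then 1 else r' u + 1,
    fun u => if u = v then M else s' u, ?_, ?_, ?_, ?_, ?_, ?_, ?_⟩
  · refine sup_le (fun a b hab => (hF' hab).2.2) ((SimpleGraph.edge_le_iff _).2 ?_)
    rcases hw with rfl | hw
    · exact Or.inl rfl
    · exact Or.inr hw.2
  · intro u hu
    rcases (hF _ _).1 hu with hu | ⟨⟨h1, _⟩ | ⟨_, h1⟩, _⟩
    · exact h.avoid u hu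
    · exact hzv.ne h1.symm
    · exact hwz h1
  · intro hu
    rcases (hF _ _).1 hu with hu | ⟨⟨h1, _⟩ | ⟨h1, _⟩, _⟩
    · exact h.not_adj hu
    · exact hvx h1
    · exact hvy h1
  · intro u
    by_cases hu : u = x ∨ u = y
    · simp [hu]
    · simp only [hu, if_false, iff_false]
      split_ifs <;> simp
  · intro u
    by_cases hu : u = v
    · subst hu
      simp [hvx, hvy, hM]
    · simp only [hu, if_false]
      exact h.s_eq u
  · intro u hux huy huz
    by_cases huv : u = v
    · subst huv
      rw [if_pos hzv]
      refine (Set.ncard_le_ncard (t := {x}) ?_ (Set.toFinite _)).trans (Set.ncard_singleton x).le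
      rintro u' ⟨k1, k2, k3, k4⟩
      simp only [hux, huy, or_self, if_false, if_true] at k4
      have h0 : u' = x ∨ u' = y := by
        by_contra hcon
        have := r_of u' (fun h => hcon (Or.inl h)) (fun h => hcon (Or.inr h))
        simp only [hcon, k1.ne', if_false] at k4
        omega
      rcases h0 with h0 | rfl
      · exact h0
      -- If `y` is adjacent to `v`, it is the common neighbour `w`, and the edge `v y` has gone into
      -- the forest.
      · have hyw := (hcommon _ hzy k1).resolve_left hxy.symm
        exact absurd ((hF _ _).2 (Or.inr ⟨Or.inl ⟨rfl, hyw.symm⟩, k1.ne⟩)) k2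
    -- A neighbour `u` of `v` was a neighbour of `z` in the contraction, with bound one. Now `v` may
    -- be a new lower neighbour of `u`, but only if `u` is not adjacent to `z`, where the bound is
    -- two; a common neighbour has its edge to `v` in the forest.
    · have hsub : {u' | H.Adj u u' ∧ ¬ (F' ⊔ SimpleGraph.edge v w).Adj u u' ∧ u' ≠ z ∧
          (if u' = x ∨ u' = y then 0 else if u' = v then 1 else r' u' + 1) ≤
          (if u = x ∨ u = y then 0 else if u = v then 1 else r' u + 1)} ⊆
          {u' | (contractPair H z v).Adj u u' ∧ ¬ F'.Adj u u' ∧ u' ≠ z ∧ r' u' ≤ r' u} ∪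
          {u' | u' = v ∧ H.Adj v u ∧ ¬ H.Adj z u} := by
        rintro u' ⟨k1, k2, k3, k4⟩
        by_cases hu' : u' = v
        · subst hu'
          refine Or.inr ⟨rfl, k1.symm, fun hzu => ?_⟩
          have huw := (hcommon _ hzu k1.symm).resolve_left hux
          exact k2 ((hF _ _).2 (Or.inr ⟨Or.inr ⟨rfl, huw.symm⟩, k1.ne⟩))
        · refine Or.inl ⟨⟨k1.ne, huv, hu', Or.inl k1⟩, fun h => k2 (Or.inl h), k3, ?_⟩
          simp only [hux, huy, huv, hu', or_self, if_false] at k4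
          by_cases h0 : u' = x ∨ u' = y
          · rw [(h.r_eq u').2 h0]; exact Nat.zero_le _
          · simp only [h0, if_false] at k4; omega
      refine (Set.ncard_le_ncard hsub (Set.toFinite _)).trans ((Set.ncard_union_le _ _).trans ?_)
      have hold := h.r_le u hux huy huz
      by_cases hzu : H.Adj z u
      · rw [if_pos hzu]
        rw [if_pos ⟨hzu.ne, hzv.ne, huv, Or.inl hzu⟩] at hold
        have : {u' | u' = v ∧ H.Adj v u ∧ ¬ H.Adj z u} = ∅ := by
          ext u'; simp [hzu]
        rw [this, Set.ncard_empty]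
        exact hold
      · rw [if_neg hzu]
        by_cases hvu : H.Adj v u
        · rw [if_pos ⟨huz.symm, hzv.ne, huv, Or.inr (Or.inl ⟨rfl, hvu⟩)⟩] at hold
          have : {u' | u' = v ∧ H.Adj v u ∧ ¬ H.Adj z u}.ncard ≤ 1 :=
            (Set.ncard_le_ncard (t := {v}) (fun _ h => h.1) (Set.toFinite _)).trans
              (Set.ncard_singleton v).le
          omega
        · have : {u' | u' = v ∧ H.Adj v u ∧ ¬ H.Adj z u} = ∅ := by
            ext u'; simp [hvu]
          rw [this, Set.ncard_empty]
          split_ifs at hold <;> omega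
  · intro u hux huy huz
    by_cases huv : u = v
    · subst huv
      refine (Set.ncard_le_ncard (t := {w}) ?_ (Set.toFinite _)).trans (Set.ncard_singleton w).le
      rintro u' ⟨k1, -⟩
      rcases (hF _ _).1 k1 with k | ⟨⟨_, k⟩ | ⟨k, _⟩, k'⟩
      · exact absurd rfl (hF' k).1
      · exact k.symm
      · exact absurd k k'
    · refine (Set.ncard_le_ncard ?_ (Set.toFinite _)).trans (h.s_le u hux huy huz)
      rintro u' ⟨k1, k2⟩
      by_cases hu' : u' = v
      · simp only [hu', huv, if_true, if_false] at k2
        have := hle u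
        omega
      · simp only [hu', huv, if_false] at k2
        rcases (hF _ _).1 k1 with k | ⟨⟨k, _⟩ | ⟨k, _⟩, _⟩
        · exact ⟨k, k2⟩
        · exact absurd k.symm huv
        · exact absurd k.symm hu'

/-- In an edge-maximal spherical graph on `W`, an edge of a triangle `z x y` lies in a second
triangle, unless the triangle contains all vertices. -/
theorem exists_second_triangle {W : Finset V} (hH : IsSpherical H)
    (hmax : ∀ K, IsSpherical K → (∀ a b, K.Adj a b → a ∈ W ∧ b ∈ W) → H ≤ K → K ≤ H)
    (hsupp : ∀ a b, H.Adj a b → a ∈ W ∧ b ∈ W) {z x y t : V} (hzx : H.Adj z x) (hzy : H.Adj z y)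
    (hxy : H.Adj x y) (ht : t ∈ W) (htz : t ≠ z) (htx : t ≠ x) (hty : t ≠ y) :
    ∃ v, v ≠ y ∧ H.Adj z v ∧ H.Adj x v := by
  obtain ⟨σ, hr, hg⟩ := id hH
  have hadd : ∀ a b, a ∈ W → b ∈ W → a ≠ b → IsSpherical (H ⊔ SimpleGraph.edge a b) →
      H.Adj a b := by
    intro a b ha hb hab hsph
    refine hmax _ hsph (fun c d hcd => ?_) le_sup_left (Or.inr ?_)
    · rcases hcd with hcd | hcd
      · exact hsupp c d hcd
      · rw [SimpleGraph.edge_adj] at hcd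
        rcases hcd.1 with ⟨rfl, rfl⟩ | ⟨rfl, rfl⟩
        · exact ⟨ha, hb⟩
        · exact ⟨hb, ha⟩
    · exact (SimpleGraph.edge_adj _ _ _ _).2 ⟨Or.inl ⟨rfl, rfl⟩, hab⟩
  -- By maximality, consecutive neighbours of a vertex are adjacent.
  have corner : ∀ {u a b}, H.Adj u a → σ (u, a) = (u, b) → H.Adj u b → a ≠ b → H.Adj a b :=
    fun hua hσ hub hab => hadd _ _ (hsupp _ _ hua).2 (hsupp _ _ hub).2 hab
      (hr.isSpherical_sup_corner hg hua hσ hab)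
  by_contra hcon
  have hno : ∀ v, H.Adj z v → H.Adj x v → v = y := fun v h1 h2 => by
    by_contra h; exact hcon ⟨v, h, h1, h2⟩
  -- all neighbours of `u` are `p` and `q`
  have key : ∀ u p q, H.Adj u p → H.Adj u q → p ≠ q → (∀ v, H.Adj u v → H.Adj p v → v = q) →
      ∀ v, H.Adj u v → v = p ∨ v = q := by
    intro u p q hup huq hpq huniq v huv
    obtain ⟨w, huw, hw⟩ := hr.exists_next hup
    obtain ⟨w', huw', hw'⟩ := hr.exists_prev hup
    have hwp : w ≠ p := by
      rintro rfl
      exact hpq (hr.eq_of_fixed huw huq hw).symm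
    have hwp' : w' ≠ p := by
      rintro rfl
      exact hpq (hr.eq_of_fixed huw' huq hw').symm
    -- Both the successor and the predecessor of `p` around `u` are `q`, so the rotation at `u`
    -- consists of `p` and `q` alone.
    have e1 := huniq w huw (corner hup hw huw hwp.symm)
    have e2 := huniq w' huw' (corner huw' hw' hup hwp').symm
    subst e1
    subst e2
    by_contra hv
    refine not_comps_of_invariant (σ := σ) (α := 1) (T := {d | d = (u, p) ∨ d = (u, w')}) ?_ ?_
      (Or.inl rfl) (b := (u, v)) ?_ ((le_sup_left : orb σ ≤ _) (hr.cycle u p v hup huv))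
    · rintro d (rfl | rfl)
      · exact Or.inr hw
      · exact Or.inl hw'
    · exact fun d hd => hd
    · rintro (h | h)
      · exact hv (Or.inl (Prod.ext_iff.1 h).2)
      · exact hv (Or.inr (Prod.ext_iff.1 h).2)
  have kz := key z x y hzx hzy hxy.ne (fun v h1 h2 => hno v h1 h2)
  have kx := key x z y hzx.symm hxy hzy.ne (fun v h1 h2 => hno v h2 h1)
  have ky := key y z x hzy.symm hxy.symm hzx.ne (fun v h1 h2 => by
    rcases kz v h2 with h | h
    · exact h
    · exact absurd h h1.ne')
  -- The triangle is a component of its own, so the edge `z t` could be added, against maximality.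
  have hsph := hH.sup_edge_of_closed (S := {z, x, y}) (a := z) (b := t) ?_ (by simp)
    (by simp [htz, htx, hty])
  · have := hadd z t (hsupp _ _ hzx).1 ht htz.symm hsph
    rcases kz t this with h | h
    · exact htx h
    · exact hty h
  · rintro u (rfl | rfl | rfl) v huv
    · rcases kz v huv with h | h <;> simp [h]
    · rcases kx v huv with h | h <;> simp [h]
    · rcases ky v huv with h | h <;> simp [h]

theorem exists_maximal_spherical {W : Finset V} (hH : IsSpherical H)
    (hsupp : ∀ a b, H.Adj a b → a ∈ W ∧ b ∈ W) :
    ∃ K, H ≤ K ∧ IsSpherical K ∧ (∀ a b, K.Adj a b → a ∈ W ∧ b ∈ W) ∧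
      ∀ K', IsSpherical K' → (∀ a b, K'.Adj a b → a ∈ W ∧ b ∈ W) → K ≤ K' → K' ≤ K := by
  obtain ⟨K, hle, hK⟩ := (Set.toFinite {K : SimpleGraph V | IsSpherical K ∧
    ∀ a b, K.Adj a b → a ∈ W ∧ b ∈ W}).exists_le_maximal (a := H) ⟨hH, hsupp⟩
  exact ⟨K, hle, hK.1.1, hK.1.2, fun K' h1 h2 h3 => hK.2 ⟨h1, h2⟩ h3⟩

/-- Induction on the size of `W`. Edge-maximality provides a second triangle `z x v`. The set `X` is
`W` without `z` and `v`; that the triangle `z v a` separates means that `X.erase a` is not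
connected. A separating triangle leads to gluing, and its absence to contracting `v` into `z`. -/
theorem IsSpherical.hasForest {W : Finset V} (hH : IsSpherical H)
    (hsupp : ∀ a b, H.Adj a b → a ∈ W ∧ b ∈ W) {z x y : V} (hzx : H.Adj z x) (hzy : H.Adj z y)
    (hxy : H.Adj x y) : HasForest H z x y := by
  classical
  induction hn : W.card using Nat.strong_induction_on generalizing H W z x y with
  | _ n ih =>
  obtain ⟨K, hle, hK, hKs, hmax⟩ := exists_maximal_spherical hH hsupp
  refine HasForest.mono ?_ hle
  replace hzx := hle hzx
  replace hzy := hle hzy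
  replace hxy := hle hxy
  clear hH hsupp hle H
  rename' K => H, hK => hH, hKs => hsupp
  by_cases hbase : ∃ t ∈ W, t ≠ z ∧ t ≠ x ∧ t ≠ y
  swap
  · have hW : ∀ u, u ≠ z → u ≠ x → u ≠ y → ∀ v, ¬ H.Adj u v := fun u h1 h2 h3 v h =>
      hbase ⟨u, (hsupp _ _ h).1, h1, h2, h3⟩
    refine ⟨⊥, fun u => if u = x ∨ u = y then 0 else 1, fun u => if u = x ∨ u = y then 0 else 1,
      bot_le, fun u h => h, fun h => h, ?_, ?_, ?_, ?_⟩
    · intro u; split_ifs with h <;> simp [h]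
    · intro u; split_ifs with h <;> simp [h]
    · intro u h1 h2 h3
      have : {u' | H.Adj u u' ∧ ¬ (⊥ : SimpleGraph V).Adj u u' ∧ u' ≠ z ∧
          (if u' = x ∨ u' = y then 0 else 1) ≤ (if u = x ∨ u = y then 0 else 1)} = ∅ := by
        ext u'; simp [hW u h3 h1 h2 u']
      rw [this, Set.ncard_empty]
      exact Nat.zero_le _
    · intro u h1 h2 h3
      simp
  obtain ⟨t, htW, htz, htx, hty⟩ := hbase
  obtain ⟨v, hvy, hzv, hxv⟩ := exists_second_triangle hH hmax hsupp hzx hzy hxy htW htz htx hty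
  have hzW := (hsupp _ _ hzv).1
  have hvW := (hsupp _ _ hzv).2
  set X := (W.erase z).erase v with hX
  have memX : ∀ {a}, a ∈ W → a ≠ z → a ≠ v → a ∈ X := fun h1 h2 h3 =>
    Finset.mem_erase.2 ⟨h3, Finset.mem_erase.2 ⟨h2, h1⟩⟩
  by_cases hsep : ∃ a, H.Adj z a ∧ H.Adj v a ∧ ¬ CutConnected H (X.erase a)
  · obtain ⟨a, hza, hva, hcut⟩ := hsep
    unfold CutConnected at hcut
    push Not at hcut
    obtain ⟨S, hS, hne, hSX, hno⟩ := hcut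
    have haW := (hsupp _ _ hza).2
    have hS' : ∀ s ∈ S, s ∈ W ∧ s ≠ z ∧ s ≠ v ∧ s ≠ a := by
      intro s hs
      have := hS hs
      simp only [hX, Finset.mem_erase] at this
      tauto
    -- The two sides of the separating triangle, each including it. The side containing `x y` is
    -- taken first in the gluing; the other is rooted at `v a`.
    set W₁ := insert z (insert v (insert a S)) with hW₁
    set W₂ := W \ S with hW₂
    have m₁ : ∀ u, u ∈ W₁ ↔ u = z ∨ u = v ∨ u = a ∨ u ∈ S := by
      intro u; simp [hW₁]
    have m₂ : ∀ u, u ∈ W₂ ↔ u ∈ W ∧ u ∉ S := by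
      intro u; simp [hW₂]
    have hadj : ∀ b c, H.Adj b c → (b ∈ W₁ ∧ c ∈ W₁) ∨ (b ∈ W₂ ∧ c ∈ W₂) := by
      have aux : ∀ b c, H.Adj b c → b ∈ S → c ∈ W₁ := by
        intro b c hbc hb
        by_contra hc
        rw [m₁] at hc
        push Not at hc
        exact hno b hb c (Finset.mem_erase.2 ⟨hc.2.2.1, memX (hsupp _ _ hbc).2 hc.1 hc.2.1⟩)
          hc.2.2.2 hbc
      intro b c hbc
      by_cases hb : b ∈ S
      · exact Or.inl ⟨(m₁ b).2 (by tauto), aux b c hbc hb⟩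
      · by_cases hc : c ∈ S
        · exact Or.inl ⟨aux c b hbc.symm hc, (m₁ c).2 (by tauto)⟩
        · exact Or.inr ⟨(m₂ b).2 ⟨(hsupp _ _ hbc).1, hb⟩, (m₂ c).2 ⟨(hsupp _ _ hbc).2, hc⟩⟩
    have hsub₁ : W₁ ⊆ W := by
      intro u hu
      rcases (m₁ u).1 hu with rfl | rfl | rfl | h
      · exact hzW
      · exact hvW
      · exact haW
      · exact (hS' u h).1
    have hc₁ : W₁.card < n := by
      rw [← hn]
      refine Finset.card_lt_card ⟨hsub₁, fun h => hSX (Finset.Subset.antisymm hS fun u hu => ?_)⟩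
      simp only [hX, Finset.mem_erase] at hu
      have := (m₁ u).1 (h hu.2.2.2)
      tauto
    have hc₂ : W₂.card < n := by
      rw [← hn]
      obtain ⟨s, hs⟩ := hne
      exact Finset.card_lt_card ⟨Finset.sdiff_subset, fun h =>
        ((m₂ s).1 (h (hS' s hs).1)).2 hs⟩
    have hz₁ : z ∈ W₁ := (m₁ z).2 (Or.inl rfl)
    have hv₁ : v ∈ W₁ := (m₁ v).2 (by tauto)
    have ha₁ : a ∈ W₁ := (m₁ a).2 (by tauto)
    have hz₂ : z ∈ W₂ := (m₂ z).2 ⟨hzW, fun h => (hS' z h).2.1 rfl⟩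
    have hv₂ : v ∈ W₂ := (m₂ v).2 ⟨hvW, fun h => (hS' v h).2.2.1 rfl⟩
    have ha₂ : a ∈ W₂ := (m₂ a).2 ⟨haW, fun h => (hS' a h).2.2.2 rfl⟩
    have hinter : ∀ u, u ∈ W₁ → u ∈ W₂ → u = z ∨ u = v ∨ u = a := by
      intro u h1 h2
      have := (m₁ u).1 h1
      have := (m₂ u).1 h2
      tauto
    have sub : ∀ {W' : Finset V} {p q : V}, W'.card < n → z ∈ W' → p ∈ W' → q ∈ W' → H.Adj z p →
        H.Adj z q → H.Adj p q → HasForest (restrictTo H W') z p q := by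
      intro W' p q hc hz hp hq hzp hzq hpq
      exact ih _ hc (hH.mono (restrictTo_le _)) (fun _ _ h => h.2) ⟨hzp, hz, hp⟩ ⟨hzq, hz, hq⟩
        ⟨hpq, hp, hq⟩ rfl
    rcases hadj x y hxy with ⟨hx, hy⟩ | ⟨hx, hy⟩
    · exact HasForest.glue hadj hz₁ hz₂ hinter hv₁ ha₁ hx hy (sub hc₁ hz₁ hx hy hzx hzy hxy)
        (sub hc₂ hz₂ hv₂ ha₂ hzv hza hva)
    · exact HasForest.glue (fun b c h => (hadj b c h).symm) hz₂ hz₁ (fun u h1 h2 => hinter u h2 h1)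
        hv₂ ha₂ hx hy (sub hc₂ hz₂ hx hy hzx hzy hxy) (sub hc₁ hz₁ hv₁ ha₁ hzv hza hva)
  · push Not at hsep
    obtain ⟨w, hcommon, hw⟩ : ∃ w, (∀ c, H.Adj z c → H.Adj v c → c = x ∨ c = w) ∧
        (w = v ∨ (H.Adj z w ∧ H.Adj v w)) := by
      by_cases hex : ∃ w, w ≠ x ∧ H.Adj z w ∧ H.Adj v w
      · obtain ⟨w, hwx, hzw, hvw⟩ := hex
        refine ⟨w, fun c hzc hvc => ?_, Or.inr ⟨hzw, hvw⟩⟩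
        by_contra hc
        push Not at hc
        exact hH.separating_triangle (X := X) (by simp [hX]) (by simp [hX])
          (memX (hsupp _ _ hzx).2 hzx.ne' hxv.ne) (memX (hsupp _ _ hzw).2 hzw.ne' hvw.ne')
          (memX (hsupp _ _ hzc).2 hzc.ne' hvc.ne') hwx.symm hc.1.symm hc.2.symm hzv hzx hzw hzc
          hxv.symm hvw hvc (hsep x hzx hxv.symm) (hsep w hzw hvw) (hsep c hzc hvc)
      · push Not at hex
        refine ⟨v, fun c hzc hvc => ?_, Or.inl rfl⟩
        by_contra hc
        push Not at hc
        exact hex c hc.1 hzc hvc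
    refine HasForest.of_contractPair hzv hxv.ne' hvy hzy hxy.ne hcommon hw ?_
    refine ih (W.erase v).card (by rw [← hn]; exact Finset.card_erase_lt_of_mem hvW)
      (hH.contractPair hzv) (W := W.erase v) ?_ ⟨hzx.ne, hzv.ne, hxv.ne, Or.inl hzx⟩
      ⟨hzy.ne, hzv.ne, hvy.symm, Or.inl hzy⟩ ⟨hxy.ne, hxv.ne, hvy.symm, Or.inl hxy⟩ rfl
    rintro a b ⟨h1, h2, h3, h4 | ⟨rfl, h4⟩ | ⟨rfl, h4⟩⟩
    · exact ⟨Finset.mem_erase.2 ⟨h2, (hsupp _ _ h4).1⟩, Finset.mem_erase.2 ⟨h3, (hsupp _ _ h4).2⟩⟩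
    · exact ⟨Finset.mem_erase.2 ⟨h2, hzW⟩, Finset.mem_erase.2 ⟨h3, (hsupp _ _ h4).2⟩⟩
    · exact ⟨Finset.mem_erase.2 ⟨h2, (hsupp _ _ h4).2⟩, Finset.mem_erase.2 ⟨h3, hzW⟩⟩

/-- Every spherical graph has a spanning subgraph `F` that is 1-degenerate with respect to a
ranking `s` such that `H - E(F)` is 2-degenerate with respect to a ranking `r`. -/
theorem IsSpherical.exists_forest (hH : IsSpherical H) :
    ∃ (F : SimpleGraph V) (r s : V → ℕ), F ≤ H ∧
      (∀ u, {u' | H.Adj u u' ∧ ¬ F.Adj u u' ∧ r u' ≤ r u}.ncard ≤ 2) ∧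
      (∀ u, {u' | F.Adj u u' ∧ s u' ≤ s u}.ncard ≤ 1) := by
  classical
  rcases Nat.lt_or_ge (Fintype.card V) 3 with hV | hV
  · refine ⟨⊥, 0, 0, bot_le, fun u => ?_, fun u => by simp⟩
    rw [← Nat.card_eq_fintype_card, ← Set.ncard_univ] at hV
    exact (Set.ncard_le_ncard (Set.subset_univ _) (Set.toFinite _)).trans (by omega)
  obtain ⟨K, hle, hK, -, hmax⟩ := exists_maximal_spherical (W := Finset.univ) hH (by simp)
  have hadd : ∀ a b, a ≠ b → IsSpherical (K ⊔ SimpleGraph.edge a b) → K.Adj a b := by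
    intro a b hab hsph
    exact hmax _ hsph (by simp) le_sup_left
      (Or.inr ((SimpleGraph.edge_adj _ _ _ _).2 ⟨Or.inl ⟨rfl, rfl⟩, hab⟩))
  -- An edge-maximal spherical graph is connected.
  have hclosed : ∀ S : Set V, (∀ u ∈ S, ∀ v, K.Adj u v → v ∈ S) → ∀ a ∈ S, ∀ b, b ∈ S := by
    intro S hS a ha b
    by_contra hb
    exact hb (hS a ha b (hadd a b (fun h => hb (h ▸ ha)) (hK.sup_edge_of_closed hS ha hb)))
  -- Consecutive neighbours being adjacent, a triangle-free maximal graph has maximum degree at most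
  -- one; by connectedness it would have at most two vertices.
  obtain ⟨z, x, y, hzx, hzy, hxy⟩ : ∃ z x y, K.Adj z x ∧ K.Adj z y ∧ K.Adj x y := by
    obtain ⟨σ, hr, hg⟩ := id hK
    obtain ⟨a, b, c, hab, hac, hbc⟩ := Fintype.two_lt_card_iff.1 hV
    by_contra hno
    push Not at hno
    have huniq : ∀ u v w, K.Adj u v → K.Adj u w → w = v := by
      intro u v w huv huw
      obtain ⟨v', huv', hv'⟩ := hr.exists_next huv
      by_cases h : v' = v
      · subst h
        exact hr.eq_of_fixed huv huw hv'
      · exact absurd (hadd v v' (Ne.symm h) (hr.isSpherical_sup_corner hg huv hv' (Ne.symm h)))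
          (hno u v v' huv huv')
    have ha : ∃ d, K.Adj a d := by
      by_contra hcon
      push Not at hcon
      have := hclosed {a} (fun u hu v huv => by
        rw [Set.mem_singleton_iff.1 hu] at huv
        exact absurd huv (hcon v)) a rfl b
      exact hab (Set.mem_singleton_iff.1 this).symm
    obtain ⟨d, had⟩ := ha
    have hall := hclosed {a, d} (fun u hu v huv => by
      rcases hu with rfl | rfl
      · exact Or.inr (huniq _ _ _ had huv)
      · exact Or.inl (huniq _ _ _ had.symm huv)) a (Or.inl rfl)
    have hb := (hall b).resolve_left hab.symm
    have hc := (hall c).resolve_left hac.symm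
    exact hbc (hb.trans hc.symm)
  obtain ⟨F, r, s, h⟩ := hK.hasForest (W := Finset.univ) (by simp) hzx hzy hxy
  -- With `z` lowest, `x` and `y` have below or beside them at most `z` and each other, and only
  -- neighbours of `z`, whose bound was one, gain `z`.
  refine ⟨F ⊓ H, fun u => if u = z then 0 else r u + 1, s, inf_le_right, fun u => ?_, fun u => ?_⟩
  · have hsub : {u' | H.Adj u u' ∧ ¬ (F ⊓ H).Adj u u' ∧
        (if u' = z then 0 else r u' + 1) ≤ if u = z then 0 else r u + 1} ⊆
        {u' | K.Adj u u' ∧ ¬ F.Adj u u' ∧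
          (if u' = z then 0 else r u' + 1) ≤ if u = z then 0 else r u + 1} :=
      fun u' ⟨h1, h2, h3⟩ => ⟨hle h1, fun h4 => h2 ⟨h4, h1⟩, h3⟩
    refine (Set.ncard_le_ncard hsub (Set.toFinite _)).trans ?_
    by_cases huz : u = z
    · refine (Set.ncard_le_ncard (t := ∅) ?_ (Set.toFinite _)).trans (by simp)
      rintro u' ⟨h1, h2, h3⟩
      subst huz
      simp only [h1.ne', if_true, if_false] at h3
      omega
    by_cases hux : u = x ∨ u = y
    · refine (Set.ncard_le_ncard (t := {z, if u = x then y else x}) ?_ (Set.toFinite _)).trans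
        ((Set.ncard_insert_le _ _).trans (by rw [Set.ncard_singleton]))
      rintro u' ⟨h1, h2, h3⟩
      by_cases hu' : u' = z
      · exact Or.inl hu'
      · simp only [huz, hu', if_false, (h.r_eq u).2 hux] at h3
        have h4 := (h.r_eq u').1 (by omega)
        right
        rcases h4 with rfl | rfl
        · rw [if_neg h1.ne]; rfl
        · rw [if_pos (hux.resolve_right h1.ne)]; rfl
    · push Not at hux
      have hold := h.r_le u hux.1 hux.2 huz
      by_cases hzu : K.Adj z u
      · rw [if_pos hzu] at hold
        refine (Set.ncard_le_ncard (t := insert z {u' | K.Adj u u' ∧ ¬ F.Adj u u' ∧ u' ≠ z ∧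
          r u' ≤ r u}) ?_ (Set.toFinite _)).trans ((Set.ncard_insert_le _ _).trans (by omega))
        rintro u' ⟨h1, h2, h3⟩
        by_cases hu' : u' = z
        · exact Or.inl hu'
        · simp only [huz, hu', if_false] at h3
          exact Or.inr ⟨h1, h2, hu', by omega⟩
      · rw [if_neg hzu] at hold
        refine (Set.ncard_le_ncard ?_ (Set.toFinite _)).trans hold
        rintro u' ⟨h1, h2, h3⟩
        have hu' : u' ≠ z := by rintro rfl; exact hzu h1.symm
        simp only [huz, hu', if_false] at h3
        exact ⟨h1, h2, hu', by omega⟩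
  · refine (Set.ncard_le_ncard (t := {u' | F.Adj u u' ∧ s u' ≤ s u}) (fun u' h => ⟨h.1.1, h.2⟩)
      (Set.toFinite _)).trans ?_
    by_cases hux : u = x ∨ u = y
    · refine (Set.ncard_le_ncard (t := ∅) ?_ (Set.toFinite _)).trans (by simp)
      rintro u' ⟨h1, h2⟩
      rw [(h.s_eq u).2 hux, Nat.le_zero] at h2
      have := (h.s_eq u').1 h2
      rcases hux with rfl | rfl <;> rcases this with rfl | rfl
      · exact h1.ne rfl
      · exact h.not_adj h1
      · exact h.not_adj h1.symm
      · exact h1.ne rfl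
    · push Not at hux
      by_cases huz : u = z
      · refine (Set.ncard_le_ncard (t := ∅) ?_ (Set.toFinite _)).trans (by simp)
        rintro u' ⟨h1, h2⟩
        exact h.avoid _ (huz ▸ h1)
      · exact h.s_le u hux.1 hux.2 huz

end

/-! ### Consequences of degeneracy -/

section
variable {V : Type*} [Fintype V] {G : SimpleGraph V} {k : ℕ} {r : V → ℕ}

/-- A highest vertex of a cycle has both its neighbours on the cycle at or below its rank. -/
theorem isAcyclic_of_ncard_le_one (h : ∀ u, {u' | G.Adj u u' ∧ r u' ≤ r u}.ncard ≤ 1) :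
    G.IsAcyclic := by
  classical
  intro v c hc
  obtain ⟨u, hu, hmax⟩ := c.support.toFinset.exists_max_image r
    ⟨v, List.mem_toFinset.2 c.start_mem_support⟩
  have h2 := hc.ncard_neighborSet_toSubgraph_eq_two (List.mem_toFinset.1 hu)
  have hsub : c.toSubgraph.neighborSet u ⊆ {u' | G.Adj u u' ∧ r u' ≤ r u} := by
    intro u' hu'
    refine ⟨c.toSubgraph.adj_sub hu', hmax u' (List.mem_toFinset.2 ?_)⟩
    exact c.mem_verts_toSubgraph.1 (c.toSubgraph.edge_vert hu'.symm)
  have := Set.ncard_le_ncard hsub (Set.toFinite _)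
  have := h u
  omega

/-- Ties are broken by an enumeration of the vertices. Neighbours of equal rank are already counted,
so no count increases. -/
theorem exists_injective_rank (h : ∀ u, {u' | G.Adj u u' ∧ r u' ≤ r u}.ncard ≤ k) :
    ∃ w : V → ℕ, Function.Injective w ∧ ∀ u, {u' | G.Adj u u' ∧ w u' ≤ w u}.ncard ≤ k := by
  have hlt : ∀ u v, r u < r v → r u * Fintype.card V + (Fintype.equivFin V u : ℕ) <
      r v * Fintype.card V + (Fintype.equivFin V v : ℕ) := by
    intro u v huv
    have h1 := (Fintype.equivFin V u).2
    have h2 := Nat.mul_le_mul_right (Fintype.card V) (Nat.succ_le_of_lt huv)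
    rw [Nat.succ_mul] at h2
    omega
  refine ⟨fun v => r v * Fintype.card V + (Fintype.equivFin V v : ℕ), fun u v huv => ?_, fun u => ?_⟩
  · rcases lt_trichotomy (r u) (r v) with h1 | h1 | h1
    · exact absurd huv (hlt u v h1).ne
    · simp only [h1, Nat.add_left_cancel_iff] at huv
      exact (Fintype.equivFin V).injective (Fin.ext huv)
    · exact absurd huv (hlt v u h1).ne'
  · refine (Set.ncard_le_ncard ?_ (Set.toFinite _)).trans (h u)
    rintro u' ⟨h1, h2⟩
    exact ⟨h1, not_lt.1 fun h3 => (hlt u u' h3).not_ge h2⟩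

/-- Greedy colouring by increasing rank: at most `k` of the `k + 1` colours are forbidden at each
vertex. -/
theorem isChoosable_of_degenerate {V : Type u} [Fintype V] {G : SimpleGraph V} {r : V → ℕ}
    (h : ∀ u, {u' | G.Adj u u' ∧ r u' ≤ r u}.ncard ≤ k) : IsChoosable.{u, w} G (k + 1) := by
  classical
  intro C L hL
  have key : ∀ S : Finset V, ∃ φ : V → C, (∀ v, φ v ∈ L v) ∧
      ∀ u ∈ S, ∀ v ∈ S, G.Adj u v → φ u ≠ φ v := by
    intro S
    induction S using Finset.induction_on_max_value r with
    | empty =>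
      have : ∀ v, (L v).Nonempty := fun v => Finset.card_pos.1 (by rw [hL]; omega)
      choose φ hφ using this
      exact ⟨φ, hφ, by simp⟩
    | insert m S hm hmax ih =>
      obtain ⟨φ, hφ, hS⟩ := ih
      have hcard : ((S.filter fun u => G.Adj m u).image φ).card < (L m).card := by
        rw [hL, Nat.lt_succ_iff]
        refine Finset.card_image_le.trans ((h m).trans' ?_)
        rw [← Set.ncard_coe_finset]
        refine Set.ncard_le_ncard (fun u hu => ?_) (Set.toFinite _)
        rw [Finset.mem_coe, Finset.mem_filter] at hu
        exact ⟨hu.2, hmax u hu.1⟩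
      obtain ⟨c, hc, hc'⟩ := Finset.exists_mem_notMem_of_card_lt_card hcard
      have hne : ∀ u ∈ S, G.Adj m u → c ≠ φ u := fun u hu hmu hcu =>
        hc' (Finset.mem_image.2 ⟨u, Finset.mem_filter.2 ⟨hu, hmu⟩, hcu.symm⟩)
      refine ⟨Function.update φ m c, fun v => ?_, ?_⟩
      · by_cases hv : v = m
        · subst hv; rwa [Function.update_self]
        · rw [Function.update_of_ne hv]; exact hφ v
      · intro u hu v hv huv
        rcases Finset.mem_insert.1 hu with rfl | huS
        · rcases Finset.mem_insert.1 hv with rfl | hvS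
          · exact absurd rfl huv.ne
          · rw [Function.update_self, Function.update_of_ne huv.ne']
            exact hne v hvS huv
        · have hum : u ≠ m := fun h => hm (h ▸ huS)
          rw [Function.update_of_ne hum]
          rcases Finset.mem_insert.1 hv with rfl | hvS
          · rw [Function.update_self]
            exact (hne u huS huv.symm).symm
          · rw [Function.update_of_ne (fun h : v = m => hm (h ▸ hvS))]
            exact hS u huS v hvS huv
  obtain ⟨φ, hφ, hG⟩ := key Finset.univ
  exact ⟨SimpleGraph.Coloring.mk φ fun {u v} huv => hG u (Finset.mem_univ u) v (Finset.mem_univ v) huv,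
    hφ⟩

/-- A set `U` of vertices contains an independent set `X` such that every vertex of `U` outside `X`
has a neighbour of smaller or equal rank in `X`. -/
theorem exists_kernel [DecidableEq V] (G : SimpleGraph V) (r : V → ℕ) (U : Finset V) :
    ∃ X ⊆ U, G.IsIndepSet (X : Set V) ∧ ∀ u ∈ U, u ∉ X → ∃ x ∈ X, G.Adj u x ∧ r x ≤ r u := by
  induction U using Finset.induction_on_max_value r with
  | empty => exact ⟨∅, Finset.Subset.refl _, by simp [SimpleGraph.IsIndepSet], by simp⟩
  | insert m U hm hmax ih =>
    obtain ⟨X, hXU, hX, hdom⟩ := ih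
    by_cases hex : ∃ x ∈ X, G.Adj m x
    · obtain ⟨x, hx, hmx⟩ := hex
      refine ⟨X, hXU.trans (Finset.subset_insert _ _), hX, fun u hu hu' => ?_⟩
      rcases Finset.mem_insert.1 hu with rfl | hu
      · exact ⟨x, hx, hmx, hmax x (hXU hx)⟩
      · exact hdom u hu hu'
    · push Not at hex
      refine ⟨insert m X, Finset.insert_subset_insert _ hXU, ?_, fun u hu hu' => ?_⟩
      · intro u hu v hv _ huv
        rcases Finset.mem_insert.1 hu with rfl | huX
        · rcases Finset.mem_insert.1 hv with rfl | hvX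
          · exact huv.ne rfl
          · exact hex v hvX huv
        · rcases Finset.mem_insert.1 hv with rfl | hvX
          · exact hex u huX huv.symm
          · exact hX huX hvX huv.ne huv
      · rw [Finset.mem_insert, not_or] at hu'
        obtain ⟨x, hx, h1⟩ := hdom u ((Finset.mem_insert.1 hu).resolve_left hu'.1) hu'.2
        exact ⟨x, Finset.mem_insert_of_mem hx, h1⟩

/-- Painter colours a kernel of each selected set. A vertex that pays a token without being coloured
loses a neighbour of smaller or equal rank, so its tokens continue to outnumber such neighbours. -/
theorem painterWins_of_degenerate [DecidableEq V] (S : Finset V) (t : V → ℕ)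
    (h : ∀ u ∈ S, {u' | u' ∈ S ∧ G.Adj u u' ∧ r u' ≤ r u}.ncard < t u) : PainterWins G S t := by
  induction hn : S.card using Nat.strong_induction_on generalizing S t with
  | _ n ih =>
  rcases S.eq_empty_or_nonempty with rfl | hS
  · exact PainterWins.done t
  choose σ hsub hind hdom using exists_kernel G r
  refine PainterWins.round S t (fun v hv => Nat.zero_lt_of_lt (h v hv)) σ (fun U _ _ => hsub U)
    (fun U _ _ => hind U) fun U hU hne => ?_
  have hσ : (σ U).Nonempty := by
    obtain ⟨u, hu⟩ := hne
    by_cases hu' : u ∈ σ U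
    · exact ⟨u, hu'⟩
    · obtain ⟨x, hx, -⟩ := hdom U u hu hu'
      exact ⟨x, hx⟩
  have hσS : σ U ⊆ S := (hsub U).trans hU
  refine ih _ ?_ _ _ (fun u hu => ?_) rfl
  · rw [← hn]
    obtain ⟨x, hx⟩ := hσ
    exact Finset.card_lt_card ⟨Finset.sdiff_subset, fun h' =>
      (Finset.mem_sdiff.1 (h' (hσS hx))).2 hx⟩
  · have huS := (Finset.mem_sdiff.1 hu).1
    have hmono : {u' | u' ∈ S \ σ U ∧ G.Adj u u' ∧ r u' ≤ r u} ⊆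
        {u' | u' ∈ S ∧ G.Adj u u' ∧ r u' ≤ r u} :=
      fun u' h' => ⟨(Finset.mem_sdiff.1 h'.1).1, h'.2⟩
    have hlt := h u huS
    by_cases huU : u ∈ U
    · rw [if_pos huU]
      obtain ⟨x, hx, hux, hr⟩ := hdom U u huU (Finset.mem_sdiff.1 hu).2
      have : {u' | u' ∈ S \ σ U ∧ G.Adj u u' ∧ r u' ≤ r u}.ncard <
          {u' | u' ∈ S ∧ G.Adj u u' ∧ r u' ≤ r u}.ncard :=
        Set.ncard_lt_ncard ⟨hmono, fun h' =>
          (Finset.mem_sdiff.1 (h' (show x ∈ {u' | u' ∈ S ∧ G.Adj u u' ∧ r u' ≤ r u} from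
            ⟨hσS hx, hux, hr⟩)).1).2 hx⟩ (Set.toFinite _)
      omega
    · rw [if_neg huU]
      exact (Set.ncard_le_ncard hmono (Set.toFinite _)).trans_lt hlt

theorem isPaintable_of_degenerate [DecidableEq V]
    (h : ∀ u, {u' | G.Adj u u' ∧ r u' ≤ r u}.ncard ≤ k) : IsPaintable G (k + 1) := by
  refine painterWins_of_degenerate (r := r) _ _ fun u _ => Nat.lt_succ_of_le ?_
  simpa using h u

open MvPolynomial in
/-- The product of the leading variables has coefficient one in a product of differences
of variables. -/
theorem coeff_prod_X_sub_X {ι : Type*} (w : V → ℕ) (s : Finset ι) (a b : ι → V)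
    (hab : ∀ i ∈ s, w (b i) < w (a i)) :
    (∏ i ∈ s, (X (a i) - X (b i) : MvPolynomial V ℝ)).coeff
        (∑ i ∈ s, Finsupp.single (a i) 1) = 1 ∧
    ∀ m, (∏ i ∈ s, (X (a i) - X (b i) : MvPolynomial V ℝ)).coeff m ≠ 0 →
      ∑ v, m v * w v ≤ ∑ v, (∑ i ∈ s, Finsupp.single (a i) 1 : V →₀ ℕ) v * w v := by
  classical
  induction s using Finset.induction_on with
  | empty =>
    refine ⟨by simp, fun m hm => ?_⟩
    simp only [Finset.prod_empty, coeff_one, ne_eq, ite_eq_right_iff, one_ne_zero, imp_false,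
      not_not] at hm
    simp [← hm]
  | insert i s hi ih =>
    obtain ⟨h1, h2⟩ := ih fun j hj => hab j (Finset.mem_insert_of_mem hj)
    have hlt := hab i (Finset.mem_insert_self i s)
    rw [Finset.prod_insert hi, Finset.sum_insert hi]
    set P := ∏ i ∈ s, (X (a i) - X (b i) : MvPolynomial V ℝ)
    set η := ∑ i ∈ s, (Finsupp.single (a i) 1 : V →₀ ℕ)
    have wt_add : ∀ (m : V →₀ ℕ) (c : V),
        ∑ v, (Finsupp.single c 1 + m : V →₀ ℕ) v * w v = w c + ∑ v, m v * w v := by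
      intro m c
      simp only [Finsupp.add_apply, add_mul, Finset.sum_add_distrib, Finsupp.single_apply]
      simp
    have hX : ∀ (m : V →₀ ℕ) (c : V), (X c * P).coeff m ≠ 0 →
        ∑ v, m v * w v ≤ w c + ∑ v, η v * w v := by
      intro m c hm
      rw [coeff_X_mul'] at hm
      split_ifs at hm with hc
      · have := h2 _ hm
        have e : Finsupp.single c 1 + (m - Finsupp.single c 1) = m := by
          refine add_tsub_cancel_of_le (Finsupp.single_le_iff.2 ?_)
          exact Nat.one_le_iff_ne_zero.2 (Finsupp.mem_support_iff.1 hc)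
        rw [← e, wt_add]
        exact Nat.add_le_add_left this _
      · exact absurd rfl hm
    refine ⟨?_, fun m hm => ?_⟩
    · rw [sub_mul, coeff_sub, coeff_X_mul, h1]
      -- The leading monomial has the largest `w`-weight; terms that use the lower variable `b i`
      -- weigh strictly less, so nothing cancels.
      have : (X (b i) * P).coeff (Finsupp.single (a i) 1 + η) = 0 := by
        by_contra h
        have := hX _ _ h
        rw [wt_add] at this
        omega
      rw [this, sub_zero]
    · rw [wt_add]
      rw [sub_mul, coeff_sub] at hm
      by_cases ha : (X (a i) * P).coeff m = 0
      · rw [ha, zero_sub, neg_ne_zero] at hm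
        exact (hX _ _ hm).trans (by omega)
      · exact hX _ _ ha

-- After making the ranks injective, each factor is, up to sign, the variable of the higher end
-- minus that of the lower end. In the product of the leading variables the exponent of `v` is the
-- number of its lower neighbours.
open MvPolynomial in
theorem alonTarsiNumber_le_of_degenerate [LinearOrder V]
    (h : ∀ u, {u' | G.Adj u u' ∧ r u' ≤ r u}.ncard ≤ k) : alonTarsiNumber G ≤ k + 1 := by
  classical
  obtain ⟨w, hw, hk⟩ := exists_injective_rank h
  refine Nat.sInf_le ?_
  let a : V × V → V := fun p => if w p.1 < w p.2 then p.2 else p.1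
  let b : V × V → V := fun p => if w p.1 < w p.2 then p.1 else p.2
  let s : Finset (V × V) := Finset.univ.filter fun p => p.1 < p.2 ∧ G.Adj p.1 p.2
  have hs : ∀ p ∈ s, p.1 < p.2 ∧ G.Adj p.1 p.2 := fun p hp => (Finset.mem_filter.1 hp).2
  have hab : ∀ p ∈ s, w (b p) < w (a p) := by
    intro p hp
    simp only [a, b]
    split_ifs with h1
    · exact h1
    · exact lt_of_le_of_ne (not_lt.1 h1) fun h2 => (hs p hp).1.ne' (hw h2)
  have hprod : graphPolynomial G =
      C (∏ p ∈ s, if w p.1 < w p.2 then (1 : ℝ) else -1) *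
        ∏ p ∈ s, (X (a p) - X (b p) : MvPolynomial V ℝ) := by
    unfold graphPolynomial
    rw [map_prod, ← Finset.prod_mul_distrib]
    refine Finset.prod_congr (by ext p; simp [s]) fun p _ => ?_
    simp only [a, b]
    split_ifs <;> simp
  refine ⟨∑ p ∈ s, Finsupp.single (a p) 1, ?_, fun v => Nat.lt_succ_of_le ?_⟩
  · rw [hprod, coeff_C_mul, (coeff_prod_X_sub_X w s a b hab).1, mul_one]
    refine Finset.prod_ne_zero_iff.2 fun p _ => ?_
    split_ifs <;> norm_num
  · have e : (∑ p ∈ s, (Finsupp.single (a p) 1 : V →₀ ℕ)) v = (s.filter fun p => a p = v).card := by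
      rw [Finsupp.finsetSum_apply, Finset.card_filter]
      exact Finset.sum_congr rfl fun p _ => Finsupp.single_apply
    rw [e]
    refine (hk v).trans' ?_
    have hinj : Set.InjOn b (s.filter fun p => a p = v) := by
      intro p hp q hq hpq
      obtain ⟨hp, hpv⟩ := Finset.mem_filter.1 (Finset.mem_coe.1 hp)
      obtain ⟨hq, hqv⟩ := Finset.mem_filter.1 (Finset.mem_coe.1 hq)
      have h1 := (hs p hp).1
      have h2 := (hs q hq).1
      have hpq' : a p = a q := hpv.trans hqv.symm
      simp only [a, b] at hpq hpq'
      split_ifs at hpq hpq' with h3 h4 h4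
      · exact Prod.ext hpq hpq'
      · rw [hpq, hpq'] at h1
        exact absurd h1 h2.asymm
      · rw [hpq, hpq'] at h1
        exact absurd h1 h2.asymm
      · exact Prod.ext hpq' hpq
    rw [← Finset.card_image_of_injOn hinj, ← Set.ncard_coe_finset]
    refine Set.ncard_le_ncard (fun u hu => ?_) (Set.toFinite _)
    obtain ⟨p, hp, rfl⟩ := Finset.mem_image.1 (Finset.mem_coe.1 hu)
    obtain ⟨hps, rfl⟩ := Finset.mem_filter.1 hp
    refine ⟨?_, (hab p hps).le⟩
    simp only [a, b]
    split_ifs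
    · exact (hs p hps).2.symm
    · exact (hs p hps).2

end

/-! ### Rotation systems built by a sweep -/

section

open Equiv Equiv.Perm

section
variable {D : Type*} {σ τ α : Perm D}

theorem isChain_congr_of_mem {R R' : D → D → Prop} {l : List D} {y : D}
    (h : (l ++ [y]).IsChain R) (hR : ∀ x ∈ l, ∀ z, R x z → R' x z) : (l ++ [y]).IsChain R' := by
  induction l with
  | nil => exact List.isChain_singleton y
  | cons x l ih =>
    have h2 := ih (List.IsChain.of_cons h) fun z hz => hR z (List.mem_cons_of_mem _ hz)
    cases l with
    | nil => exact List.isChain_pair.2 (hR x (by simp) y (List.isChain_pair.1 h))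
    | cons z l =>
      simp only [List.cons_append, List.isChain_cons_cons] at h h2 ⊢
      exact ⟨hR x (by simp) z h.1, h2⟩

theorem orb_of_chain {l : List D} {a : D} (h : (a :: l).IsChain fun x y => σ x = y) :
    ∀ x ∈ l, orb σ a x := by
  induction l generalizing a with
  | nil => simp
  | cons b l ih =>
    rw [List.isChain_cons_cons] at h
    have hab := h.1 ▸ orb_apply σ a
    intro x hx
    rcases List.mem_cons.1 hx with rfl | hx
    · exact hab
    · exact Setoid.trans' _ hab (ih h.2 x hx)

theorem apply_mem_of_chain {l : List D} {y : D} (h : (l ++ [y]).IsChain fun x y => σ x = y) :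
    ∀ x ∈ l, σ x ∈ l ∨ σ x = y := by
  induction l with
  | nil => simp
  | cons b l ih =>
    have ih' := ih (List.IsChain.of_cons h)
    intro x hx
    rcases List.mem_cons.1 hx with rfl | hx
    · cases l with
      | nil => exact Or.inr (List.isChain_pair (R := fun x y => σ x = y) |>.1 h)
      | cons c l =>
        simp only [List.cons_append, List.isChain_cons_cons] at h
        exact Or.inl (by rw [h.1]; simp)
    · rcases ih' x hx with h' | h'
      · exact Or.inl (List.mem_cons_of_mem _ h')
      · exact Or.inr h'

theorem orb_of_eqOn [Finite D] {T : Set D} (hT : ∀ x ∈ T, σ x ∈ T) (hτ : ∀ x ∈ T, τ x = σ x) {x y : D}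
    (hx : x ∈ T) (h : orb σ x y) : orb τ x y := by
  obtain ⟨n, rfl⟩ := SameCycle.exists_nat_pow_eq h
  have : ∀ n : ℕ, (σ ^ n) x ∈ T ∧ orb τ x ((σ ^ n) x) := by
    intro n
    induction n with
    | zero => exact ⟨hx, Setoid.refl' _ _⟩
    | succ n ih =>
      rw [pow_succ', mul_apply]
      exact ⟨hT _ ih.1, Setoid.trans' _ ih.2 (hτ _ ih.1 ▸ orb_apply τ _)⟩
  exact (this n).2

variable [Finite D] [DecidableEq D]

/-- Insert a loop, consisting of the fixed darts `d` and `α d`, after the dart `c`. -/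
theorem GenusZero.insert_loop (hg : GenusZero σ α) {c d e : D} (hde : α d = e) (hed : α e = d)
    (hd : σ d = d) (he : σ e = e) (hne : d ≠ e) (hcd : c ≠ d) (hce : c ≠ e) :
    ∃ τ : Perm D, GenusZero τ α ∧ τ c = d ∧ τ d = e ∧ τ e = σ c ∧
      ∀ x, x ≠ c → x ≠ d → x ≠ e → τ x = σ x := by
  have hσc : σ c ≠ d := fun h => hcd (σ.injective (h.trans hd.symm))
  have hσc' : σ c ≠ e := fun h => hce (σ.injective (h.trans he.symm))
  -- Inserting `d` after `c` joins the component of `d` and `e` to the rest.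
  have h1 : GenusZero (swap d (σ c) * σ) α := by
    refine hg.swap_mul (Or.inr (Or.inr ?_))
    refine not_comps_of_invariant (T := {x | x = d ∨ x = e}) ?_ ?_ (Or.inl rfl) ?_
    · rintro x (rfl | rfl)
      · exact Or.inl hd
      · exact Or.inr he
    · rintro x (rfl | rfl)
      · exact Or.inr hde
      · exact Or.inl hed
    · rintro (h | h)
      · exact hσc h
      · exact hσc' h
  have e1 : (swap d (σ c) * σ) d = σ c := by rw [mul_apply, hd, swap_apply_left]
  have e2 : (swap d (σ c) * σ) e = e := by
    rw [mul_apply, he, swap_apply_of_ne_of_ne hne.symm hσc'.symm]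
  have e3 : (swap d (σ c) * σ) c = d := by rw [mul_apply, swap_apply_right]
  -- Inserting `e` after `d` splits a face, because the face permutation sends `e` to `σ c`.
  have h2 : GenusZero (swap e (σ c) * (swap d (σ c) * σ)) α := by
    refine h1.swap_mul (Or.inr (Or.inl ?_))
    have := orb_apply (swap d (σ c) * σ * α) e
    rwa [mul_apply, hed, e1] at this
  refine ⟨_, h2, ?_, ?_, ?_, ?_⟩
  · rw [mul_apply, e3, swap_apply_of_ne_of_ne hne hσc.symm]
  · rw [mul_apply, e1, swap_apply_right]
  · rw [mul_apply, e2, swap_apply_left]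
  · intro x hxc hxd hxe
    have hx1 : σ x ≠ d := fun h => hxd (σ.injective (h.trans hd.symm))
    have hx2 : σ x ≠ e := fun h => hxe (σ.injective (h.trans he.symm))
    have hx3 : σ x ≠ σ c := fun h => hxc (σ.injective h)
    rw [mul_apply, mul_apply, swap_apply_of_ne_of_ne hx1 hx3, swap_apply_of_ne_of_ne hx2 hx3]

/-- Insert nested loops into a cycle. -/
theorem GenusZero.insert_loops (hα : ∀ x, α (α x) = x) {a : D} (O : List D) {l m : List D}
    (hg : GenusZero σ α) (hch : (a :: (l ++ m) ++ [a]).IsChain fun x y => σ x = y)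
    (hnd : (a :: (l ++ m)).Nodup) (hO : O.Nodup) (hαO : ∀ d ∈ O, α d ∉ O)
    (hfix : ∀ d ∈ O, σ d = d ∧ σ (α d) = α d ∧ α d ≠ d ∧ d ∉ a :: (l ++ m) ∧ α d ∉ a :: (l ++ m)) :
    ∃ τ : Perm D, GenusZero τ α ∧
      (a :: (l ++ O ++ ((O.map α).reverse ++ m)) ++ [a]).IsChain (fun x y => τ x = y) ∧
      ∀ x, x ∉ a :: (l ++ m) → x ∉ O → α x ∉ O → τ x = σ x := by
  induction O generalizing σ l m with
  | nil => exact ⟨σ, hg, by simpa using hch, fun x _ _ _ => rfl⟩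
  | cons d O ih =>
    obtain ⟨h1, h2, h3, h4, h5⟩ := hfix d (by simp)
    -- The loop goes right after the last dart `c` of `a :: l`; the later loops go between `d` and
    -- `α d`, which makes them nested.
    obtain ⟨P, c, hP⟩ : ∃ P c, a :: l = P ++ [c] :=
      ⟨_, _, (List.dropLast_append_getLast (List.cons_ne_nil a l)).symm⟩
    have hlm : a :: (l ++ m) = P ++ c :: m := by
      rw [← List.cons_append, hP]; simp
    rw [hlm] at hch hnd h4 h5
    have hcm : c ∈ P ++ c :: m := by simp
    obtain ⟨τ, t1, t2, t3, t4, t5⟩ := hg.insert_loop (c := c) rfl (hα d) h1 h2 h3.symm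
      (fun h => h4 (h ▸ hcm)) (fun h => h5 (h ▸ hcm))
    have hPc : ∀ x ∈ P, x ≠ c := fun x hx h => by
      subst h
      exact (List.nodup_append.1 hnd).2.2 _ hx _ (by simp) rfl
    have hmc : ∀ x ∈ m, x ≠ c := fun x hx h => by
      subst h
      exact (List.nodup_cons.1 (List.nodup_append.1 hnd).2.1).1 hx
    have ht : ∀ x ∈ P ++ c :: m, x ≠ c → τ x = σ x := fun x hx hxc =>
      t5 x hxc (fun h => h4 (h ▸ hx)) (fun h => h5 (h ▸ hx))
    have hch' : (a :: ((l ++ [d]) ++ (α d :: m)) ++ [a]).IsChain fun x y => τ x = y := by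
      have hrw : a :: ((l ++ [d]) ++ (α d :: m)) ++ [a] = P ++ ([c] ++ ([d] ++ (α d :: (m ++ [a])))) := by
        have : a :: ((l ++ [d]) ++ (α d :: m)) ++ [a] = (a :: l) ++ (d :: α d :: m ++ [a]) := by simp
        rw [this, hP]; simp
      rw [hrw]
      have hch2 : ((P ++ [c]) ++ (m ++ [a])).IsChain fun x y => σ x = y := by
        simpa using hch
      obtain ⟨k1, k2, k3⟩ := List.isChain_append.1 hch2
      have k1' := isChain_congr_of_mem k1 (R' := fun x y => τ x = y) fun x hx z hz => by
        rw [ht x (by simp [hx]) (hPc x hx)]; exact hz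
      have k2' := isChain_congr_of_mem k2 (R' := fun x y => τ x = y) fun x hx z hz => by
        rw [ht x (by simp [hx]) (hmc x hx)]; exact hz
      have k4 : (α d :: (m ++ [a])).IsChain fun x y => τ x = y := by
        refine List.isChain_cons.2 ⟨fun y hy => ?_, k2'⟩
        rw [t4]
        exact k3 c (by simp) y hy
      rw [← List.append_assoc]
      refine List.isChain_append.2 ⟨k1', ?_, ?_⟩
      · exact List.isChain_cons_cons.2 ⟨t3, k4⟩
      · intro x hx y hy
        simp at hx hy
        rw [← hx, ← hy, t2]
    have hO' := List.nodup_cons.1 hO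
    have hnd' : (a :: ((l ++ [d]) ++ (α d :: m))).Nodup := by
      have hperm : (a :: ((l ++ [d]) ++ (α d :: m))).Perm (d :: α d :: (a :: (l ++ m))) := by
        have : ((l ++ [d]) ++ (α d :: m)).Perm (d :: α d :: (l ++ m)) := by
          rw [List.append_assoc]
          refine List.perm_middle.trans (List.Perm.cons _ ?_)
          exact List.perm_middle
        refine (this.cons a).trans ?_
        exact (List.Perm.swap _ _ _).trans (List.Perm.cons _ (List.Perm.swap _ _ _))
      rw [hperm.nodup_iff, hlm, List.nodup_cons, List.nodup_cons]
      refine ⟨?_, h5, hnd⟩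
      rw [List.mem_cons, not_or]
      exact ⟨h3.symm, h4⟩
    have hmem : ∀ x, x ∈ a :: ((l ++ [d]) ++ (α d :: m)) ↔ x ∈ a :: (l ++ m) ∨ x = d ∨ x = α d := by
      intro x
      simp only [List.mem_cons, List.mem_append, List.not_mem_nil, or_false]
      tauto
    have hαd : ∀ d' ∈ O, d' ≠ α d ∧ α d' ≠ α d ∧ d' ≠ d ∧ α d' ≠ d := by
      intro d' hd'
      have hne : d' ≠ d := fun h => hO'.1 (h ▸ hd')
      refine ⟨fun h => ?_, fun h => hne (α.injective h), hne, fun h => ?_⟩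
      · exact hαO d (by simp) (by rw [← h]; simp [hd'])
      · exact hαO d' (by simp [hd']) (by rw [h]; simp)
    obtain ⟨ρ, r1, r2, r3⟩ := ih t1 hch' hnd' hO'.2
      (fun d' hd' h => hαO d' (by simp [hd']) (by simp [h])) (fun d' hd' => by
        obtain ⟨f1, f2, f3, f4, f5⟩ := hfix d' (by simp [hd'])
        obtain ⟨g1, g2, g3, g4⟩ := hαd d' hd'
        rw [hmem, hmem]
        have f4' := f4
        have f5' := f5
        rw [hlm] at f4' f5'
        refine ⟨?_, ?_, f3, by tauto, by tauto⟩
        · rw [t5 d' (fun h => f4' (h ▸ hcm)) g3 g1, f1]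
        · rw [t5 (α d') (fun h => f5' (h ▸ hcm)) g4 g2, f2])
    refine ⟨ρ, r1, ?_, fun x hx hxO hxO' => ?_⟩
    · simpa using r2
    · rw [List.mem_cons, not_or] at hxO hxO'
      have hxα : x ≠ α d := fun h => hxO'.1 (by rw [h, hα])
      rw [r3 x (by rw [hmem]; tauto) hxO.2 hxO'.2]
      rw [hlm] at hx
      exact t5 x (fun h => hx (h ▸ hcm)) hxO.1 hxα

/-- Split a cycle into two. -/
theorem GenusZero.split_cycle (hg : GenusZero σ α) {a s : D} {A S B : List D}
    (hch : (a :: (A ++ (s :: S) ++ B) ++ [a]).IsChain fun x y => σ x = y)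
    (hnd : (a :: (A ++ (s :: S) ++ B)).Nodup) :
    ∃ τ : Perm D, GenusZero τ α ∧ (a :: (A ++ B) ++ [a]).IsChain (fun x y => τ x = y) ∧
      (s :: S ++ [s]).IsChain (fun x y => τ x = y) ∧
      ∀ x, x ∉ a :: (A ++ (s :: S) ++ B) → τ x = σ x := by
  obtain ⟨P, c, hP⟩ : ∃ P c, a :: A = P ++ [c] :=
    ⟨_, _, (List.dropLast_append_getLast (List.cons_ne_nil a A)).symm⟩
  obtain ⟨Q, t, hQ⟩ : ∃ Q t, s :: S = Q ++ [t] :=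
    ⟨_, _, (List.dropLast_append_getLast (List.cons_ne_nil s S)).symm⟩
  have hl : a :: (A ++ (s :: S) ++ B) = P ++ [c] ++ (Q ++ [t]) ++ B := by
    rw [← hP, ← hQ]; simp
  have horb : ∀ x ∈ A ++ (s :: S) ++ B ++ [a], orb σ a x := orb_of_chain hch
  have horb' : ∀ x ∈ P ++ [c] ++ (Q ++ [t]) ++ B, orb σ a x := by
    intro x hx
    rw [← hl] at hx
    rcases List.mem_cons.1 hx with rfl | hx
    · exact Setoid.refl' _ _
    · exact horb x (by simp only [List.mem_append] at hx ⊢; tauto)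
  have hct : orb σ (σ c) (σ t) := by
    have h1 := horb' c (by simp)
    have h2 := horb' t (by simp)
    exact Setoid.trans' _ (Setoid.symm' _ (Setoid.trans' _ h1 (orb_apply σ c)))
      (Setoid.trans' _ h2 (orb_apply σ t))
  rw [hl] at hnd
  have nP : ∀ x ∈ P, x ≠ c ∧ x ≠ t := by
    intro x hx
    simp only [List.nodup_append, List.mem_append, List.mem_singleton] at hnd
    constructor
    · rintro rfl
      exact hnd.1.1.2.2 x hx x rfl rfl
    · rintro rfl
      exact hnd.1.2.2 x (Or.inl hx) x (Or.inr rfl) rfl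
  have nQ : ∀ x ∈ Q, x ≠ c ∧ x ≠ t := by
    intro x hx
    simp only [List.nodup_append, List.mem_append, List.mem_singleton] at hnd
    constructor
    · rintro rfl
      exact hnd.1.2.2 x (Or.inr rfl) x (Or.inl hx) rfl
    · rintro rfl
      exact hnd.1.2.1.2.2 x hx x rfl rfl
  have nB : ∀ x ∈ B, x ≠ c ∧ x ≠ t := by
    intro x hx
    simp only [List.nodup_append, List.mem_append, List.mem_singleton] at hnd
    constructor
    · rintro rfl
      exact hnd.2.2 x (Or.inl (Or.inr rfl)) x hx rfl
    · rintro rfl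
      exact hnd.2.2 x (Or.inr (Or.inr rfl)) x hx rfl
  have hne : c ≠ t := by
    rintro rfl
    simp only [List.nodup_append, List.mem_append, List.mem_singleton] at hnd
    exact hnd.1.2.2 c (Or.inr rfl) c (Or.inr rfl) rfl
  -- Exchanging the images of `c` and `t`, the last darts of `a :: A` and of `s :: S`, closes the
  -- stretch `s :: S` and bridges the gap it leaves.
  have τc : (swap (σ c) (σ t) * σ) c = σ t := by rw [mul_apply, swap_apply_left]
  have τt : (swap (σ c) (σ t) * σ) t = σ c := by rw [mul_apply, swap_apply_right]
  have τx : ∀ x, x ≠ c ∧ x ≠ t → (swap (σ c) (σ t) * σ) x = σ x := fun x hx => by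
    rw [mul_apply, swap_apply_of_ne_of_ne (fun h => hx.1 (σ.injective h))
      (fun h => hx.2 (σ.injective h))]
  have hch' : ((P ++ [c]) ++ ((Q ++ [t]) ++ (B ++ [a]))).IsChain fun x y => σ x = y := by
    have : a :: (A ++ (s :: S) ++ B) ++ [a] = (P ++ [c]) ++ ((Q ++ [t]) ++ (B ++ [a])) := by
      rw [hl]; simp
    rwa [this] at hch
  obtain ⟨k1, k2, k3⟩ := List.isChain_append.1 hch'
  obtain ⟨m1, m2, m3⟩ := List.isChain_append.1 k2
  have k1' := isChain_congr_of_mem k1 (R' := fun x y => (swap (σ c) (σ t) * σ) x = y) fun x hx z hz => by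
    rw [τx x (nP x hx)]; exact hz
  have m1' := isChain_congr_of_mem m1 (R' := fun x y => (swap (σ c) (σ t) * σ) x = y) fun x hx z hz => by
    rw [τx x (nQ x hx)]; exact hz
  have m2' := isChain_congr_of_mem m2 (R' := fun x y => (swap (σ c) (σ t) * σ) x = y) fun x hx z hz => by
    rw [τx x (nB x hx)]; exact hz
  refine ⟨swap (σ c) (σ t) * σ, hg.swap_mul (Or.inl hct), ?_, ?_, ?_⟩
  · have : a :: (A ++ B) ++ [a] = (P ++ [c]) ++ (B ++ [a]) := by rw [← hP]; simp
    rw [this]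
    refine List.isChain_append.2 ⟨k1', m2', fun x hx y hy => ?_⟩
    simp only [List.getLast?_append, List.getLast?_singleton, Option.some_or, Option.mem_def,
      Option.some.injEq] at hx
    rw [← hx, τc]
    exact m3 t (by simp) y hy
  · rw [hQ]
    refine List.isChain_append.2 ⟨m1', List.isChain_singleton s, fun x hx y hy => ?_⟩
    simp only [List.getLast?_append, List.getLast?_singleton, Option.some_or, Option.mem_def,
      Option.some.injEq] at hx
    simp only [List.head?_cons, Option.mem_def, Option.some.injEq] at hy
    rw [← hx, τt, ← hy]
    refine k3 c (by simp) s ?_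
    rw [← hQ]; simp
  · intro x hx
    rw [hl] at hx
    exact τx x ⟨by rintro rfl; exact hx (by simp), by rintro rfl; exact hx (by simp)⟩

end

end

/-! ### The state of the sweep and its step -/

section

open Equiv Equiv.Perm

section
variable {V : Type*} [Fintype V] [DecidableEq V] {H : SimpleGraph V} {o : V} {Q : Finset V}
  {σ : Perm (V × V)} {L A S B : List (V × V)}

/-- A rotation system of the graph formed by the edges of `H` that meet `Q`, in which all vertices
outside `Q` are merged into one; the darts leaving the merged vertex are listed in `L`, after the
sentinel `(o, o)`. -/
structure SweepState (H : SimpleGraph V) (o : V) (Q : Finset V) (σ : Perm (V × V))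
    (L : List (V × V)) : Prop where
  genus : GenusZero σ (rev V)
  mem : ∀ d, d ∈ L ↔ H.Adj d.1 d.2 ∧ d.1 ∉ Q ∧ d.2 ∈ Q
  nodup : L.Nodup
  chain : ((o, o) :: L ++ [(o, o)]).IsChain fun x y => σ x = y
  dart : ∀ d : V × V, d.1 ∈ Q → H.Adj d.1 d.2 → (σ d).1 = d.1 ∧ H.Adj (σ d).1 (σ d).2
  cycle : ∀ p ∈ Q, ∀ r r', H.Adj p r → H.Adj p r' → orb σ (p, r) (p, r')
  fixed : ∀ d : V × V, d ≠ (o, o) → (¬ H.Adj d.1 d.2 ∨ (d.1 ∉ Q ∧ d.2 ∉ Q)) → σ d = d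

/-- The merged vertex carries only the sentinel, an unused diagonal dart. It keeps the cycle
nonempty, so that insertion is always possible, and marks where the list starts. -/
theorem sweepState_empty (H : SimpleGraph V) (o : V) : SweepState H o ∅ 1 [] where
  genus := genusZero_one _
  mem := by simp
  nodup := List.nodup_nil
  chain := List.isChain_pair.2 rfl
  dart := by simp
  cycle := by simp
  fixed := fun _ _ _ => rfl

theorem SweepState.isSpherical (h : SweepState H o Finset.univ σ L) : IsSpherical H := by
  have hL : L = [] := List.eq_nil_iff_forall_not_mem.2 fun d hd =>
    ((h.mem d).1 hd).2.1 (Finset.mem_univ _)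
  have ho : σ (o, o) = (o, o) := by
    have := h.chain
    rw [hL] at this
    exact List.isChain_pair (R := fun x y => σ x = y) |>.1 this
  have hfix : ∀ u v, ¬ H.Adj u v → σ (u, v) = (u, v) := by
    intro u v huv
    by_cases hd : (u, v) = (o, o)
    · rw [hd, ho]
    · exact h.fixed _ hd (Or.inl huv)
  refine ⟨σ, ⟨fun d => ?_, hfix, fun u v w => h.cycle u (Finset.mem_univ _) v w⟩, h.genus⟩
  by_cases hd : H.Adj d.1 d.2
  · exact (h.dart d (Finset.mem_univ _) hd).1
  · exact congrArg Prod.fst (hfix d.1 d.2 hd)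

/-- The sweep passes the vertex `q`: the darts `S` at `q` whose other ends have been swept are
consecutive in the list, and are replaced by the edges from `q` to the other vertices. -/
theorem SweepState.step (h : SweepState H o Q σ (A ++ S ++ B)) {q : V} (hq : q ∉ Q)
    (hS : ∀ d ∈ S, d.1 = q) (hA : ∀ d ∈ A, d.1 ≠ q) (hB : ∀ d ∈ B, d.1 ≠ q) {O : List (V × V)}
    (hOn : O.Nodup) (hO : ∀ d, d ∈ O ↔ H.Adj d.1 d.2 ∧ d.1 = q ∧ d.2 ∉ Q) :
    ∃ τ, SweepState H o (insert q Q) τ (A ++ (O.map (rev V)).reverse ++ B) := by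
  have hmemL := h.mem
  have hnoto : (o, o) ∉ A ++ S ++ B := fun h' => ((hmemL _).1 h').1.ne rfl
  have hndo : ((o, o) :: (A ++ S ++ B)).Nodup := List.nodup_cons.2 ⟨hnoto, h.nodup⟩
  have hrev : ∀ d : V × V, rev V (rev V d) = d := fun d => rfl
  have hOL : ∀ d ∈ O, d ∉ (o, o) :: (A ++ S ++ B) ∧ rev V d ∉ (o, o) :: (A ++ S ++ B) := by
    intro d hd
    obtain ⟨h1, h2, h3⟩ := (hO d).1 hd
    rw [List.mem_cons, List.mem_cons, hmemL, hmemL]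
    refine ⟨?_, ?_⟩
    · rintro (rfl | h')
      · exact h1.ne rfl
      · exact h3 h'.2.2
    · rintro (h' | h')
      · have h4 : d = (o, o) := by rw [← hrev d, h']; rfl
        rw [h4] at h1
        exact h1.ne rfl
      · have : d.1 ∈ Q := h'.2.2
        exact hq (h2 ▸ this)
  have hOne : ∀ d ∈ O, ∀ d' ∈ O, rev V d ≠ d' := by
    intro d hd d' hd' he
    obtain ⟨h1, h2, h3⟩ := (hO d).1 hd
    obtain ⟨h1', h2', h3'⟩ := (hO d').1 hd'
    have : d'.1 = d.2 := by rw [← he]; rfl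
    exact h1.ne (h2.trans (h2'.symm.trans this))
  -- Edges from `q` to unswept vertices are loops at the merged vertex, inserted right after `S`.
  obtain ⟨ρ, g1, c1, f1⟩ := h.genus.insert_loops (l := A ++ S) (m := B) hrev O h.chain hndo hOn
    (fun d hd hd' => hOne d hd _ hd' rfl) (fun d hd => by
      obtain ⟨h1, h2, h3⟩ := (hO d).1 hd
      have k1 := (hOL d hd).1
      have k2 := (hOL d hd).2
      refine ⟨h.fixed d ?_ (Or.inr ⟨h2 ▸ hq, h3⟩), h.fixed _ ?_ (Or.inr ⟨h3, ?_⟩),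
        hOne d hd d hd, k1, k2⟩
      · intro h'; exact k1 (by rw [h']; simp)
      · intro h'; exact k2 (by rw [h']; simp)
      · show d.1 ∉ Q
        exact h2 ▸ hq)
  set O' := (O.map (rev V)).reverse with hO'
  have memO' : ∀ d, d ∈ O' ↔ rev V d ∈ O := by
    intro d
    rw [hO', List.mem_reverse, List.mem_map]
    exact ⟨fun ⟨e, he, hed⟩ => by rw [← hed]; exact he, fun hd => ⟨_, hd, rfl⟩⟩
  have hnd' : ((o, o) :: (A ++ (S ++ O) ++ (O' ++ B))).Nodup := by
    have hperm : ((o, o) :: (A ++ (S ++ O) ++ (O' ++ B))).Perm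
        (((o, o) :: (A ++ S ++ B)) ++ (O ++ O')) := by
      rw [List.perm_iff_count]
      intro d
      simp only [List.count_cons, List.count_append]
      omega
    rw [hperm.nodup_iff, List.nodup_append, List.nodup_append]
    refine ⟨hndo, ⟨hOn, ?_, ?_⟩, ?_⟩
    · exact List.nodup_reverse.2 (hOn.map (rev V).injective)
    · intro d hd e he hde
      subst hde
      exact hOne _ ((memO' d).1 he) _ hd rfl
    · intro d hd e he hde
      subst hde
      rcases List.mem_append.1 he with he | he
      · exact (hOL d he).1 hd
      · exact (hOL _ ((memO' d).1 he)).2 hd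
  -- Splitting off `S ++ O` makes it the rotation at `q`; the opposite darts `O'` stay at the merged
  -- vertex. If `q` is isolated, nothing is split.
  have hcyc : ∃ τ : Perm (V × V), GenusZero τ (rev V) ∧
      ((o, o) :: (A ++ O' ++ B) ++ [(o, o)]).IsChain (fun x y => τ x = y) ∧
      (∀ d ∈ S ++ O, τ d ∈ S ++ O) ∧ (∀ d ∈ S ++ O, ∀ e ∈ S ++ O, orb τ d e) ∧
      ∀ x, x ∉ (o, o) :: (A ++ (S ++ O) ++ (O' ++ B)) → τ x = ρ x := by
    rcases hSO : S ++ O with _ | ⟨s, S'⟩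
    · have hS0 := (List.append_eq_nil_iff.1 hSO).1
      have hO0 := (List.append_eq_nil_iff.1 hSO).2
      refine ⟨ρ, g1, ?_, by simp, by simp, fun x _ => rfl⟩
      have : O' = [] := by rw [hO', hO0]; rfl
      rw [hS0, hO0, this] at c1
      rw [this]
      simpa using c1
    · have c1' : ((o, o) :: (A ++ (s :: S') ++ (O' ++ B)) ++ [(o, o)]).IsChain
          fun x y => ρ x = y := by
        rw [← hSO, ← List.append_assoc A S O]; exact c1
      rw [hSO] at hnd'
      obtain ⟨τ, t1, t2, t3, t4⟩ := g1.split_cycle c1' hnd'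
      refine ⟨τ, t1, ?_, ?_, ?_, t4⟩
      · rw [List.append_assoc A O' B]; exact t2
      · intro d hd
        rcases apply_mem_of_chain t3 d hd with h' | h'
        · exact h'
        · rw [h']; simp
      · have ho : ∀ d ∈ s :: S', orb τ s d := fun d hd =>
          orb_of_chain (l := S' ++ [s]) t3 d (by
            rcases List.mem_cons.1 hd with rfl | hd <;> simp [*])
        exact fun d hd e he => Setoid.trans' _ (Setoid.symm' _ (ho d hd)) (ho e he)
  obtain ⟨τ, t1, t2, t3, t4, t5⟩ := hcyc
  have hτσ : ∀ d, d ∉ (o, o) :: (A ++ S ++ B) → d ∉ O → rev V d ∉ O → τ d = σ d := by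
    intro d h1 h2 h3
    rw [t5 d ?_, f1 d h1 h2 h3]
    intro h'
    simp only [List.mem_cons, List.mem_append, memO'] at h1 h'
    tauto
  have hSO : ∀ d, d ∈ S ++ O ↔ H.Adj d.1 d.2 ∧ d.1 = q := by
    intro d
    rw [List.mem_append]
    constructor
    · rintro (hd | hd)
      · exact ⟨((hmemL d).1 (by simp [hd])).1, hS d hd⟩
      · exact ⟨((hO d).1 hd).1, ((hO d).1 hd).2.1⟩
    · rintro ⟨h1, h2⟩
      by_cases h3 : d.2 ∈ Q
      · have := (hmemL d).2 ⟨h1, h2 ▸ hq, h3⟩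
        simp only [List.mem_append] at this
        rcases this with (h' | h') | h'
        · exact absurd h2 (hA d h')
        · exact Or.inl h'
        · exact absurd h2 (hB d h')
      · exact Or.inr ((hO d).2 ⟨h1, h2, h3⟩)
  have hQfix : ∀ d : V × V, d.1 ∈ Q → H.Adj d.1 d.2 → τ d = σ d := by
    intro d h1 h2
    refine hτσ d ?_ ?_ ?_
    · rw [List.mem_cons, hmemL]
      rintro (rfl | h')
      · exact h2.ne rfl
      · exact h'.2.1 h1
    · intro h'
      exact hq (((hO d).1 h').2.1 ▸ h1)
    · intro h'
      exact ((hO _).1 h').2.2 h1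
  refine ⟨τ, t1, ?_, ?_, t2, ?_, ?_, ?_⟩
  · intro d
    simp only [List.mem_append, memO', Finset.mem_insert]
    constructor
    · rintro ((hd | hd) | hd)
      · have := (hmemL d).1 (by simp [hd])
        exact ⟨this.1, fun h' => h'.elim (hA d hd) this.2.1, Or.inr this.2.2⟩
      · obtain ⟨k1, k2, k3⟩ := (hO _).1 hd
        refine ⟨k1.symm, fun h' => h'.elim (fun h4 => k1.ne (k2.trans h4.symm)) k3, Or.inl k2⟩
      · have := (hmemL d).1 (by simp [hd])
        exact ⟨this.1, fun h' => h'.elim (hB d hd) this.2.1, Or.inr this.2.2⟩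
    · rintro ⟨k1, k2, rfl | k3⟩
      · exact Or.inl (Or.inr ((hO _).2 ⟨k1.symm, rfl, fun h' => k2 (Or.inr h')⟩))
      · have := (hmemL d).2 ⟨k1, fun h' => k2 (Or.inr h'), k3⟩
        simp only [List.mem_append] at this
        rcases this with (h' | h') | h'
        · exact Or.inl (Or.inl h')
        · exact absurd (Or.inl (hS d h')) k2
        · exact Or.inr h'
  · have : (A ++ O' ++ B).Sublist ((o, o) :: (A ++ (S ++ O) ++ (O' ++ B))) := by
      refine List.Sublist.cons _ ?_
      rw [List.append_assoc, List.append_assoc]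
      exact List.Sublist.append (List.Sublist.refl _) (List.sublist_append_right _ _)
    exact hnd'.sublist this
  · intro d hd hadj
    rcases Finset.mem_insert.1 hd with hd | hd
    · have := (hSO _).1 (t3 d ((hSO d).2 ⟨hadj, hd⟩))
      exact ⟨this.2.trans hd.symm, this.1⟩
    · rw [hQfix d hd hadj]
      exact h.dart d hd hadj
  · intro p hp r r' hr hr'
    rcases Finset.mem_insert.1 hp with rfl | hp
    · exact t4 _ ((hSO _).2 ⟨hr, rfl⟩) _ ((hSO _).2 ⟨hr', rfl⟩)
    · refine orb_of_eqOn (T := {d | d.1 ∈ Q ∧ H.Adj d.1 d.2}) ?_ ?_ ⟨hp, hr⟩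
        (h.cycle p hp r r' hr hr')
      · rintro d ⟨k1, k2⟩
        have := h.dart d k1 k2
        exact ⟨this.1.symm ▸ k1, this.2⟩
      · rintro d ⟨k1, k2⟩
        exact hQfix d k1 k2
  · intro d hdo hd
    have hno : d ∉ (o, o) :: (A ++ S ++ B) ∧ d ∉ O ∧ rev V d ∉ O := by
      rw [List.mem_cons, hmemL, hO, hO]
      simp only [Finset.mem_insert, not_or] at hd
      refine ⟨?_, ?_, ?_⟩
      · rintro (h' | h')
        · exact hdo h'
        · rcases hd with hd | hd
          · exact hd h'.1
          · exact hd.2.2 h'.2.2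
      · rintro ⟨k1, k2, k3⟩
        rcases hd with hd | hd
        · exact hd k1
        · exact hd.1.1 k2
      · rintro ⟨k1, k2, k3⟩
        rcases hd with hd | hd
        · exact hd k1.symm
        · exact hd.2.1 k2
    rw [hτσ d hno.1 hno.2.1 hno.2.2]
    refine h.fixed d hdo (hd.imp id fun hd => ?_)
    exact ⟨fun h' => hd.1 (Finset.mem_insert_of_mem h'), fun h' => hd.2 (Finset.mem_insert_of_mem h')⟩

end

end

section

open Equiv Equiv.Perm

/-! ### Straight-line graphs are spherical -/

theorem exists_append_of_pairwise {D : Type*} {p : D → Prop} {L : List D}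
    (h : L.Pairwise fun x y => p y → p x) :
    ∃ A B, L = A ++ B ∧ (∀ x ∈ A, p x) ∧ ∀ x ∈ B, ¬ p x := by
  induction L with
  | nil => exact ⟨[], [], rfl, by simp, by simp⟩
  | cons x L ih =>
    rw [List.pairwise_cons] at h
    by_cases hx : p x
    · obtain ⟨A, B, rfl, hA, hB⟩ := ih h.2
      exact ⟨x :: A, B, rfl, by simpa [hx] using hA, hB⟩
    · refine ⟨[], x :: L, rfl, by simp, fun y hy => ?_⟩
      rcases List.mem_cons.1 hy with rfl | hy
      · exact hx
      · exact fun hpy => hx (h.1 y hy hpy)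

theorem exists_sorted_list {D : Type*} (f : D → ℝ) (s : Finset D) :
    ∃ L : List D, L.Nodup ∧ (∀ d, d ∈ L ↔ d ∈ s) ∧ L.Pairwise fun x y => f x ≤ f y := by
  classical
  induction s using Finset.induction_on_max_value f with
  | empty => exact ⟨[], by simp, by simp, by simp⟩
  | insert a s ha hmax ih =>
    obtain ⟨L, h1, h2, h3⟩ := ih
    refine ⟨L ++ [a], ?_, ?_, ?_⟩
    · rw [List.nodup_append]
      refine ⟨h1, List.nodup_singleton a, fun x hx y hy hxy => ?_⟩
      rw [List.mem_singleton] at hy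
      exact ha ((h2 a).1 (hy ▸ hxy ▸ hx))
    · intro d
      rw [List.mem_append, h2, List.mem_singleton, Finset.mem_insert, or_comm]
    · rw [List.pairwise_append]
      refine ⟨h3, List.pairwise_singleton _ _, fun x hx y hy => ?_⟩
      rw [List.mem_singleton] at hy
      exact hy ▸ hmax x ((h2 x).1 hx)

section
variable {V : Type*} (X Y : V → ℝ)

noncomputable def dartSlope (d : V × V) : ℝ := (Y d.1 - Y d.2) / (X d.1 - X d.2)

/-- The height above `t` of the line through the ends of `d`. -/
noncomputable def dartHeight (d : V × V) (t : ℝ) : ℝ := Y d.2 + (t - X d.2) * dartSlope X Y d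

/-- The abscissas of the points of the segment `d`, which is directed from right to left. -/
def dartRange (d : V × V) : Set ℝ := Set.Icc (X d.2) (X d.1)

/-- The segment `d` is below the segment `e` somewhere on their common range. -/
def DartBelow (d e : V × V) : Prop :=
  ∃ t ∈ dartRange X d ∩ dartRange X e, dartHeight X Y d t < dartHeight X Y e t

variable {X Y}

theorem dartHeight_left (d : V × V) : dartHeight X Y d (X d.2) = Y d.2 := by
  simp [dartHeight]

theorem dartHeight_right {d : V × V} (h : X d.2 < X d.1) : dartHeight X Y d (X d.1) = Y d.1 := by
  have : X d.1 - X d.2 ≠ 0 := (sub_pos.2 h).ne'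
  unfold dartHeight dartSlope
  field_simp
  ring

theorem continuous_dartHeight (d : V × V) : Continuous (dartHeight X Y d) := by
  unfold dartHeight
  fun_prop

/-- Two noncrossing segments are not both below each other. -/
theorem DartBelow.asymm {d e : V × V}
    (hN : ∀ t, X d.2 < t → t < X d.1 → X e.2 < t → t < X e.1 →
      dartHeight X Y d t ≠ dartHeight X Y e t) (h : DartBelow X Y d e) : ¬ DartBelow X Y e d := by
  rintro ⟨t₂, ⟨⟨a1, a2⟩, ⟨a3, a4⟩⟩, a5⟩
  obtain ⟨t₁, ⟨⟨b1, b2⟩, ⟨b3, b4⟩⟩, b5⟩ := h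
  have hcont : Continuous fun t => dartHeight X Y e t - dartHeight X Y d t :=
    (continuous_dartHeight e).sub (continuous_dartHeight d)
  -- The difference of heights changes sign, hence vanishes strictly between `t₁` and `t₂`, in the
  -- interior of both ranges.
  rcases lt_trichotomy t₁ t₂ with h | h | h
  · obtain ⟨t, ⟨h1, h2⟩, h3⟩ := intermediate_value_Ioo' h.le hcont.continuousOn
      (show (0 : ℝ) ∈ _ from ⟨sub_neg.2 a5, sub_pos.2 b5⟩)
    exact hN t (by linarith) (by linarith) (by linarith) (by linarith) (sub_eq_zero.1 h3).symm
  · subst h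
    exact lt_asymm a5 b5
  · obtain ⟨t, ⟨h1, h2⟩, h3⟩ := intermediate_value_Ioo h.le hcont.continuousOn
      (show (0 : ℝ) ∈ _ from ⟨sub_neg.2 a5, sub_pos.2 b5⟩)
    exact hN t (by linarith) (by linarith) (by linarith) (by linarith) (sub_eq_zero.1 h3).symm

variable [Fintype V] [DecidableEq V] {H : SimpleGraph V}

/-- A graph drawn with straight edges, no two of which cross, and with different abscissas of
the vertices, is spherical. -/
theorem isSpherical_of_heights (hX : Function.Injective X)
    (hN : ∀ d e : V × V, d ≠ e → H.Adj d.1 d.2 → H.Adj e.1 e.2 →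
      ∀ t, X d.2 < t → t < X d.1 → X e.2 < t → t < X e.1 →
        dartHeight X Y d t ≠ dartHeight X Y e t)
    (hO : ∀ (d : V × V) (q : V), H.Adj d.1 d.2 → X d.2 < X q → X q < X d.1 →
      dartHeight X Y d (X q) ≠ Y q) : IsSpherical H := by
  classical
  rcases isEmpty_or_nonempty V with hV | ⟨⟨o⟩⟩
  · exact ⟨1, ⟨fun _ => rfl, fun _ _ _ => rfl, fun u => isEmptyElim u⟩, genusZero_one _⟩
  -- The sweep runs from left to right; `L` lists the segments with exactly one swept end, from
  -- bottom to top.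
  have key : ∀ n ≤ Fintype.card V, ∃ (Q : Finset V) (σ : Perm (V × V)) (L : List (V × V)),
      Q.card = n ∧ (∀ p ∈ Q, ∀ r ∉ Q, X p < X r) ∧ SweepState H o Q σ L ∧
      L.Pairwise (DartBelow X Y) := by
    intro n
    induction n with
    | zero => exact fun _ => ⟨∅, 1, [], rfl, by simp, sweepState_empty H o, List.Pairwise.nil⟩
    | succ n ih =>
      intro hn
      obtain ⟨Q, σ, L, hQn, hlow, hst, hL⟩ := ih (by omega)
      have hne : (Qᶜ : Finset V).Nonempty := by
        rw [← Finset.card_pos, Finset.card_compl]; omega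
      obtain ⟨q, hq, hmin⟩ := Finset.exists_min_image Qᶜ X hne
      rw [Finset.mem_compl] at hq
      have hmin' : ∀ r, r ∉ Q → r ≠ q → X q < X r := fun r hr hrq =>
        lt_of_le_of_ne (hmin r (Finset.mem_compl.2 hr)) fun h => hrq (hX h).symm
      have hright : ∀ d ∈ L, X q ≤ X d.1 := fun d hd =>
        hmin d.1 (Finset.mem_compl.2 ((hst.mem d).1 hd).2.1)
      have hleft : ∀ d ∈ L, X d.2 < X q := fun d hd => hlow _ ((hst.mem d).1 hd).2.2 q hq
      have hrange : ∀ d ∈ L, X q ∈ dartRange X d := fun d hd => ⟨(hleft d hd).le, hright d hd⟩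
      have hat : ∀ d ∈ L, d.1 = q → dartHeight X Y d (X q) = Y q := fun d hd hdq => by
        subst hdq; exact dartHeight_right (hleft d hd)
      have hoff : ∀ d ∈ L, d.1 ≠ q → dartHeight X Y d (X q) ≠ Y q := fun d hd hdq =>
        hO d q ((hst.mem d).1 hd).1 (hleft d hd) (hmin' _ ((hst.mem d).1 hd).2.1 hdq)
      have hasymm : ∀ d ∈ L, ∀ e ∈ L, DartBelow X Y d e →
          ¬ dartHeight X Y e (X q) < dartHeight X Y d (X q) := by
        intro d hd e he hde hlt
        have hne : d ≠ e := by rintro rfl; exact lt_irrefl _ hlt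
        exact hde.asymm (hN d e hne ((hst.mem d).1 hd).1 ((hst.mem e).1 he).1)
          ⟨X q, ⟨hrange e he, hrange d hd⟩, hlt⟩
      -- The vertical order cuts the list at `q`: `A` passes below `q`, `S` ends at `q`, and `B`
      -- passes above.
      obtain ⟨A, L', rfl, hA, hL'⟩ := exists_append_of_pairwise
        (p := fun d => d.1 ≠ q ∧ dartHeight X Y d (X q) < Y q) (L := L)
        (hL.imp_of_mem fun {d e} hd he hde hpe => by
          by_contra hpd
          refine hasymm d hd e he hde ?_
          by_cases hdq : d.1 = q
          · rw [hat d hd hdq]; exact hpe.2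
          · exact hpe.2.trans_le (not_lt.1 fun h => hpd ⟨hdq, h⟩))
      obtain ⟨S, B, rfl, hS, hB⟩ := exists_append_of_pairwise (p := fun d => d.1 = q) (L := L')
        ((List.pairwise_append.1 hL).2.1.imp_of_mem fun {d e} hd he hde hpe => by
          by_contra hpd
          have hd' : d ∈ A ++ L' := List.mem_append_right _ hd
          have he' : e ∈ A ++ L' := List.mem_append_right _ he
          refine hasymm d hd' e he' hde ?_
          rw [hat e he' hpe]
          refine lt_of_le_of_ne (not_lt.1 fun h => hL' d hd ⟨hpd, h⟩) ?_
          exact (hoff d hd' hpd).symm)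
      have hAq : ∀ d ∈ A, dartHeight X Y d (X q) < Y q := fun d hd => (hA d hd).2
      have hBq : ∀ d ∈ B, Y q < dartHeight X Y d (X q) := fun d hd => by
        have h1 : d ∈ S ++ B := List.mem_append_right _ hd
        have h2 := hL' d h1
        have h3 := hoff d (List.mem_append_right _ h1) (hB d hd)
        exact lt_of_le_of_ne (not_lt.1 fun h => h2 ⟨hB d hd, h⟩) h3.symm
      obtain ⟨M, hMn, hM, hMs⟩ := exists_sorted_list (dartSlope X Y)
        (Finset.univ.filter fun d : V × V => H.Adj d.1 d.2 ∧ d.2 = q ∧ d.1 ∉ Q)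
      have hM' : ∀ d, d ∈ M ↔ H.Adj d.1 d.2 ∧ d.2 = q ∧ d.1 ∉ Q := fun d => by
        rw [hM, Finset.mem_filter]; simp
      have hMrange : ∀ d ∈ M, X q < X d.1 := fun d hd =>
        hmin' _ ((hM' d).1 hd).2.2 fun h => ((hM' d).1 hd).1.ne (h.trans ((hM' d).1 hd).2.1.symm)
      have hMrange' : ∀ d ∈ M, X q ∈ dartRange X d := fun d hd =>
        ⟨((hM' d).1 hd).2.1 ▸ le_rfl, (hMrange d hd).le⟩
      have hMat : ∀ d ∈ M, dartHeight X Y d (X q) = Y q := fun d hd => by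
        rw [← ((hM' d).1 hd).2.1]; exact dartHeight_left d
      rw [← List.append_assoc] at hst
      -- The step reverses and flips `O`; this choice of `O` puts exactly `M`, sorted by slope, into
      -- the list.
      obtain ⟨τ, hτ⟩ := hst.step hq hS (fun d hd => (hA d hd).1) hB
        (O := (M.map (rev V)).reverse) (List.nodup_reverse.2 (hMn.map (rev V).injective))
        (fun d => by
          rw [List.mem_reverse, List.mem_map]
          constructor
          · rintro ⟨e, he, rfl⟩
            exact ⟨((hM' e).1 he).1.symm, ((hM' e).1 he).2⟩
          · rintro ⟨h1, h2⟩
            exact ⟨rev V d, (hM' _).2 ⟨h1.symm, h2⟩, rfl⟩)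
      have hMM : (((M.map (rev V)).reverse).map (rev V)).reverse = M := by
        rw [List.map_reverse, List.reverse_reverse, List.map_map]
        exact List.map_id M
      rw [hMM] at hτ
      refine ⟨insert q Q, τ, _, by rw [Finset.card_insert_of_notMem hq, hQn], ?_, hτ, ?_⟩
      · intro p hp r hr
        rw [Finset.mem_insert, not_or] at hr
        rcases Finset.mem_insert.1 hp with rfl | hp
        · exact hmin' r hr.2 hr.1
        · exact hlow p hp r hr.2
      · obtain ⟨p1, p2, p3⟩ := List.pairwise_append.1 hL
        obtain ⟨-, p4, -⟩ := List.pairwise_append.1 p2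
        have hMb : M.Pairwise (DartBelow X Y) := by
          refine (hMs.and hMn).imp_of_mem fun {d e} hd he hde => ?_
          have hd2 := ((hM' d).1 hd).2.1
          have he2 := ((hM' e).1 he).2.1
          have hlt : dartSlope X Y d < dartSlope X Y e := by
            refine lt_of_le_of_ne hde.1 fun heq => ?_
            -- Two segments leaving `q` with equal slope would overlap just to the right of `q`.
            obtain ⟨t, ht1, ht2⟩ := exists_between (lt_min (hMrange d hd) (hMrange e he))
            rw [lt_min_iff] at ht2
            refine hN d e hde.2 ((hM' d).1 hd).1 ((hM' e).1 he).1 t (by rwa [hd2]) ht2.1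
              (by rwa [he2]) ht2.2 ?_
            unfold dartHeight
            rw [hd2, he2, heq]
          have hpos := lt_min (hMrange d hd) (hMrange e he)
          refine ⟨min (X d.1) (X e.1), ⟨⟨by rw [hd2]; exact hpos.le, min_le_left _ _⟩,
            ⟨by rw [he2]; exact hpos.le, min_le_right _ _⟩⟩, ?_⟩
          unfold dartHeight
          rw [hd2, he2]
          have := mul_lt_mul_of_pos_left hlt (sub_pos.2 hpos)
          linarith
        have hmemA : ∀ d ∈ A, X q ∈ dartRange X d := fun d hd =>
          hrange d (List.mem_append_left _ hd)
        have hmemB : ∀ d ∈ B, X q ∈ dartRange X d := fun d hd =>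
          hrange d (List.mem_append_right _ (List.mem_append_right _ hd))
        rw [List.append_assoc, List.pairwise_append, List.pairwise_append]
        refine ⟨p1, ⟨hMb, p4, ?_⟩, ?_⟩
        · intro d hd e he
          exact ⟨X q, ⟨hMrange' d hd, hmemB e he⟩, by rw [hMat d hd]; exact hBq e he⟩
        · intro d hd e he
          rcases List.mem_append.1 he with he | he
          · exact ⟨X q, ⟨hmemA d hd, hMrange' e he⟩, by rw [hMat e he]; exact hAq d hd⟩
          · exact p3 d hd e (List.mem_append_right _ he)
  obtain ⟨Q, σ, L, hQ, -, hst, -⟩ := key _ le_rfl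
  rw [Finset.card_eq_iff_eq_univ] at hQ
  subst hQ
  exact hst.isSpherical

end

end

/-! ### From plane drawings to rotation systems -/

/-! ### Corners of a polygonal arc -/

namespace PolygonalArc

variable (A : PolygonalArc)

theorem left_mem (i : ℕ) : A.corner i ∈ segment ℝ (A.corner i) (A.corner (i + 1)) :=
  left_mem_segment ℝ _ _

theorem right_mem (i : ℕ) : A.corner (i + 1) ∈ segment ℝ (A.corner i) (A.corner (i + 1)) :=
  right_mem_segment ℝ _ _

theorem eq_of_corner_mem {k i : ℕ} (hk : k ≤ A.n) (hi : i < A.n)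
    (h : A.corner k ∈ segment ℝ (A.corner i) (A.corner (i + 1))) : k = i ∨ k = i + 1 := by
  rcases hk.lt_or_eq with hk | hk
  · rcases lt_trichotomy k i with hki | hki | hki
    · obtain ⟨h1, h2⟩ := A.simple k i hki hi _ ⟨A.left_mem k, h⟩
      rw [h1] at h2
      exact absurd h2 (A.corner_ne k hk)
    · exact Or.inl hki
    · exact Or.inr (A.simple i k hki hk _ ⟨h, A.left_mem k⟩).1
  · obtain ⟨j, rfl⟩ : ∃ j, k = j + 1 := ⟨k - 1, by omega⟩
    rcases (show i ≤ j by omega).lt_or_eq with hij | hij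
    · obtain ⟨-, h2⟩ := A.simple i j hij (by omega) _ ⟨h, A.right_mem j⟩
      exact absurd h2.symm (A.corner_ne j (by omega))
    · exact Or.inr (by rw [hij])

theorem corner_injOn {j k : ℕ} (hj : j ≤ A.n) (hk : k ≤ A.n) (h : A.corner j = A.corner k) :
    j = k := by
  have key : ∀ {j k}, j < k → k ≤ A.n → A.corner j ≠ A.corner k := by
    intro j k hjk hk h
    have hmem : A.corner k ∈ segment ℝ (A.corner j) (A.corner (j + 1)) := h ▸ A.left_mem j
    rcases A.eq_of_corner_mem hk (by omega) hmem with h1 | h1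
    · omega
    · exact A.corner_ne j (by omega) (h1 ▸ h)
  rcases lt_trichotomy j k with h1 | h1 | h1
  · exact absurd h (key h1 hk)
  · exact h1
  · exact absurd h.symm (key h1 hj)

theorem corner_mem_carrier {k : ℕ} (hk : k ≤ A.n) : A.corner k ∈ A.carrier := by
  rcases hk.lt_or_eq with hk | hk
  · exact ⟨k, hk, A.left_mem k⟩
  · have := A.n_pos
    refine ⟨k - 1, by omega, ?_⟩
    have h := A.right_mem (k - 1)
    rwa [Nat.sub_add_cancel (by omega)] at h ⊢

end PolygonalArc

/-- A shear of the plane after which the points of a finite set have different abscissas. -/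
theorem exists_shear_injOn {P : Set (ℝ × ℝ)} (hP : P.Finite) :
    ∃ c : ℝ, Set.InjOn (fun p : ℝ × ℝ => p.1 + c * p.2) P := by
  -- Only finitely many shears give two of the points the same abscissa.
  obtain ⟨c, hc⟩ := ((hP.prod hP).image fun pq : (ℝ × ℝ) × (ℝ × ℝ) =>
    -(pq.1.1 - pq.2.1) / (pq.1.2 - pq.2.2)).exists_notMem
  refine ⟨c, fun p hp q hq hpq => ?_⟩
  simp only at hpq
  by_cases h : p.2 = q.2
  · exact Prod.ext (by rw [h] at hpq; linarith) h
  · refine absurd ⟨(p, q), ⟨hp, hq⟩, ?_⟩ hc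
    have h' : p.2 - q.2 ≠ 0 := sub_ne_zero.2 h
    field_simp
    linarith

/-- The point of a segment at a given abscissa. -/
theorem dartHeight_mem_segment {W : Type*} {f : W → ℝ × ℝ} {c : ℝ} {d : W × W} {t : ℝ}
    (hd : (f d.2).1 + c * (f d.2).2 < (f d.1).1 + c * (f d.1).2)
    (h1 : (f d.2).1 + c * (f d.2).2 ≤ t) (h2 : t ≤ (f d.1).1 + c * (f d.1).2) :
    ((t - c * dartHeight (fun w => (f w).1 + c * (f w).2) (fun w => (f w).2) d t,
      dartHeight (fun w => (f w).1 + c * (f w).2) (fun w => (f w).2) d t) : ℝ × ℝ) ∈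
      segment ℝ (f d.2) (f d.1) := by
  have hpos := sub_pos.2 hd
  have hne := hpos.ne'
  rw [segment_eq_image]
  refine ⟨(t - ((f d.2).1 + c * (f d.2).2)) /
    ((f d.1).1 + c * (f d.1).2 - ((f d.2).1 + c * (f d.2).2)),
    ⟨div_nonneg (sub_nonneg.2 h1) hpos.le, (div_le_one hpos).2 (by linarith)⟩, ?_⟩
  simp only [dartHeight, dartSlope]
  refine Prod.ext ?_ ?_
  · simp only [Prod.fst_add, Prod.smul_fst, smul_eq_mul]
    field_simp
    ring
  · simp only [Prod.snd_add, Prod.smul_snd, smul_eq_mul]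
    field_simp
    ring

/-! ### The straight-line subdivision and the contraction of arcs -/

namespace PlaneDrawing

variable {V : Type*} {G : SimpleGraph V} (P : PlaneDrawing G)

theorem pos_eq_of_mem {e : G.edgeSet} {v : V} (hv : v ∈ (e : Sym2 V)) :
    P.pos v = (P.arc e).corner 0 ∨ P.pos v = (P.arc e).corner (P.arc e).n := by
  have : P.pos v ∈ (P.arc e).ends := by
    rw [P.arc_ends]
    exact Sym2.mem_map.2 ⟨v, hv, rfl⟩
  exact Sym2.mem_iff.1 this

/-- A point of two different arcs is an end of either. -/
theorem eq_end_of_mem {e f : G.edgeSet} (hef : e ≠ f) {x : ℝ × ℝ} (he : x ∈ (P.arc e).carrier)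
    (hf : x ∈ (P.arc f).carrier) :
    x = (P.arc e).corner 0 ∨ x = (P.arc e).corner (P.arc e).n := by
  obtain ⟨v, hv, -, rfl⟩ := P.disjoint e f hef x ⟨he, hf⟩
  exact P.pos_eq_of_mem hv

/-- The positions of the vertices and the corners of the arcs. -/
def points : Set (ℝ × ℝ) :=
  Set.range P.pos ∪ {x | ∃ e, ∃ i ≤ (P.arc e).n, (P.arc e).corner i = x}

theorem finite_points [Finite V] : P.points.Finite := by
  refine (Set.finite_range _).union ?_
  have : {x | ∃ e, ∃ i ≤ (P.arc e).n, (P.arc e).corner i = x} =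
      ⋃ e, (P.arc e).corner '' {i | i ≤ (P.arc e).n} := by
    ext x; simp
  rw [this]
  exact Set.finite_iUnion fun e => (Set.finite_le_nat _).image _

theorem corner_mem_points {e : G.edgeSet} {i : ℕ} (hi : i ≤ (P.arc e).n) :
    (P.arc e).corner i ∈ P.points := Or.inr ⟨e, i, hi, rfl⟩

/-- A point of the drawing on a segment of an arc is an end of the segment. -/
theorem eq_of_mem_segment {e : G.edgeSet} {i : ℕ} (hi : i < (P.arc e).n) {x : ℝ × ℝ}
    (hx : x ∈ P.points)
    (h : x ∈ segment ℝ ((P.arc e).corner i) ((P.arc e).corner (i + 1))) :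
    x = (P.arc e).corner i ∨ x = (P.arc e).corner (i + 1) := by
  have key : ∀ k ≤ (P.arc e).n, x = (P.arc e).corner k →
      x = (P.arc e).corner i ∨ x = (P.arc e).corner (i + 1) := by
    rintro k hk rfl
    rcases (P.arc e).eq_of_corner_mem hk hi h with rfl | rfl
    · exact Or.inl rfl
    · exact Or.inr rfl
  have key' : x = (P.arc e).corner 0 ∨ x = (P.arc e).corner (P.arc e).n →
      x = (P.arc e).corner i ∨ x = (P.arc e).corner (i + 1) := fun h' =>
    h'.elim (key 0 (Nat.zero_le _)) (key _ le_rfl)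
  rcases hx with ⟨v, rfl⟩ | ⟨f, k, hk, rfl⟩
  · exact key' (P.pos_eq_of_mem (P.vertex_mem e v ⟨i, hi, h⟩))
  · by_cases hef : e = f
    · subst hef; exact key k hk rfl
    · exact key' (P.eq_end_of_mem hef ⟨i, hi, h⟩ ((P.arc f).corner_mem_carrier hk))

/-- A common point of two different segments is an end of the first one. -/
theorem eq_of_mem_segment_of_mem_segment {e f : G.edgeSet} {i j : ℕ} (hi : i < (P.arc e).n)
    (hj : j < (P.arc f).n) {x : ℝ × ℝ}
    (h : x ∈ segment ℝ ((P.arc e).corner i) ((P.arc e).corner (i + 1)))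
    (h' : x ∈ segment ℝ ((P.arc f).corner j) ((P.arc f).corner (j + 1))) :
    (e = f ∧ i = j) ∨ x = (P.arc e).corner i ∨ x = (P.arc e).corner (i + 1) := by
  by_cases hef : e = f
  · subst hef
    rcases lt_trichotomy i j with hij | hij | hij
    · obtain ⟨h1, h2⟩ := (P.arc e).simple i j hij hj x ⟨h, h'⟩
      exact Or.inr (Or.inr (by rw [h2, h1]))
    · exact Or.inl ⟨rfl, hij⟩
    · exact Or.inr (Or.inl ((P.arc e).simple j i hij hi x ⟨h', h⟩).2)
  · refine Or.inr (P.eq_of_mem_segment hi ?_ h)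
    rcases P.eq_end_of_mem hef ⟨i, hi, h⟩ ⟨j, hj, h'⟩ with h1 | h1
    · rw [h1]; exact P.corner_mem_points (Nat.zero_le _)
    · rw [h1]; exact P.corner_mem_points le_rfl

/-- The graph on the points of the drawing in which the first `m e + 1` segments of every arc `e`
are replaced by one edge. -/
def subdivision (m : G.edgeSet → ℕ) : SimpleGraph P.points where
  Adj p q := p ≠ q ∧ ∃ e, s(p.1, q.1) = s((P.arc e).corner 0, (P.arc e).corner (m e + 1)) ∨
    ∃ i, m e < i ∧ i < (P.arc e).n ∧ s(p.1, q.1) = s((P.arc e).corner i, (P.arc e).corner (i + 1))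
  symm := ⟨fun p q ⟨h1, h2⟩ => ⟨h1.symm, by rwa [Sym2.eq_swap]⟩⟩
  loopless := ⟨fun _ h => h.1 rfl⟩

theorem subdivision_zero_adj {p q : P.points} (h : (P.subdivision 0).Adj p q) :
    ∃ e i, i < (P.arc e).n ∧
      s(p.1, q.1) = s((P.arc e).corner i, (P.arc e).corner (i + 1)) := by
  obtain ⟨-, e, h | ⟨i, -, hi, h⟩⟩ := h
  · exact ⟨e, 0, (P.arc e).n_pos, h⟩
  · exact ⟨e, i, hi, h⟩

theorem segment_eq_of_sym2_eq {a b c d : ℝ × ℝ} (h : s(a, b) = s(c, d)) :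
    segment ℝ b a = segment ℝ c d := by
  rcases Sym2.eq_iff.1 h with ⟨rfl, rfl⟩ | ⟨rfl, rfl⟩
  · exact segment_symm ℝ _ _
  · rfl

theorem isSpherical_subdivision_zero [Finite V] : IsSpherical (P.subdivision 0) := by
  classical
  have := P.finite_points.fintype
  obtain ⟨c, hc⟩ := exists_shear_injOn P.finite_points
  have hX : Function.Injective fun p : P.points => p.1.1 + c * p.1.2 := fun p q h =>
    Subtype.ext (hc p.2 q.2 h)
  have hends : ∀ {a b u v x : ℝ × ℝ}, s(a, b) = s(u, v) → (x = u ∨ x = v) → x = a ∨ x = b := by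
    intro a b u v x h hx
    rcases Sym2.eq_iff.1 h with ⟨rfl, rfl⟩ | ⟨rfl, rfl⟩ <;> tauto
  refine isSpherical_of_heights (X := fun p : P.points => p.1.1 + c * p.1.2)
    (Y := fun p => p.1.2) hX ?_ ?_
  · intro d e hde hd he t h1 h2 h3 h4 heq
    obtain ⟨a, i, hi, hdi⟩ := P.subdivision_zero_adj hd
    obtain ⟨b, j, hj, hej⟩ := P.subdivision_zero_adj he
    have m1 := dartHeight_mem_segment (f := fun p : P.points => p.1) (c := c) (d := d) (t := t)
      (h1.trans h2) h1.le h2.le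
    have m2 := dartHeight_mem_segment (f := fun p : P.points => p.1) (c := c) (d := e) (t := t)
      (h3.trans h4) h3.le h4.le
    rw [← heq, segment_eq_of_sym2_eq hej] at m2
    rw [segment_eq_of_sym2_eq hdi] at m1
    rcases P.eq_of_mem_segment_of_mem_segment hi hj m1 m2 with ⟨rfl, rfl⟩ | h
    · rcases Sym2.eq_iff.1 (hdi.trans hej.symm) with ⟨k1, k2⟩ | ⟨k1, k2⟩
      · exact hde (Prod.ext (Subtype.ext k1) (Subtype.ext k2))
      · have k1' : d.1 = e.2 := Subtype.ext k1
        have k2' : d.2 = e.1 := Subtype.ext k2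
        simp only [k1', k2'] at h1 h2
        linarith
    · rcases hends hdi h with h | h
      · rw [← h] at h2
        simp at h2
      · rw [← h] at h1
        simp at h1
  · intro d q hd h1 h2 heq
    obtain ⟨a, i, hi, hdi⟩ := P.subdivision_zero_adj hd
    have m1 := dartHeight_mem_segment (f := fun p : P.points => p.1) (c := c) (d := d)
      (h1.trans h2) h1.le h2.le
    rw [segment_eq_of_sym2_eq hdi] at m1
    rw [heq, add_sub_cancel_right] at m1
    rcases hends hdi (P.eq_of_mem_segment hi q.2 m1) with h | h
    · have : q = d.1 := Subtype.ext h
      rw [this] at h2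
      exact lt_irrefl _ h2
    · have : q = d.2 := Subtype.ext h
      rw [this] at h1
      exact lt_irrefl _ h1

/-- An inner corner of an arc is not a corner of any other arc. -/
theorem eq_of_corner_eq {e f : G.edgeSet} {i k : ℕ} (hi : 0 < i) (hin : i < (P.arc e).n)
    (hk : k ≤ (P.arc f).n) (h : (P.arc f).corner k = (P.arc e).corner i) : f = e ∧ k = i := by
  by_cases hef : e = f
  · subst hef
    exact ⟨rfl, (P.arc e).corner_injOn hk hin.le h⟩
  · rcases P.eq_end_of_mem hef ((P.arc e).corner_mem_carrier hin.le)
      (h ▸ (P.arc f).corner_mem_carrier hk) with h1 | h1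
    · have := (P.arc e).corner_injOn hin.le (Nat.zero_le _) h1
      omega
    · have := (P.arc e).corner_injOn hin.le le_rfl h1
      omega

/-- Induction on the total of `m`: with `m e = k + 1`, contracting corner `k + 1` into corner 0
turns the next segment of the arc into an edge from corner 0 to corner `k + 2`. -/
theorem isSpherical_subdivision [Finite V] (m : G.edgeSet → ℕ) (hm : ∀ e, m e < (P.arc e).n) :
    IsSpherical (P.subdivision m) := by
  classical
  have := P.finite_points.fintype
  have := Fintype.ofFinite G.edgeSet
  induction hN : ∑ e, m e generalizing m with
  | zero =>
    have : m = 0 := funext fun e => (Finset.sum_eq_zero_iff.1 hN) e (Finset.mem_univ e)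
    rw [this]
    exact P.isSpherical_subdivision_zero
  | succ N ih =>
    obtain ⟨e, -, he⟩ := Finset.exists_ne_zero_of_sum_ne_zero (by rw [hN]; omega : ∑ e, m e ≠ 0)
    obtain ⟨k, hk⟩ : ∃ k, m e = k + 1 := ⟨m e - 1, by omega⟩
    have hkn : k + 1 < (P.arc e).n := hk ▸ hm e
    set m' := Function.update m e k with hm'
    have e1 : m' e = k := Function.update_self _ _ _
    have e2 : ∀ f, f ≠ e → m' f = m f := fun f hf => Function.update_of_ne hf _ _
    have hsum : ∑ f, m' f = N := by
      have h1 := Finset.add_sum_erase Finset.univ m (Finset.mem_univ e)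
      have h2 := Finset.add_sum_erase Finset.univ m' (Finset.mem_univ e)
      have h3 : ∑ f ∈ Finset.univ.erase e, m' f = ∑ f ∈ Finset.univ.erase e, m f :=
        Finset.sum_congr rfl fun f hf => e2 f (Finset.ne_of_mem_erase hf)
      rw [h3] at h2
      omega
    have hsph := ih m' (fun f => by
      by_cases hf : f = e
      · rw [hf, e1]; omega
      · rw [e2 f hf]; exact hm f) hsum
    let z : P.points := ⟨_, P.corner_mem_points (e := e) (Nat.zero_le _)⟩
    let v : P.points := ⟨_, P.corner_mem_points (e := e) hkn.le⟩
    have hzv : (P.subdivision m').Adj z v := by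
      refine ⟨fun h => ?_, e, Or.inl (by rw [e1])⟩
      have := (P.arc e).corner_injOn (Nat.zero_le _) hkn.le (Subtype.ext_iff.1 h)
      omega
    refine (hsph.contractPair hzv).mono ?_
    rintro p q ⟨hpq, f, hf⟩
    have hv : p ≠ v ∧ q ≠ v := by
      have aux : ∀ a b, a ≤ (P.arc f).n → b ≤ (P.arc f).n → (f = e → a ≠ k + 1 ∧ b ≠ k + 1) →
          s(p.1, q.1) = s((P.arc f).corner a, (P.arc f).corner b) → p ≠ v ∧ q ≠ v := by
        intro a b ha hb hab h
        have na : (P.arc f).corner a ≠ (P.arc e).corner (k + 1) := fun h' => by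
          obtain ⟨h1, h2⟩ := P.eq_of_corner_eq (Nat.succ_pos k) hkn ha h'
          exact (hab h1).1 h2
        have nb : (P.arc f).corner b ≠ (P.arc e).corner (k + 1) := fun h' => by
          obtain ⟨h1, h2⟩ := P.eq_of_corner_eq (Nat.succ_pos k) hkn hb h'
          exact (hab h1).2 h2
        rcases Sym2.eq_iff.1 h with ⟨h1, h2⟩ | ⟨h1, h2⟩
        · exact ⟨fun h' => na (h1.symm.trans (congrArg Subtype.val h')),
            fun h' => nb (h2.symm.trans (congrArg Subtype.val h'))⟩
        · exact ⟨fun h' => nb (h1.symm.trans (congrArg Subtype.val h')),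
            fun h' => na (h2.symm.trans (congrArg Subtype.val h'))⟩
      rcases hf with hf | ⟨i, hi, hin, hf⟩
      · refine aux 0 (m f + 1) (Nat.zero_le _) (hm f) (fun h => ?_) hf
        rw [h, hk]; omega
      · refine aux i (i + 1) hin.le hin (fun h => ?_) hf
        rw [h, hk] at hi; omega
    refine ⟨hpq, hv.1, hv.2, ?_⟩
    by_cases hfe : f = e
    · subst hfe
      rcases hf with hf | ⟨i, hi, hin, hf⟩
      · have hvadj : ∀ q : P.points, q ≠ v → q.1 = (P.arc f).corner (m f + 1) →
            (P.subdivision m').Adj v q := fun q hq h =>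
          ⟨hq.symm, f, Or.inr ⟨k + 1, by omega, hkn, by rw [h, hk]⟩⟩
        rcases Sym2.eq_iff.1 hf with ⟨h1, h2⟩ | ⟨h1, h2⟩
        · exact Or.inr (Or.inl ⟨Subtype.ext h1, hvadj q hv.2 h2⟩)
        · exact Or.inr (Or.inr ⟨Subtype.ext h2, hvadj p hv.1 h1⟩)
      · exact Or.inl ⟨hpq, f, Or.inr ⟨i, by omega, hin, hf⟩⟩
    · refine Or.inl ⟨hpq, f, ?_⟩
      rw [e2 f hfe]
      exact hf

end PlaneDrawing

/-- Every planar graph has a spanning subgraph `F` that is 1-degenerate such that `G - E(F)` is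
2-degenerate. -/
theorem IsPlanar.exists_forest {V : Type*} [Fintype V] {G : SimpleGraph V} (hG : IsPlanar G) :
    ∃ (F : SimpleGraph V) (r s : V → ℕ), F ≤ G ∧
      (∀ u, {u' | (G.deleteEdges F.edgeSet).Adj u u' ∧ r u' ≤ r u}.ncard ≤ 2) ∧
      (∀ u, {u' | F.Adj u u' ∧ s u' ≤ s u}.ncard ≤ 1) := by
  classical
  obtain ⟨P⟩ := hG
  have := P.finite_points.fintype
  -- With this `m` each arc becomes a single edge between its ends, so `G` embeds in the resulting
  -- graph and the forest and ranks pull back.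
  have hsph := P.isSpherical_subdivision (fun e => (P.arc e).n - 1) fun e =>
    Nat.sub_lt (P.arc e).n_pos one_pos
  let f : V → P.points := fun v => ⟨P.pos v, Or.inl ⟨v, rfl⟩⟩
  have hf : Function.Injective f := fun u v h => P.pos_injective (congrArg Subtype.val h)
  have hadj : ∀ u v, G.Adj u v →
      (P.subdivision fun e => (P.arc e).n - 1).Adj (f u) (f v) := by
    intro u v huv
    refine ⟨fun h => huv.ne (hf h), ⟨s(u, v), huv⟩, Or.inl ?_⟩
    rw [Nat.sub_add_cancel (P.arc _).n_pos]
    have := P.arc_ends ⟨s(u, v), huv⟩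
    rw [Sym2.map_mk] at this
    exact this.symm
  obtain ⟨F, r, s, -, hr, hs⟩ := hsph.exists_forest
  refine ⟨F.comap f ⊓ G, r ∘ f, s ∘ f, inf_le_right, fun u => ?_, fun u => ?_⟩
  · refine (Set.ncard_le_ncard_of_injOn f ?_ hf.injOn (Set.toFinite _)).trans (hr (f u))
    rintro u' ⟨h1, h2⟩
    rw [SimpleGraph.deleteEdges_adj, SimpleGraph.mem_edgeSet] at h1
    exact ⟨hadj _ _ h1.1, fun h => h1.2 ⟨h, h1.1⟩, h2⟩
  · refine (Set.ncard_le_ncard_of_injOn f ?_ hf.injOn (Set.toFinite _)).trans (hs (f u))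
    rintro u' ⟨h1, h2⟩
    exact ⟨h1.1, h2⟩

theorem theorem3p1 {V : Type u} [Fintype V] [LinearOrder V] (G : SimpleGraph V)
    (hG : IsPlanar G) :
    ∃ F : SimpleGraph V, F ≤ G ∧ F.IsAcyclic ∧
      alonTarsiNumber (G.deleteEdges F.edgeSet) ≤ 3 ∧
      IsPaintable (G.deleteEdges F.edgeSet) 3 ∧
      IsChoosable.{u, w} (G.deleteEdges F.edgeSet) 3 := by
  obtain ⟨F, r, s, hF, hr, hs⟩ := hG.exists_forest
  exact ⟨F, hF, isAcyclic_of_ncard_le_one hs, alonTarsiNumber_le_of_degenerate hr,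
    isPaintable_of_degenerate hr, isChoosable_of_degenerate hr⟩
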